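/- Let $\mu,\nu$ be Borel probability measures on $\mathbb R$ with bounded support. For measures $\gamma,\rho$ put $\operatorname{Ent}(\gamma|\rho)=\int\log\frac{d\gamma}{d\rho}\,d\gamma$ if $\gamma\ll\rho$ and $\operatorname{Ent}(\gamma|\rho)=+\infty$ otherwise, and assume that $\operatorname{Ent}(\mu|\mathcal L^1)<+\infty$ and $\operatorname{Ent}(\nu|\mathcal L^1)<+\infty$, where $\mathcal L^1$ is Lebesgue measure; in particular $\mu,\nu\ll\mathcal L^1$. Let $\Pi(\mu,\nu)$ be the set of probability measures on $\mathbb R^2$ with marginals $\mu$ and $\nu$, with the topology of narrow convergence, let $W_1(\mu,\nu)=\min_{\gamma\in\Pi(\mu,\nu)}\int|y-x|\,d\gamma(x,y)$, and let $\mathcal O_1(\mu,\nu)\subset\Pi(\mu,\nu)$ be the set of minimizers (the optimal plans). Let $F_\mu,F_\nu$ be the cumulative distribution functions and $A=\{x\in\mathbb R: F_\mu(x)=F_\nu(x)\}$. Assume: (H1) $A\cap\operatorname{supp}\mu$ has Lebesgue-negligible boundary, and its interior is $\bigcup_i(a_i,b_i)$ with pairwise disjoint nonempty open intervals such that $$-\sum_i\int_{a_i}^{b_i}\log\bigl(\min\{x-a_i,\,b_i-x\}\bigr)\,d\mu(x)<+\infty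 .$$ (H2) There is $\gamma\in\mathcal O_1(\mu,\nu)$ with $\operatorname{Ent}\bigl(\gamma\llcorner(\mathbb R\setminus A)^2\,\big|\,\mu\otimes\nu\bigr)<+\infty$. For $\varepsilon>0$ and $\gamma\in\Pi(\mu,\nu)$ put $J_\varepsilon(\gamma)=\int|y-x|\,d\gamma+\varepsilon\operatorname{Ent}(\gamma|\mu\otimes\nu)$ and $$F_\varepsilon(\gamma)=\frac1\varepsilon\Bigl(\int|y-x|\,d\gamma-W_1(\mu,\nu)\Bigr)+\operatorname{Ent}(\gamma|\mu\otimes\nu)-|\log(2\varepsilon)|\,\mu(A).$$ Then $\log\frac{d\mu}{d\mathcal L^1}$ is $\mu$-integrable on $A$, and as $\varepsilon\to0^+$ the functionals $F_\varepsilon$ $\Gamma$-converge on $\Pi(\mu,\nu)$ to the functional $F$ given by $$F(\gamma)=\operatorname{Ent}\bigl(\gamma\llcorner(\mathbb R\setminus A)^2\,\big|\,\mu\otimes\nu\bigr)-\int_A\log\Bigl(\frac{d\mu}{d\mathcal L^1}\Bigr)d\mu\quad\text{if }\gamma\in\mathcal O_1(\mu,\nu),\qquad F(\gamma)=+\infty\quad\text{otherwise.}$$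 Moreover $J_\varepsilon$ (for every $\varepsilon>0$) and $F$ attain finite minima on $\Pi(\mu,\nu)$, and as $\varepsilon\to0^+$ $$\min J_\varepsilon=W_1(\mu,\nu)+\varepsilon|\log(2\varepsilon)|\,\mu(A)+\varepsilon\min F+o(\varepsilon).$$ Furthermore, the displayed condition in (H1) holds whenever the interior of $A\cap\operatorname{supp}\mu$ is such a union of pairwise disjoint nonempty intervals $(a_i,b_i)$ and one of the following is true: (H1a) $\mu$ has a bounded density on $A$ and $\sum_i|a_i-b_i|\,\bigl|\log|a_i-b_i|\bigr|<+\infty$; or (H1b) $\sum_i|a_i-b_i|^{1-\delta}<+\infty$ for some $\delta>0$. -/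

import Mathlib

open MeasureTheory Filter Topology Set

noncomputable section

/-- Relative entropy of `γ` with respect to `ρ`, with values in the extended reals: the integral
of `log (dγ/dρ)` against `γ` (positive part minus negative part) if `γ ≪ ρ`, and `+∞` otherwise.
The negative part is finite when `ρ` is finite, and when `ρ` is Lebesgue measure and `γ` is a
probability measure with bounded support, so that no `∞ - ∞` occurs in these cases. -/
def relEnt {X : Type*} [MeasurableSpace X] (γ ρ : Measure X) : EReal :=
  open Classical in
  if γ ≪ ρ then
    ((∫⁻ x, ENNReal.ofReal (Real.log (γ.rnDeriv ρ x).toReal) ∂γ : ENNReal) : EReal)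
      - ((∫⁻ x, ENNReal.ofReal (-Real.log (γ.rnDeriv ρ x).toReal) ∂γ : ENNReal) : EReal)
  else ⊤

/-- The set `Π(μ, ν)` of transport plans; it carries the topology of narrow convergence, induced
by `ProbabilityMeasure (ℝ × ℝ)`. -/
def transportPlans (μ ν : Measure ℝ) : Set (ProbabilityMeasure (ℝ × ℝ)) :=
  {γ | (γ : Measure (ℝ × ℝ)).map Prod.fst = μ ∧ (γ : Measure (ℝ × ℝ)).map Prod.snd = ν}

/-- The transport energy `∫ |y - x| dγ` (the integrand is `γ`-integrable as soon as the marginals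
of `γ` have bounded support). -/
def mongeCost (γ : ProbabilityMeasure (ℝ × ℝ)) : ℝ :=
  ∫ p, |p.2 - p.1| ∂(γ : Measure (ℝ × ℝ))

/-- The minimal transport energy `W₁(μ, ν)`, for `μ` and `ν` with bounded support. -/
def wassersteinOne (μ ν : Measure ℝ) : ℝ :=
  sInf (mongeCost '' transportPlans μ ν)

/-- The set of optimal transport plans for the distance cost. -/
def optimalPlans (μ ν : Measure ℝ) : Set (ProbabilityMeasure (ℝ × ℝ)) :=
  {γ | γ ∈ transportPlans μ ν ∧ mongeCost γ = wassersteinOne μ ν}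

/-- The set `A` on which the cumulative distribution functions of `μ` and `ν` coincide. -/
def coincidenceSet (μ ν : Measure ℝ) : Set ℝ :=
  {x | ProbabilityTheory.cdf μ x = ProbabilityTheory.cdf ν x}

/-- `Γ`-convergence of a family of extended-real-valued functionals along a filter, on a
metrizable space. For `l = atTop` on `ℕ` it is the usual definition for sequences; for
`l = 𝓝[>] 0` on `ℝ` it is `Γ`-convergence of a family indexed by `ε > 0` as `ε → 0`. -/
def GammaTendsto {X ι : Type*} [TopologicalSpace X]
    (G : ι → X → EReal) (l : Filter ι) (G₀ : X → EReal) : Prop :=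
  ∀ x : X,
    (∀ u : ι → X, Tendsto u l (𝓝 x) → G₀ x ≤ liminf (fun i => G i (u i)) l) ∧
    (∃ u : ι → X, Tendsto u l (𝓝 x) ∧ limsup (fun i => G i (u i)) l ≤ G₀ x)

/-- The penalized functional `J_ε(γ) = ∫ |y - x| dγ + ε Ent(γ | μ ⊗ ν)`. -/
def penalizedCost (μ ν : Measure ℝ) (ε : ℝ) (γ : transportPlans μ ν) : EReal :=
  ((mongeCost γ.1 : ℝ) : EReal)
    + (ε : EReal) * relEnt (γ.1 : Measure (ℝ × ℝ)) (μ.prod ν)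

/-- The rescaled functional
`F_ε(γ) = (1/ε) (∫ |y - x| dγ - W₁(μ, ν)) + Ent(γ | μ ⊗ ν) - |log (2ε)| μ(A)`. -/
def rescaledCost (μ ν : Measure ℝ) (ε : ℝ) (γ : transportPlans μ ν) : EReal :=
  (((1 / ε) * (mongeCost γ.1 - wassersteinOne μ ν) : ℝ) : EReal)
    + relEnt (γ.1 : Measure (ℝ × ℝ)) (μ.prod ν)
    - ((|Real.log (2 * ε)| * μ.real (coincidenceSet μ ν) : ℝ) : EReal)

/-- The limit functional `F`: it is `+∞` off the optimal plans, and
`Ent(γ restricted to (ℝ \ A)² | μ ⊗ ν) - ∫_A log (dμ/dx) dμ` on them. -/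
def limitCost (μ ν : Measure ℝ) (γ : transportPlans μ ν) : EReal :=
  open Classical in
  if γ.1 ∈ optimalPlans μ ν then
    relEnt ((γ.1 : Measure (ℝ × ℝ)).restrict ((coincidenceSet μ ν)ᶜ ×ˢ (coincidenceSet μ ν)ᶜ))
        (μ.prod ν)
      - ((∫ x in coincidenceSet μ ν, Real.log (μ.rnDeriv volume x).toReal ∂μ : ℝ) : EReal)
  else ⊤

/-- `U` is the union of the pairwise disjoint nonempty open intervals `(a i, b i)`. -/
structure IsDisjointIntervalUnion {ι : Type*} (U : Set ℝ) (a b : ι → ℝ) : Prop where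
  lt : ∀ i, a i < b i
  disjoint : Pairwise fun i j => Disjoint (Ioo (a i) (b i)) (Ioo (a j) (b j))
  eq_iUnion : U = ⋃ i, Ioo (a i) (b i)

/-- The condition `-∑ᵢ ∫_{aᵢ}^{bᵢ} log (min {x - aᵢ, bᵢ - x}) dμ(x) < +∞`. It is expressed through
the positive part of the integrand: when the intervals are pairwise disjoint and contained in a
bounded set, the integrand is bounded below by a constant independent of `i`, so its negative part
contributes only a finite amount to the sum. -/
def LogDistSummable {ι : Type*} (μ : Measure ℝ) (a b : ι → ℝ) : Prop :=
  ∑' i, ∫⁻ x in Ioo (a i) (b i), ENNReal.ofReal (-Real.log (min (x - a i) (b i - x))) ∂μ < ⊤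

end

/-! Let `A` be the coincidence set and f the density of μ. The potential φ with slope sign(F_μ -
F_ν) is 1-Lipschitz and flat on `A`. The reduced cost c(x,y) = |y-x| - (φ(y) - φ(x)) is therefore
nonnegative, and at least the length of `A` between x and y. It vanishes on the graph of the
monotone rearrangement, so the integral of c against a plan is exactly the excess of its transport
energy over W₁ (`mongeCost_sub_wassersteinOne`). Optimal plans live on {c = 0}. Since μ-almost every
point of `A` is interior to `A`, they fix the mass of `A` pointwise (`ae_eq_of_mem_coincidenceSet`).
The densities of μ and ν agree on `A`, so no mass enters `A` from outside either.

Lower bound. The entropy is tested by Donsker-Varadhan duality, with a bounded continuous function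
on Aᶜ × ℝ and with the logarithm of the Gibbs kernel exp(-c/ε)/Z_ε(x) on A × ℝ (`le_relEnt_plan`).
The term c/ε absorbs the scaled excess cost, and what remains on `A` is -∫_A log Z_ε dμ. The ratio
Z_ε/(2εf) has μ-mean at most 1 on `A`, by a layer-cake estimate that uses only the lower bound on c,
and its positive logarithm tends to 0 almost everywhere, because near an interior point of `A` the
kernel is dominated by the two-sided exponential. As log⁺ is sublinear, this suffices for ∫_A log
Z_ε dμ ≤ log(2ε) μ(A) + ∫_A log f dμ + o(1) (`eventually_integral_log_gibbsMass_le`).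

Upper bound. An optimal plan of finite limit energy is kept on Aᶜ × ℝ, and its diagonal part on `A`
is replaced by the kernel (2ε)⁻¹ exp(-|x-y|/ε) min(1/f(x), 1/f(y)), whose marginals are at most 1
and tend to 1. A block diagonal plan on a grid of size ε restores the missing mass. Its entropy is
controlled by the number of cells, and all terms in log ε combine to exactly -log(2ε) μ(A), so no
rate is needed for the vanishing of the defect (`eventually_recoveryEnergy_le`,
`exists_recoveryPlan`).

Minima. The set of plans is compact and the functionals are lower semicontinuous. Convergence of the
minimal values follows from the two bounds, and the expansion is that convergence rescaled
(`exists_expansion`). The sufficient conditions for logarithmic integrability reduce to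
one-dimensional integrals of -log s or s^(-τ); the second also uses Young's inequality and the
finite entropy of μ. -/

noncomputable section

/-! ### Relative entropy and Donsker-Varadhan duality -/

section RelativeEntropy

variable {X : Type*} [MeasurableSpace X]

theorem neg_mul_log_le_one (r : ℝ) (hr : 0 ≤ r) : -(r * Real.log r) ≤ 1 := by
  rcases hr.eq_or_lt with rfl | h
  · simp
  · have h1 := Real.log_le_sub_one_of_pos (inv_pos.2 h)
    rw [Real.log_inv] at h1
    have h2 : r * (-Real.log r) ≤ r * (r⁻¹ - 1) := mul_le_mul_of_nonneg_left h1 hr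
    rw [mul_sub, mul_inv_cancel₀ h.ne'] at h2
    linarith

/-- Young's inequality for the pair `r log r - r`, `exp`. -/
theorem mul_le_mul_log_add_exp (r s : ℝ) (hr : 0 ≤ r) :
    r * s ≤ r * Real.log r - r + Real.exp s := by
  rcases hr.eq_or_lt with rfl | h
  · simp [Real.exp_nonneg]
  · have h1 := Real.add_one_le_exp (s - Real.log r)
    rw [Real.exp_sub, Real.exp_log h, le_div_iff₀ h] at h1
    nlinarith

theorem lintegral_comp_rnDeriv {γ ρ : Measure X} [IsFiniteMeasure γ] [SigmaFinite ρ]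
    (h : γ ≪ ρ) {φ : ℝ → ℝ} (hφ : Measurable φ) :
    ∫⁻ x, ENNReal.ofReal (φ (γ.rnDeriv ρ x).toReal) ∂γ
      = ∫⁻ x, ENNReal.ofReal ((γ.rnDeriv ρ x).toReal * φ (γ.rnDeriv ρ x).toReal) ∂ρ := by
  rw [← lintegral_rnDeriv_mul h
    (f := fun x => ENNReal.ofReal (φ (γ.rnDeriv ρ x).toReal)) (by fun_prop)]
  refine lintegral_congr_ae ?_
  filter_upwards [γ.rnDeriv_lt_top ρ] with x hx
  rw [ENNReal.ofReal_mul ENNReal.toReal_nonneg, ENNReal.ofReal_toReal hx.ne]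

/-- The density r vanishes off `K`, and -r log r ≤ 1 on `K`. Localizing to `K` is what covers an
infinite reference measure such as Lebesgue measure. -/
theorem lintegral_neg_log_rnDeriv_le {γ ρ : Measure X} [IsFiniteMeasure γ] [SigmaFinite ρ]
    (h : γ ≪ ρ) {K : Set X} (hK : MeasurableSet K) (hγ : γ Kᶜ = 0) :
    ∫⁻ x, ENNReal.ofReal (-Real.log (γ.rnDeriv ρ x).toReal) ∂γ ≤ ρ K := by
  rw [lintegral_comp_rnDeriv (φ := fun t => -Real.log t) h (by fun_prop)]
  have h0 : ∀ᵐ x ∂ρ, x ∈ Kᶜ → γ.rnDeriv ρ x = 0 := by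
    have : ∫⁻ x in Kᶜ, γ.rnDeriv ρ x ∂ρ = 0 := by
      rw [Measure.setLIntegral_rnDeriv h, hγ]
    rw [lintegral_eq_zero_iff (by fun_prop)] at this
    exact (ae_restrict_iff' hK.compl).1 this
  calc _ ≤ ∫⁻ x, K.indicator 1 x ∂ρ := by
        refine lintegral_mono_ae ?_
        filter_upwards [h0] with x hx
        by_cases hxK : x ∈ K
        · simp only [hxK, indicator_of_mem, Pi.one_apply]
          rw [← ENNReal.ofReal_one]
          refine ENNReal.ofReal_le_ofReal ?_
          have := neg_mul_log_le_one _ (ENNReal.toReal_nonneg (a := γ.rnDeriv ρ x))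
          linarith
        · simp [hx hxK]
    _ = ρ K := by simp [lintegral_indicator hK]

theorem integrable_of_lintegral_ofReal_lt_top {γ : Measure X} {f : X → ℝ}
    (hf : AEStronglyMeasurable f γ) (h1 : ∫⁻ x, ENNReal.ofReal (f x) ∂γ < ⊤)
    (h2 : ∫⁻ x, ENNReal.ofReal (-f x) ∂γ < ⊤) : Integrable f γ := by
  refine ⟨hf, ?_⟩
  rw [hasFiniteIntegral_iff_norm]
  calc _ ≤ ∫⁻ x, (ENNReal.ofReal (f x) + ENNReal.ofReal (-f x)) ∂γ := by
        refine lintegral_mono fun x => ?_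
        rcases le_total 0 (f x) with h | h
        · rw [Real.norm_of_nonneg h]; exact le_self_add
        · rw [Real.norm_of_nonpos h]; exact le_add_self
    _ = _ := lintegral_add_left' hf.aemeasurable.ennreal_ofReal _
    _ < ⊤ := ENNReal.add_lt_top.2 ⟨h1, h2⟩

theorem relEnt_eq_integral {γ ρ : Measure X} (h : γ ≪ ρ)
    (hi : Integrable (fun x => Real.log (γ.rnDeriv ρ x).toReal) γ) :
    relEnt γ ρ = ((∫ x, Real.log (γ.rnDeriv ρ x).toReal ∂γ : ℝ) : EReal) := by
  have h1 : ∫⁻ x, ENNReal.ofReal (Real.log (γ.rnDeriv ρ x).toReal) ∂γ ≠ ⊤ :=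
    ((lintegral_mono fun x => ENNReal.ofReal_le_ofReal (le_abs_self _)).trans_lt
      ((hasFiniteIntegral_iff_norm _).1 hi.2)).ne
  have h2 : ∫⁻ x, ENNReal.ofReal (-Real.log (γ.rnDeriv ρ x).toReal) ∂γ ≠ ⊤ :=
    ((lintegral_mono fun x => ENNReal.ofReal_le_ofReal (neg_le_abs _)).trans_lt
      ((hasFiniteIntegral_iff_norm _).1 hi.2)).ne
  rw [relEnt, if_pos h, integral_eq_lintegral_pos_part_sub_lintegral_neg_part hi, EReal.coe_sub,
    EReal.coe_ennreal_toReal h1, EReal.coe_ennreal_toReal h2]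

/-- The negative part is always finite here, so an infinite positive part would make the
extended-real difference equal to `⊤`. -/
theorem ac_and_integrable_of_relEnt_lt_top {γ ρ : Measure X} [IsFiniteMeasure γ] [SigmaFinite ρ]
    {K : Set X} (hK : MeasurableSet K) (hγ : γ Kᶜ = 0) (hρ : ρ K < ⊤) (h : relEnt γ ρ < ⊤) :
    γ ≪ ρ ∧ Integrable (fun x => Real.log (γ.rnDeriv ρ x).toReal) γ := by
  have hac : γ ≪ ρ := by
    by_contra hn
    rw [relEnt, if_neg hn] at h
    exact lt_irrefl _ h
  have hneg := (lintegral_neg_log_rnDeriv_le hac hK hγ).trans_lt hρ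
  refine ⟨hac, integrable_of_lintegral_ofReal_lt_top
    (Measurable.aestronglyMeasurable (by fun_prop)) ?_ hneg⟩
  rw [relEnt, if_pos hac] at h
  by_contra hpos
  rw [not_lt, top_le_iff] at hpos
  rw [hpos, ← EReal.coe_ennreal_toReal hneg.ne, EReal.coe_ennreal_top, EReal.top_sub_coe] at h
  exact lt_irrefl _ h

theorem integrable_mul_log_rnDeriv_iff {γ ρ : Measure X} [IsFiniteMeasure γ] [SigmaFinite ρ]
    (h : γ ≪ ρ) :
    Integrable (fun x => (γ.rnDeriv ρ x).toReal * Real.log (γ.rnDeriv ρ x).toReal) ρ ↔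
      Integrable (fun x => Real.log (γ.rnDeriv ρ x).toReal) γ :=
  integrable_rnDeriv_smul_iff (f := fun x => Real.log (γ.rnDeriv ρ x).toReal) h

theorem relEnt_eq_integral_mul_log {γ ρ : Measure X} [IsFiniteMeasure γ] [SigmaFinite ρ]
    (h : γ ≪ ρ)
    (hi : Integrable (fun x => (γ.rnDeriv ρ x).toReal * Real.log (γ.rnDeriv ρ x).toReal) ρ) :
    relEnt γ ρ
      = ((∫ x, (γ.rnDeriv ρ x).toReal * Real.log (γ.rnDeriv ρ x).toReal ∂ρ : ℝ) : EReal) := by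
  rw [relEnt_eq_integral h ((integrable_mul_log_rnDeriv_iff h).1 hi),
    ← integral_rnDeriv_smul (f := fun x => Real.log (γ.rnDeriv ρ x).toReal) h]
  rfl

/-- Entropy of a measure given by a density. -/
theorem relEnt_withDensity {ρ : Measure X} [SigmaFinite ρ] {D : X → ℝ} (hD : Measurable D)
    (hD0 : ∀ x, 0 ≤ D x) (hDi : Integrable D ρ)
    (hDl : Integrable (fun x => D x * Real.log (D x)) ρ) :
    relEnt (ρ.withDensity fun x => ENNReal.ofReal (D x)) ρ
      = ((∫ x, D x * Real.log (D x) ∂ρ : ℝ) : EReal) := by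
  have hr : (fun x => ((ρ.withDensity fun x => ENNReal.ofReal (D x)).rnDeriv ρ x).toReal)
      =ᵐ[ρ] D := by
    filter_upwards [Measure.rnDeriv_withDensity ρ hD.ennreal_ofReal] with x hx
    rw [hx, ENNReal.toReal_ofReal (hD0 x)]
  have : IsFiniteMeasure (ρ.withDensity fun x => ENNReal.ofReal (D x)) :=
    isFiniteMeasure_withDensity_ofReal hDi.2
  have hr2 : (fun x => ((ρ.withDensity fun x => ENNReal.ofReal (D x)).rnDeriv ρ x).toReal *
      Real.log ((ρ.withDensity fun x => ENNReal.ofReal (D x)).rnDeriv ρ x).toReal)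
      =ᵐ[ρ] fun x => D x * Real.log (D x) := by
    filter_upwards [hr] with x hx
    rw [hx]
  rw [relEnt_eq_integral_mul_log (withDensity_absolutelyContinuous _ _) (hDl.congr hr2.symm),
    integral_congr_ae hr2]

/-- Used before dualizing: against the restricted reference, the exponential term of the dual
functional is integrated over `U` only. -/
theorem relEnt_restrict (γ ρ : Measure X) [IsFiniteMeasure γ] [SigmaFinite ρ] {U : Set X}
    (hU : MeasurableSet U) :
    relEnt (γ.restrict U) ρ = relEnt (γ.restrict U) (ρ.restrict U) := by
  have hiff : γ.restrict U ≪ ρ ↔ γ.restrict U ≪ ρ.restrict U := by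
    refine ⟨fun h => ?_, fun h => h.trans Measure.restrict_le_self.absolutelyContinuous⟩
    have := h.restrict U
    rwa [Measure.restrict_restrict hU, inter_self] at this
  by_cases h : γ.restrict U ≪ ρ
  · have hw := Measure.withDensity_rnDeriv_eq _ _ h
    have hw2 : γ.restrict U = (ρ.restrict U).withDensity ((γ.restrict U).rnDeriv ρ) := by
      rw [← restrict_withDensity hU, hw, Measure.restrict_restrict hU, inter_self]
    have hr : (γ.restrict U).rnDeriv (ρ.restrict U) =ᵐ[γ.restrict U] (γ.restrict U).rnDeriv ρ := by
      refine (hiff.1 h).ae_le ?_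
      have := Measure.rnDeriv_withDensity (ρ.restrict U) (Measure.measurable_rnDeriv (γ.restrict U) ρ)
      rwa [← hw2] at this
    rw [relEnt, relEnt, if_pos h, if_pos (hiff.1 h)]
    congr 2
    · refine lintegral_congr_ae ?_
      filter_upwards [hr] with x hx
      rw [hx]
    · refine lintegral_congr_ae ?_
      filter_upwards [hr] with x hx
      rw [hx]
  · rw [relEnt, relEnt, if_neg h, if_neg (hiff.not.1 h)]

/-- The Donsker-Varadhan lower bound for the relative entropy. -/
theorem le_relEnt {γ ρ : Measure X} [IsFiniteMeasure γ] [IsFiniteMeasure ρ] {φ : X → ℝ}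
    (hφ : Integrable φ γ) (he : Integrable (fun x => Real.exp (φ x)) ρ) :
    ((∫ x, φ x ∂γ - ∫ x, Real.exp (φ x) ∂ρ + γ.real univ : ℝ) : EReal) ≤ relEnt γ ρ := by
  rcases lt_or_ge (relEnt γ ρ) ⊤ with h | h
  · obtain ⟨hac, hi⟩ := ac_and_integrable_of_relEnt_lt_top MeasurableSet.univ (by simp)
      (measure_lt_top _ _) h
    have hi' := (integrable_mul_log_rnDeriv_iff hac).2 hi
    rw [relEnt_eq_integral_mul_log hac hi', EReal.coe_le_coe_iff,
      ← integral_rnDeriv_smul (f := φ) hac, ← Measure.integral_toReal_rnDeriv hac]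
    have hφ' := (integrable_rnDeriv_smul_iff (f := φ) hac).2 hφ
    have h1 : Integrable (fun x => (γ.rnDeriv ρ x).toReal) ρ := Measure.integrable_toReal_rnDeriv
    have h2 : Integrable (fun x => (γ.rnDeriv ρ x).toReal • φ x - Real.exp (φ x)) ρ := hφ'.sub he
    rw [← integral_sub hφ' he, ← integral_add h2 h1]
    refine integral_mono (h2.add h1) hi' fun x => ?_
    have := mul_le_mul_log_add_exp (γ.rnDeriv ρ x).toReal (φ x) ENNReal.toReal_nonneg
    simp only [smul_eq_mul]
    linarith
  · exact le_top.trans h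

/-- Truncation of the logarithm to the interval `[-n, n]`. -/
def truncLog (n : ℕ) (t : ℝ) : ℝ := if t = 0 then -n else max (-n) (min n (Real.log t))

@[fun_prop]
theorem measurable_truncLog (n : ℕ) : Measurable (truncLog n) :=
  Measurable.ite (measurableSet_singleton 0) measurable_const (by fun_prop)

theorem abs_truncLog_le (n : ℕ) (t : ℝ) : |truncLog n t| ≤ n := by
  have hn : (0 : ℝ) ≤ n := n.cast_nonneg
  rw [truncLog, abs_le]
  split_ifs
  · constructor <;> linarith
  · exact ⟨le_max_left _ _, max_le (by linarith) (min_le_left _ _)⟩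

/-- A lower bound independent of `n` is what Fatou's lemma requires along the truncations. -/
theorem neg_two_le_mul_truncLog (n : ℕ) {t : ℝ} (ht : 0 ≤ t) :
    -2 ≤ t * truncLog n t - Real.exp (truncLog n t) + t := by
  have hn : (0 : ℝ) ≤ n := n.cast_nonneg
  have he : Real.exp (-n) ≤ 1 := Real.exp_le_one_iff.2 (by linarith)
  rw [truncLog]
  split_ifs with h0
  · rw [h0]; linarith
  have ht' : 0 < t := lt_of_le_of_ne ht (Ne.symm h0)
  rcases lt_or_ge (Real.log t) (-n) with h1 | h1
  · rw [min_eq_right (by linarith), max_eq_left h1.le]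
    have h2 : t ≤ Real.exp (-n) := ((Real.log_lt_iff_lt_exp ht').1 h1).le
    have h3 : (n : ℝ) * Real.exp (-n) ≤ 1 := by
      rw [Real.exp_neg, ← div_eq_mul_inv, div_le_one (Real.exp_pos _)]
      linarith [Real.add_one_le_exp (n : ℝ)]
    nlinarith
  rcases lt_or_ge (n : ℝ) (Real.log t) with h2 | h2
  · rw [min_eq_left h2.le, max_eq_right (by linarith)]
    have h3 : Real.exp n ≤ t := ((Real.lt_log_iff_exp_lt ht').1 h2).le
    nlinarith
  · rw [min_eq_right h2, max_eq_right h1, Real.exp_log ht']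
    linarith [neg_mul_log_le_one t ht]

/-- For t > 0 the sequence is eventually constant. At t = 0 the truncation is -n rather than a
truncation of the default `Real.log 0 = 0`; hence -exp(-n) → 0, whereas the default would give the
constant -1. -/
theorem tendsto_mul_truncLog {t : ℝ} (ht : 0 ≤ t) :
    Tendsto (fun n : ℕ => t * truncLog n t - Real.exp (truncLog n t) + t) atTop
      (𝓝 (t * Real.log t)) := by
  rcases ht.eq_or_lt with rfl | h
  · have : Tendsto (fun n : ℕ => -Real.exp (-(n : ℝ))) atTop (𝓝 (-0)) :=
      (Real.tendsto_exp_neg_atTop_nhds_zero.comp tendsto_natCast_atTop_atTop).neg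
    simpa [truncLog] using this
  · refine tendsto_const_nhds.congr' ?_
    obtain ⟨N, hN⟩ := exists_nat_ge |Real.log t|
    filter_upwards [eventually_ge_atTop N] with n hn
    have hn' : |Real.log t| ≤ n := hN.trans (by exact_mod_cast hn)
    rw [truncLog, if_neg h.ne', min_eq_right (abs_le.1 hn').2, max_eq_right (abs_le.1 hn').1,
      Real.exp_log h]
    ring

/-- The formal maximizer of the dual functional is log(dγ/dρ). Its truncations are admissible, and
if all of them gave at most `c`, Fatou's lemma would bound the entropy by `c`. When γ is not
absolutely continuous, a large constant on a ρ-null set charged by γ does the job. -/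
theorem exists_bounded_measurable_lt_of_lt_relEnt {γ ρ : Measure X} [IsFiniteMeasure γ]
    [IsFiniteMeasure ρ] {c : ℝ} (hc : (c : EReal) < relEnt γ ρ) :
    ∃ (M : ℝ) (φ : X → ℝ), Measurable φ ∧ (∀ x, |φ x| ≤ M) ∧
      c < ∫ x, φ x ∂γ - ∫ x, Real.exp (φ x) ∂ρ + γ.real univ := by
  by_cases hac : γ ≪ ρ
  · by_contra! hcon
    set r : X → ℝ := fun x => (γ.rnDeriv ρ x).toReal with hr
    have hrm : Measurable r := by fun_prop
    have hr0 : ∀ x, 0 ≤ r x := fun x => ENNReal.toReal_nonneg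
    have hri : Integrable r ρ := Measure.integrable_toReal_rnDeriv
    have hφb : ∀ (κ : Measure X) [IsFiniteMeasure κ] (n : ℕ),
        Integrable (fun x => truncLog n (r x)) κ := fun κ _ n =>
      Integrable.of_bound (Measurable.aestronglyMeasurable (by fun_prop)) n
        (ae_of_all _ fun x => abs_truncLog_le n _)
    have heb : ∀ n : ℕ, Integrable (fun x => Real.exp (truncLog n (r x))) ρ := fun n =>
      Integrable.of_bound (Measurable.aestronglyMeasurable (by fun_prop)) (Real.exp n)
        (ae_of_all _ fun x => by
          rw [Real.norm_of_nonneg (Real.exp_nonneg _)]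
          exact Real.exp_le_exp.2 (abs_le.1 (abs_truncLog_le n _)).2)
    set h : ℕ → X → ℝ := fun n x => r x * truncLog n (r x) - Real.exp (truncLog n (r x)) + r x
      with hh
    have hhi : ∀ n, Integrable (h n) ρ := fun n =>
      (((integrable_rnDeriv_smul_iff (f := fun x => truncLog n (r x)) hac).2
        (hφb γ n)).sub (heb n)).add hri
    have hle : ∀ n, ∫ x, h n x ∂ρ ≤ c := fun n => by
      have := hcon n (fun x => truncLog n (r x)) (by fun_prop) fun x => abs_truncLog_le n _
      refine le_trans (le_of_eq ?_) this
      rw [← integral_rnDeriv_smul (f := fun x => truncLog n (r x)) hac,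
        ← Measure.integral_toReal_rnDeriv hac, ← integral_sub _ (heb n), ← integral_add _ hri]
      · rfl
      · exact ((integrable_rnDeriv_smul_iff (f := fun x => truncLog n (r x)) hac).2
          (hφb γ n)).sub (heb n)
      · exact (integrable_rnDeriv_smul_iff (f := fun x => truncLog n (r x)) hac).2 (hφb γ n)
    have hle2 : ∀ n, ∫⁻ x, ENNReal.ofReal (h n x + 2) ∂ρ ≤ ENNReal.ofReal (c + 2 * ρ.real univ) :=
      fun n => by
        have hhi2 : Integrable (fun x => h n x + 2) ρ := (hhi n).add (integrable_const _)
        rw [← ofReal_integral_eq_lintegral_ofReal hhi2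
          (ae_of_all _ fun x => by have := neg_two_le_mul_truncLog n (hr0 x); simp [hh]; linarith)]
        refine ENNReal.ofReal_le_ofReal ?_
        rw [integral_add (hhi n) (integrable_const _), integral_const, smul_eq_mul]
        linarith [hle n]
    have hfat : ∫⁻ x, ENNReal.ofReal (r x * Real.log (r x) + 2) ∂ρ
        ≤ ENNReal.ofReal (c + 2 * ρ.real univ) := by
      calc _ = ∫⁻ x, liminf (fun n => ENNReal.ofReal (h n x + 2)) atTop ∂ρ := by
            refine lintegral_congr fun x => (Tendsto.liminf_eq ?_).symm
            exact ENNReal.tendsto_ofReal ((tendsto_mul_truncLog (hr0 x)).add_const 2)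
        _ ≤ liminf (fun n => ∫⁻ x, ENNReal.ofReal (h n x + 2) ∂ρ) atTop :=
            lintegral_liminf_le fun n => by fun_prop
        _ ≤ _ := liminf_le_of_le (by isBoundedDefault) fun b hb => by
            obtain ⟨n, hn⟩ := hb.exists
            exact hn.trans (hle2 n)
    have h2i : Integrable (fun x => r x * Real.log (r x) + 2) ρ := by
      refine ⟨Measurable.aestronglyMeasurable (by fun_prop), ?_⟩
      rw [hasFiniteIntegral_iff_ofReal (ae_of_all _ fun x => by
        have := neg_mul_log_le_one _ (hr0 x); simp only [Pi.zero_apply]; linarith)]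
      exact hfat.trans_lt ENNReal.ofReal_lt_top
    have hli : Integrable (fun x => r x * Real.log (r x)) ρ := by
      refine (h2i.sub (integrable_const (2 : ℝ))).congr (ae_of_all _ fun x => ?_)
      simp
    -- `ENNReal.ofReal` truncates at 0, so this sign is needed to read the Fatou bound back as an
    -- inequality between real numbers.
    have hc2 : 0 ≤ c + 2 * ρ.real univ := by
      have : ∫ x, (-2 : ℝ) ∂ρ ≤ ∫ x, h 0 x ∂ρ :=
        integral_mono (integrable_const _) (hhi 0) fun x => neg_two_le_mul_truncLog 0 (hr0 x)
      rw [integral_const, smul_eq_mul] at this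
      linarith [hle 0]
    rw [← ofReal_integral_eq_lintegral_ofReal h2i (ae_of_all _ fun x => by
      have := neg_mul_log_le_one _ (hr0 x); simp only [Pi.zero_apply]; linarith),
      ENNReal.ofReal_le_ofReal_iff hc2, integral_add hli (integrable_const _), integral_const,
      smul_eq_mul] at hfat
    rw [relEnt_eq_integral_mul_log hac hli, EReal.coe_lt_coe_iff] at hc
    simp only [hr] at hfat
    linarith
  · rw [Measure.AbsolutelyContinuous] at hac
    push Not at hac
    obtain ⟨N₀, hN₀, hγ₀⟩ := hac
    set N := toMeasurable ρ N₀
    have hN : MeasurableSet N := measurableSet_toMeasurable _ _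
    have hρN : ρ N = 0 := by rw [measure_toMeasurable, hN₀]
    have hγN : 0 < γ.real N := by
      rw [measureReal_def, ENNReal.toReal_pos_iff]
      exact ⟨(pos_iff_ne_zero.2 hγ₀).trans_le (measure_mono (subset_toMeasurable _ _)),
        measure_lt_top _ _⟩
    -- The exponential term sees nothing of the null set and stays at ρ(X), while the linear term is
    -- k γ(N).
    obtain ⟨k, hk⟩ := exists_nat_gt ((c + ρ.real univ) / γ.real N)
    refine ⟨k, N.indicator fun _ => (k : ℝ), measurable_const.indicator hN, fun x => ?_, ?_⟩
    · by_cases hx : x ∈ N <;> simp [hx]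
    · have h1 : ∫ x, Real.exp (N.indicator (fun _ => (k : ℝ)) x) ∂ρ = ρ.real univ := by
        rw [integral_congr_ae (g := fun _ => (1 : ℝ))]
        · simp
        · have : ∀ᵐ x ∂ρ, x ∉ N := measure_eq_zero_iff_ae_notMem.1 hρN
          filter_upwards [this] with x hx
          simp [hx]
      rw [h1, integral_indicator hN, setIntegral_const, smul_eq_mul]
      rw [div_lt_iff₀ hγN] at hk
      linarith [measureReal_nonneg (μ := γ) (s := univ)]

/-- The relative entropy is the supremum of the Donsker-Varadhan functional over bounded
continuous functions. -/
theorem exists_boundedContinuous_lt_of_lt_relEnt [TopologicalSpace X]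
    [TopologicalSpace.PseudoMetrizableSpace X] [BorelSpace X]
    {γ ρ : Measure X} [IsFiniteMeasure γ]
    [IsFiniteMeasure ρ] {c : ℝ} (hc : (c : EReal) < relEnt γ ρ) :
    ∃ ψ : BoundedContinuousFunction X ℝ,
      c < ∫ x, ψ x ∂γ - ∫ x, Real.exp (ψ x) ∂ρ + γ.real univ := by
  let _ := TopologicalSpace.pseudoMetrizableSpacePseudoMetric X
  obtain ⟨M, φ, hφm, hφM, hlt⟩ := exists_bounded_measurable_lt_of_lt_relEnt hc
  have hi : Integrable φ (γ + ρ) :=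
    Integrable.of_bound hφm.aestronglyMeasurable M (ae_of_all _ hφM)
  set d := ∫ x, φ x ∂γ - ∫ x, Real.exp (φ x) ∂ρ + γ.real univ - c with hd
  have hd0 : 0 < d := by simp only [hd]; linarith
  -- On functions bounded by `M`, the dual functional is Lipschitz with constant at most `L` for the
  -- L¹ norm of γ + ρ: slope 1 from the linear term, exp M from the exponential. The slack `d` then
  -- tolerates an approximation error of d/(2L).
  set L := 1 + Real.exp M with hL
  have hL0 : 0 < L := by positivity
  obtain ⟨g, hg, hgi⟩ := hi.exists_boundedContinuous_integral_sub_le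
    (show 0 < d / (2 * L) by positivity)
  have hMx : ∀ x : X, 0 ≤ M := fun x => (abs_nonneg _).trans (hφM x)
  set ψ : BoundedContinuousFunction X ℝ := BoundedContinuousFunction.ofNormedAddCommGroup
    (fun x => max (-M) (min M (g x))) (by fun_prop) M (fun x => by
      rw [Real.norm_eq_abs, abs_le]
      exact ⟨le_max_left _ _, max_le (by linarith [hMx x]) (min_le_left _ _)⟩) with hψ
  have hψx : ∀ x, ψ x = max (-M) (min M (g x)) := fun x => rfl
  have hψM : ∀ x, ψ x ≤ M := fun x => by
    rw [hψx]; exact max_le (by linarith [hMx x]) (min_le_left _ _)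
  have hdist : ∀ x, |φ x - ψ x| ≤ ‖φ x - g x‖ := fun x => by
    have := abs_le.1 (hφM x)
    have e : φ x = max (-M) (min M (φ x)) := by rw [min_eq_right this.2, max_eq_right this.1]
    rw [hψx]
    conv_lhs => rw [e]
    refine (abs_max_sub_max_le_max _ _ _ _).trans ?_
    rw [sub_self, abs_zero, max_eq_right (abs_nonneg _)]
    refine (abs_min_sub_min_le_max _ _ _ _).trans ?_
    rw [sub_self, abs_zero, max_eq_right (abs_nonneg _), Real.norm_eq_abs]
  have hexp : ∀ x, |Real.exp (φ x) - Real.exp (ψ x)| ≤ Real.exp M * |φ x - ψ x| := by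
    have key : ∀ a b : ℝ, a ≤ M → b ≤ a → Real.exp a - Real.exp b ≤ Real.exp M * (a - b) := by
      intro a b ha hb
      have h1 := Real.add_one_le_exp (b - a)
      have h2 : Real.exp b = Real.exp a * Real.exp (b - a) := by rw [← Real.exp_add]; ring_nf
      have h3 := Real.exp_le_exp.2 ha
      rw [h2]
      nlinarith [Real.exp_pos a]
    intro x
    rcases le_total (ψ x) (φ x) with h | h
    · rw [abs_of_nonneg (sub_nonneg.2 (Real.exp_le_exp.2 h)), abs_of_nonneg (sub_nonneg.2 h)]
      exact key _ _ (abs_le.1 (hφM x)).2 h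
    · rw [abs_of_nonpos (sub_nonpos.2 (Real.exp_le_exp.2 h)), abs_of_nonpos (sub_nonpos.2 h)]
      have := key _ _ (hψM x) h
      linarith
  have hgi' : Integrable (fun x => ‖φ x - g x‖) (γ + ρ) := (hi.sub hgi).norm
  rw [integrable_add_measure] at hgi' hi
  rw [integral_add_measure hgi'.1 hgi'.2] at hg
  have hψγ : Integrable (fun x => ψ x) γ := ψ.integrable γ
  have hψe : Integrable (fun x => Real.exp (ψ x)) ρ :=
    Integrable.of_bound (Continuous.aestronglyMeasurable (by fun_prop)) (Real.exp M)
      (ae_of_all _ fun x => by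
        rw [Real.norm_of_nonneg (Real.exp_nonneg _)]; exact Real.exp_le_exp.2 (hψM x))
  have hφe : Integrable (fun x => Real.exp (φ x)) ρ :=
    Integrable.of_bound (Measurable.aestronglyMeasurable (by fun_prop)) (Real.exp M)
      (ae_of_all _ fun x => by
        rw [Real.norm_of_nonneg (Real.exp_nonneg _)]
        exact Real.exp_le_exp.2 (abs_le.1 (hφM x)).2)
  have h1 : ∫ x, φ x ∂γ - ∫ x, ψ x ∂γ ≤ ∫ x, ‖φ x - g x‖ ∂γ := by
    rw [← integral_sub hi.1 hψγ]
    exact integral_mono (hi.1.sub hψγ) hgi'.1 fun x => (le_abs_self _).trans (hdist x)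
  have h2 : ∫ x, Real.exp (ψ x) ∂ρ - ∫ x, Real.exp (φ x) ∂ρ
      ≤ Real.exp M * ∫ x, ‖φ x - g x‖ ∂ρ := by
    rw [← integral_sub hψe hφe, ← integral_const_mul]
    refine integral_mono (hψe.sub hφe) (hgi'.2.const_mul _) fun x => ?_
    have := (abs_sub_comm _ _).trans_le (hexp x)
    exact (le_abs_self _).trans (this.trans
      (mul_le_mul_of_nonneg_left (hdist x) (Real.exp_nonneg _)))
  have h3 : 0 ≤ ∫ x, ‖φ x - g x‖ ∂γ := integral_nonneg fun x => norm_nonneg _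
  have h4 : 0 ≤ ∫ x, ‖φ x - g x‖ ∂ρ := integral_nonneg fun x => norm_nonneg _
  refine ⟨ψ, ?_⟩
  have h5 : ∫ x, ‖φ x - g x‖ ∂γ + Real.exp M * ∫ x, ‖φ x - g x‖ ∂ρ ≤ d / 2 := by
    have h6 : L * (∫ x, ‖φ x - g x‖ ∂γ + ∫ x, ‖φ x - g x‖ ∂ρ) ≤ d / 2 := by
      calc _ ≤ L * (d / (2 * L)) := mul_le_mul_of_nonneg_left hg hL0.le
        _ = d / 2 := by field_simp
    have := Real.exp_pos M
    simp only [hL] at h6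
    nlinarith
  simp only [hd] at h5 hd0
  linarith

end RelativeEntropy
end

noncomputable section

/-! ### Exponential kernels, densities and positive logarithms on the line -/

section OneDim

/-- The part of `A` that can be reached from `y` through a portion of `A` of length at most `r`
has measure at most `2 r`. -/
theorem volume_inter_uIcc_le {A : Set ℝ} (y : ℝ) (r : ENNReal)
    {S : Set ℝ} (hS : MeasurableSet S) (hSA : S ⊆ A)
    (hSr : ∀ x ∈ S, volume (A ∩ uIcc y x) ≤ r) : volume S ≤ 2 * r := by
  have key1 : volume (S ∩ Ici y) ≤ r := by
    by_contra! h
    -- A compact subset attains its greatest point x, which lies in `S`; all of `K` sits in `A`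
    -- between y and x, where the length is at most r.
    obtain ⟨K, hKS, hKc, hK⟩ := (hS.inter measurableSet_Ici).exists_lt_isCompact h
    have hne : K.Nonempty := by
      rw [nonempty_iff_ne_empty]; rintro rfl; simp at hK
    obtain ⟨x, hxK, hx⟩ := hKc.exists_isGreatest hne
    refine absurd ((measure_mono ?_).trans (hSr x (hKS hxK).1)) hK.not_ge
    intro z hz
    exact ⟨hSA (hKS hz).1, by rw [uIcc_of_le (hKS hxK).2]; exact ⟨(hKS hz).2, hx hz⟩⟩
  have key2 : volume (S ∩ Iic y) ≤ r := by
    by_contra! h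
    obtain ⟨K, hKS, hKc, hK⟩ := (hS.inter measurableSet_Iic).exists_lt_isCompact h
    have hne : K.Nonempty := by
      rw [nonempty_iff_ne_empty]; rintro rfl; simp at hK
    obtain ⟨x, hxK, hx⟩ := hKc.exists_isLeast hne
    refine absurd ((measure_mono ?_).trans (hSr x (hKS hxK).1)) hK.not_ge
    intro z hz
    exact ⟨hSA (hKS hz).1, by rw [uIcc_of_ge (hKS hxK).2]; exact ⟨hx hz, (hKS hz).2⟩⟩
  calc volume S ≤ volume (S ∩ Ici y ∪ S ∩ Iic y) := by
        refine measure_mono fun z hz => ?_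
        rcases le_total y z with h | h
        · exact Or.inl ⟨hz, h⟩
        · exact Or.inr ⟨hz, h⟩
    _ ≤ _ := measure_union_le _ _
    _ ≤ r + r := add_le_add key1 key2
    _ = 2 * r := (two_mul r).symm

theorem le_exp_neg_div_iff {t ε p : ℝ} (ht : 0 < t) (hε : 0 < ε) :
    t ≤ Real.exp (-(p / ε)) ↔ p ≤ ε * -Real.log t := by
  rw [← Real.log_le_iff_le_exp ht, le_neg, div_le_iff₀ hε, mul_comm]

theorem integral_Ioc_neg_log : ∫ t in Ioc (0 : ℝ) 1, -Real.log t = 1 := by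
  rw [← intervalIntegral.integral_of_le zero_le_one, intervalIntegral.integral_neg, integral_log]
  simp

theorem integrableOn_Ioc_neg_log : IntegrableOn (fun t => -Real.log t) (Ioc (0 : ℝ) 1) := by
  have := (intervalIntegral.intervalIntegrable_log' (a := 0) (b := 1))
  rw [intervalIntegrable_iff_integrableOn_Ioc_of_le zero_le_one] at this
  exact this.neg

/-- Layer cake: exp(-c/ε) ≥ t means c ≤ -ε log t, and the points of `A` with this property have
total length at most -2ε log t. Integrating over t in (0,1] gives 2ε, the value attained when `A` is
the line and c is the distance to y. -/
theorem lintegral_exp_neg_div_le {A : Set ℝ} (hA : MeasurableSet A) (y : ℝ) {ε : ℝ} (hε : 0 < ε)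
    {c : ℝ → ℝ} (hcm : Measurable c) (hc0 : ∀ x, 0 ≤ c x)
    (hc : ∀ x, volume (A ∩ uIcc y x) ≤ ENNReal.ofReal (c x)) :
    ∫⁻ x in A, ENNReal.ofReal (Real.exp (-(c x / ε))) ≤ ENNReal.ofReal (2 * ε) := by
  rw [lintegral_eq_lintegral_meas_le _ (ae_of_all _ fun x => Real.exp_nonneg _)
    (Measurable.aemeasurable (by fun_prop))]
  calc _ ≤ ∫⁻ t in Ioi (0 : ℝ), (Ioc (0 : ℝ) 1).indicator
          (fun t => ENNReal.ofReal (2 * ε * -Real.log t)) t := by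
        refine setLIntegral_mono' measurableSet_Ioi fun t ht => ?_
        have ht' : 0 < t := ht
        have hms : MeasurableSet {x | t ≤ Real.exp (-(c x / ε))} :=
          measurableSet_le measurable_const (by fun_prop)
        rw [Measure.restrict_apply hms]
        by_cases h1 : t ≤ 1
        · rw [indicator_of_mem (show t ∈ Ioc (0 : ℝ) 1 from ⟨ht, h1⟩), mul_assoc,
            ENNReal.ofReal_mul zero_le_two, ENNReal.ofReal_ofNat]
          refine volume_inter_uIcc_le y _ (hms.inter hA) inter_subset_right fun x hx => ?_
          exact (hc x).trans (ENNReal.ofReal_le_ofReal ((le_exp_neg_div_iff ht' hε).1 hx.1))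
        · have : {x | t ≤ Real.exp (-(c x / ε))} = ∅ := by
            refine eq_empty_of_forall_notMem fun x hx => h1 (hx.trans ?_)
            rw [Real.exp_le_one_iff]
            have := div_nonneg (hc0 x) hε.le
            linarith
          simp [this]
    _ = ∫⁻ t in Ioc (0 : ℝ) 1, ENNReal.ofReal (2 * ε * -Real.log t) := by
        rw [setLIntegral_indicator measurableSet_Ioc,
          inter_eq_left.2 (show Ioc (0 : ℝ) 1 ⊆ Ioi 0 from fun t ht => ht.1)]
    _ = ENNReal.ofReal (2 * ε) := by
        rw [← ofReal_integral_eq_lintegral_ofReal (integrableOn_Ioc_neg_log.const_mul _),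
          integral_const_mul, integral_Ioc_neg_log, mul_one]
        refine (ae_restrict_iff' measurableSet_Ioc).2 (ae_of_all _ fun t ht => ?_)
        have := Real.log_nonpos ht.1.le ht.2
        exact mul_nonneg (by linarith) (by simpa using this)

/-- The exponential kernel is an approximate identity at every point where the measure has a
symmetric derivative. -/
theorem tendsto_integral_exp_kernel (κ : Measure ℝ) [IsFiniteMeasure κ] (x ℓ : ℝ)
    (h : Tendsto (fun r => κ.real (Metric.closedBall x r) / (2 * r)) (𝓝[>] 0) (𝓝 ℓ)) :
    Tendsto (fun ε : ℝ => (2 * ε)⁻¹ * ∫ y, Real.exp (-(|x - y| / ε)) ∂κ) (𝓝[>] 0) (𝓝 ℓ) := by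
  -- By the layer cake formula the exponential average is an average of ball averages, with radius
  -- -ε log t and weight -log t.
  have hform : ∀ ε : ℝ, 0 < ε → (2 * ε)⁻¹ * ∫ y, Real.exp (-(|x - y| / ε)) ∂κ
      = ∫ t in Ioo (0 : ℝ) 1, κ.real (Metric.closedBall x (ε * -Real.log t)) / (2 * ε) := by
    intro ε hε
    have hi : Integrable (fun y => Real.exp (-(|x - y| / ε))) κ := by
      refine Integrable.of_bound (Measurable.aestronglyMeasurable (by fun_prop)) 1
        (ae_of_all _ fun y => ?_)
      rw [Real.norm_of_nonneg (Real.exp_nonneg _), Real.exp_le_one_iff]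
      have := div_nonneg (abs_nonneg (x - y)) hε.le
      linarith
    rw [hi.integral_eq_integral_meas_le (ae_of_all _ fun x => Real.exp_nonneg _),
      ← integral_const_mul]
    have hz : ∀ t ∈ Ioi (0 : ℝ) \ Ioc 0 1,
        (2 * ε)⁻¹ * κ.real {a | t ≤ Real.exp (-(|x - a| / ε))} = 0 := by
      intro t ht
      have : {a | t ≤ Real.exp (-(|x - a| / ε))} = ∅ := by
        refine eq_empty_of_forall_notMem fun y hy => ht.2 ⟨ht.1, hy.trans ?_⟩
        rw [Real.exp_le_one_iff]
        have := div_nonneg (abs_nonneg (x - y)) hε.le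
        linarith
      simp [this]
    rw [setIntegral_eq_of_subset_of_forall_sdiff_eq_zero measurableSet_Ioi
      (fun t ht => ht.1 : Ioc (0 : ℝ) 1 ⊆ Ioi 0) hz, integral_Ioc_eq_integral_Ioo]
    refine setIntegral_congr_fun measurableSet_Ioo fun t ht => ?_
    rw [div_eq_inv_mul]
    congr 2
    ext y
    rw [Metric.mem_closedBall, dist_comm, Real.dist_eq, ← le_exp_neg_div_iff ht.1 hε]
    rfl
  obtain ⟨r₀, hr₀, hbd⟩ : ∃ r₀ > 0, ∀ r ∈ Ioo 0 r₀,
      κ.real (Metric.closedBall x r) / (2 * r) < ℓ + 1 := by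
    have := h.eventually (gt_mem_nhds (lt_add_one ℓ))
    rw [eventually_nhdsWithin_iff, Metric.eventually_nhds_iff] at this
    obtain ⟨r₀, hr₀, hb⟩ := this
    exact ⟨r₀, hr₀, fun r hr => hb (by simpa [abs_of_pos hr.1] using hr.2) hr.1⟩
  -- Small radii are controlled by the limit and large ones by the finite total mass; the dominating
  -- function is then -C log t.
  obtain ⟨C, hC⟩ : ∃ C, ∀ r, 0 < r → κ.real (Metric.closedBall x r) / (2 * r) ≤ C := by
    refine ⟨max (ℓ + 1) (κ.real univ / (2 * r₀)), fun r hr => ?_⟩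
    rcases lt_or_ge r r₀ with h1 | h1
    · exact (hbd r ⟨hr, h1⟩).le.trans (le_max_left _ _)
    · refine le_trans ?_ (le_max_right _ _)
      exact div_le_div₀ measureReal_nonneg (measureReal_mono (subset_univ _)) (by positivity)
        (by linarith)
  have hlim : Tendsto (fun ε : ℝ => ∫ t in Ioo (0 : ℝ) 1,
      κ.real (Metric.closedBall x (ε * -Real.log t)) / (2 * ε)) (𝓝[>] 0)
      (𝓝 (∫ t in Ioo (0 : ℝ) 1, ℓ * -Real.log t)) := by
    refine tendsto_integral_filter_of_dominated_convergence (fun t => C * -Real.log t) ?_ ?_ ?_ ?_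
    · filter_upwards [self_mem_nhdsWithin] with ε hε
      have hmono : Monotone fun r => κ.real (Metric.closedBall x r) := fun a b hab =>
        measureReal_mono (Metric.closedBall_subset_closedBall hab)
      exact ((hmono.measurable.comp (by fun_prop : Measurable fun t => ε * -Real.log t)).div_const
        _).aestronglyMeasurable
    · filter_upwards [self_mem_nhdsWithin] with ε hε
      refine (ae_restrict_iff' measurableSet_Ioo).2 (ae_of_all _ fun t ht => ?_)
      have hε' : 0 < ε := hε
      have hl : 0 < -Real.log t := by linarith [Real.log_neg ht.1 ht.2]
      rw [Real.norm_of_nonneg (by positivity)]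
      have := hC (ε * -Real.log t) (by positivity)
      rw [div_le_iff₀ (by positivity)] at this ⊢
      linarith
    · exact (integrableOn_Ioc_neg_log.mono_set Ioo_subset_Ioc_self).const_mul C
    · refine (ae_restrict_iff' measurableSet_Ioo).2 (ae_of_all _ fun t ht => ?_)
      have hl : 0 < -Real.log t := by linarith [Real.log_neg ht.1 ht.2]
      have h1 : Tendsto (fun ε : ℝ => ε * -Real.log t) (𝓝[>] 0) (𝓝[>] 0) := by
        refine tendsto_nhdsWithin_iff.2 ⟨?_, ?_⟩
        · have : Tendsto (fun ε : ℝ => ε * -Real.log t) (𝓝 0) (𝓝 (0 * -Real.log t)) :=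
            (continuous_mul_const _).tendsto 0
          rw [zero_mul] at this
          exact this.mono_left nhdsWithin_le_nhds
        · filter_upwards [self_mem_nhdsWithin] with ε hε
          exact mul_pos hε hl
      refine ((h.comp h1).mul_const (-Real.log t)).congr' ?_
      filter_upwards [self_mem_nhdsWithin] with ε hε
      have hε' : 0 < ε := hε
      rw [Function.comp_apply, ← mul_assoc, div_mul_eq_mul_div, mul_div_mul_right _ _ hl.ne']
  rw [integral_const_mul, ← integral_Ioc_eq_integral_Ioo, integral_Ioc_neg_log, mul_one] at hlim
  refine hlim.congr' ?_
  filter_upwards [self_mem_nhdsWithin] with ε hε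
  exact (hform ε hε).symm

theorem ae_tendsto_measureReal_closedBall_div (κ : Measure ℝ) [IsFiniteMeasure κ] :
    ∀ᵐ x, Tendsto (fun r => κ.real (Metric.closedBall x r) / (2 * r)) (𝓝[>] 0)
      (𝓝 (κ.rnDeriv volume x).toReal) := by
  filter_upwards [Besicovitch.ae_tendsto_rnDeriv κ volume, κ.rnDeriv_lt_top volume] with x hx hx2
  refine ((ENNReal.tendsto_toReal hx2.ne).comp hx).congr' ?_
  filter_upwards [self_mem_nhdsWithin] with r hr
  have hr' : 0 < r := hr
  rw [Function.comp_apply, Real.volume_closedBall, ENNReal.toReal_div,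
    ENNReal.toReal_ofReal (by positivity)]
  rfl

/-- Two probability measures with the same cumulative distribution function on `A` have the same
density on `A`. -/
theorem ae_rnDeriv_eq_of_mem_coincidenceSet (μ ν : Measure ℝ) [IsProbabilityMeasure μ]
    [IsProbabilityMeasure ν] :
    ∀ᵐ x, x ∈ coincidenceSet μ ν → μ.rnDeriv volume x = ν.rnDeriv volume x := by
  set A := coincidenceSet μ ν
  -- Points of `A` isolated on the right are countable. At any other point of `A`, the difference of
  -- the distribution functions vanishes along a sequence in `A` converging to it, so its
  -- derivative, where it exists, is 0.
  have hcount : ∀ᵐ x : ℝ, x ∉ {x ∈ A | 𝓝[A ∩ Ioi x] x = ⊥} :=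
    measure_eq_zero_iff_ae_notMem.1 (countable_setOfPred_isolated_right_within.measure_zero _)
  have h1 := (ProbabilityTheory.cdf μ).ae_hasDerivAt
  have h2 := (ProbabilityTheory.cdf ν).ae_hasDerivAt
  rw [ProbabilityTheory.measure_cdf] at h1 h2
  filter_upwards [hcount, h1, h2, μ.rnDeriv_lt_top volume, ν.rnDeriv_lt_top volume]
    with x hx hμ hν hμt hνt hxA
  have hacc : AccPt x (𝓟 A) := by
    rw [accPt_principal_iff_nhdsWithin]
    have : (𝓝[A ∩ Ioi x] x).NeBot := neBot_iff.2 fun h => hx ⟨hxA, h⟩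
    exact this.mono (nhdsWithin_mono _ fun y hy => ⟨hy.1, (mem_Ioi.1 hy.2).ne'⟩)
  have hd := (hμ.sub hν).hasDerivWithinAt (s := A)
  have hz : HasDerivWithinAt ((ProbabilityTheory.cdf μ : ℝ → ℝ) - (ProbabilityTheory.cdf ν : ℝ → ℝ))
      0 A x := by
    refine (hasDerivWithinAt_const x A (0 : ℝ)).congr (fun y hy => ?_) ?_
    · exact sub_eq_zero.2 hy
    · exact sub_eq_zero.2 hxA
  have := hacc.uniqueDiffWithinAt.eq_deriv _ hd hz
  rw [← ENNReal.toReal_eq_toReal_iff' hμt.ne hνt.ne]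
  linarith

theorem measurableSet_coincidenceSet (μ ν : Measure ℝ) : MeasurableSet (coincidenceSet μ ν) :=
  measurableSet_eq_fun (ProbabilityTheory.monotone_cdf μ).measurable
    (ProbabilityTheory.monotone_cdf ν).measurable

theorem restrict_coincidenceSet_eq {μ ν : Measure ℝ} [IsProbabilityMeasure μ]
    [IsProbabilityMeasure ν] (hμ : μ ≪ volume) (hν : ν ≪ volume) :
    μ.restrict (coincidenceSet μ ν) = ν.restrict (coincidenceSet μ ν) := by
  have hA := measurableSet_coincidenceSet μ ν
  have h := withDensity_congr_ae ((ae_restrict_iff' hA).2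
    (ae_rnDeriv_eq_of_mem_coincidenceSet μ ν))
  rwa [← restrict_withDensity hA, ← restrict_withDensity hA,
    Measure.withDensity_rnDeriv_eq μ volume hμ, Measure.withDensity_rnDeriv_eq ν volume hν] at h

/-- The positive part of the logarithm is sublinear: an `L¹`-bounded family whose positive
logarithms tend to zero almost everywhere has positive logarithms tending to zero in mean. -/
theorem tendsto_integral_posLog {Ω ι : Type*} [MeasurableSpace Ω] (κ : Measure Ω)
    [IsFiniteMeasure κ] {l : Filter ι} [l.IsCountablyGenerated] {r : ι → Ω → ℝ} {C : ℝ}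
    (hr0 : ∀ᶠ i in l, ∀ x, 0 ≤ r i x) (hri : ∀ᶠ i in l, Integrable (r i) κ)
    (hrC : ∀ᶠ i in l, ∫ x, r i x ∂κ ≤ C)
    (hlim : ∀ᵐ x ∂κ, Tendsto (fun i => Real.posLog (r i x)) l (𝓝 0)) :
    Tendsto (fun i => ∫ x, Real.posLog (r i x) ∂κ) l (𝓝 0) := by
  -- For s > K, log⁺ s ≤ log⁺ K + log⁺(s/K) ≤ log⁺ K + s/K. The truncated part is handled by
  -- dominated convergence, and the remainder has integral at most C/K.
  have hsplit : ∀ K : ℝ, 1 ≤ K → ∀ s : ℝ, 0 ≤ s →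
      Real.posLog s ≤ Real.posLog (min s K) + K⁻¹ * s := by
    intro K hK s hs
    have hK0 : 0 < K := by linarith
    rcases le_total s K with h | h
    · rw [min_eq_left h]
      have : 0 ≤ K⁻¹ * s := by positivity
      linarith
    · rw [min_eq_right h]
      have h1 : s = K * (K⁻¹ * s) := by field_simp
      have h2 : Real.posLog (K⁻¹ * s) ≤ K⁻¹ * s := by
        have hp : 0 ≤ K⁻¹ * s := by positivity
        rw [Real.posLog_apply]
        exact max_le hp (Real.log_le_self hp)
      calc Real.posLog s = Real.posLog (K * (K⁻¹ * s)) := by rw [← h1]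
        _ ≤ _ := Real.posLog_mul
        _ ≤ _ := by linarith
  have hpm : Measurable Real.posLog := Real.continuous_posLog.measurable
  have htr : ∀ K : ℝ, 1 ≤ K →
      Tendsto (fun i => ∫ x, Real.posLog (min (r i x) K) ∂κ) l (𝓝 0) := by
    intro K hK
    have := tendsto_integral_filter_of_dominated_convergence (μ := κ) (l := l)
      (F := fun i x => Real.posLog (min (r i x) K)) (f := fun _ => (0 : ℝ))
      (fun _ => Real.posLog K) ?_ ?_ (integrable_const _) ?_
    · simpa using this
    · filter_upwards [hri] with i hi
      exact (hpm.comp_aemeasurable (hi.1.aemeasurable.min aemeasurable_const)).aestronglyMeasurable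
    · filter_upwards [hr0] with i hi
      refine ae_of_all _ fun x => ?_
      rw [Real.norm_of_nonneg Real.posLog_nonneg]
      exact Real.posLog_le_posLog (le_min (hi x) (by linarith)) (min_le_right _ _)
    · filter_upwards [hlim] with x hx
      refine tendsto_of_tendsto_of_tendsto_of_le_of_le' tendsto_const_nhds hx
        (Eventually.of_forall fun i => Real.posLog_nonneg) ?_
      filter_upwards [hr0] with i hi
      exact Real.posLog_le_posLog (le_min (hi x) (by linarith)) (min_le_left _ _)
  rw [Metric.tendsto_nhds]
  intro η hη
  obtain ⟨K, hK1, hKC⟩ : ∃ K : ℝ, 1 ≤ K ∧ K⁻¹ * C < η / 2 := by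
    refine ⟨max 1 (2 * |C| / η + 1), le_max_left _ _, ?_⟩
    have h1 : 2 * |C| / η + 1 ≤ max 1 (2 * |C| / η + 1) := le_max_right _ _
    have h0 : 0 < max 1 (2 * |C| / η + 1) := lt_of_lt_of_le one_pos (le_max_left _ _)
    rw [inv_mul_lt_iff₀ h0]
    have h2 : 2 * |C| / η < max 1 (2 * |C| / η + 1) := by linarith
    rw [div_lt_iff₀ hη] at h2
    have := le_abs_self C
    nlinarith
  filter_upwards [hr0, hri, hrC, (htr K hK1).eventually (gt_mem_nhds (half_pos hη))]
    with i h0 hi hC hlt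
  rw [dist_zero_right, Real.norm_of_nonneg (integral_nonneg fun x => Real.posLog_nonneg)]
  have hmi : Integrable (fun x => Real.posLog (min (r i x) K)) κ := by
    refine Integrable.of_bound
      (hpm.comp_aemeasurable (hi.1.aemeasurable.min aemeasurable_const)).aestronglyMeasurable
      (Real.posLog K) (ae_of_all _ fun x => ?_)
    rw [Real.norm_of_nonneg Real.posLog_nonneg]
    exact Real.posLog_le_posLog (le_min (h0 x) (by linarith)) (min_le_right _ _)
  calc ∫ x, Real.posLog (r i x) ∂κ ≤ ∫ x, (Real.posLog (min (r i x) K) + K⁻¹ * r i x) ∂κ := by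
        refine integral_mono_of_nonneg (ae_of_all _ fun x => Real.posLog_nonneg)
          (hmi.add (hi.const_mul _)) (ae_of_all _ fun x => hsplit K hK1 _ (h0 x))
    _ = ∫ x, Real.posLog (min (r i x) K) ∂κ + K⁻¹ * ∫ x, r i x ∂κ := by
        rw [integral_add hmi (hi.const_mul _), integral_const_mul]
    _ ≤ ∫ x, Real.posLog (min (r i x) K) ∂κ + K⁻¹ * C := by
        have : 0 ≤ K⁻¹ := inv_nonneg.2 (by linarith)
        gcongr
    _ < η := by linarith

end OneDim
end

noncomputable section

/-- `μ` and `ν` are absolutely continuous and carried by the interval `[-R, R]`. -/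
structure BoundedMarginals (μ ν : Measure ℝ) (R : ℝ) : Prop where
  pos : 0 < R
  ac_left : μ ≪ volume
  ac_right : ν ≪ volume
  left : μ (Icc (-R) R)ᶜ = 0
  right : ν (Icc (-R) R)ᶜ = 0

/-! ### Distribution functions of measures with a density -/

section Cdf

theorem continuous_cdf_of_ac {μ : Measure ℝ} [IsProbabilityMeasure μ] (hμ : μ ≪ volume) :
    Continuous (ProbabilityTheory.cdf μ) := by
  rw [continuous_iff_continuousAt]
  intro x
  have hm : Monotone (ProbabilityTheory.cdf μ) := ProbabilityTheory.monotone_cdf μ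
  rw [hm.continuousAt_iff_leftLim_eq_rightLim, StieltjesFunction.rightLim_eq]
  have h : (ProbabilityTheory.cdf μ).measure {x} = 0 := by
    rw [ProbabilityTheory.measure_cdf]; exact hμ (by simp)
  rw [StieltjesFunction.measure_singleton, ENNReal.ofReal_eq_zero] at h
  exact le_antisymm (hm.leftLim_le le_rfl) (by linarith)

/-- Otherwise inner regularity gives a compact subset of positive measure, which lies to the left of
its own greatest point. -/
theorem measure_eq_zero_of_forall_inter_Iic {μ : Measure ℝ} [IsFiniteMeasure μ] {S : Set ℝ}
    (hS : MeasurableSet S) (h : ∀ x ∈ S, μ (S ∩ Iic x) = 0) : μ S = 0 := by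
  by_contra hne
  obtain ⟨K, hKS, hKc, hK⟩ := hS.exists_lt_isCompact (pos_iff_ne_zero.2 hne)
  have hKn : K.Nonempty := by
    rw [nonempty_iff_ne_empty]; rintro rfl; simp at hK
  obtain ⟨x, hxK, hx⟩ := hKc.exists_isGreatest hKn
  exact hK.ne' (measure_mono_null (t := S ∩ Iic x) (fun z hz => ⟨hKS hz, hx hz⟩) (h x (hKS hxK)))

theorem measurable_cdf {μ : Measure ℝ} : Measurable (ProbabilityTheory.cdf μ) :=
  (ProbabilityTheory.monotone_cdf μ).measurable

variable {μ : Measure ℝ} [IsProbabilityMeasure μ]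

theorem ae_cdf_pos : ∀ᵐ x ∂μ, 0 < ProbabilityTheory.cdf μ x := by
  have : μ {x | ProbabilityTheory.cdf μ x ≤ 0} = 0 := by
    refine measure_eq_zero_of_forall_inter_Iic
      (measurableSet_le measurable_cdf measurable_const) fun x hx => ?_
    refine measure_mono_null inter_subset_right ?_
    rw [← ProbabilityTheory.ofReal_cdf, ENNReal.ofReal_eq_zero]
    exact hx
  filter_upwards [measure_eq_zero_iff_ae_notMem.1 this] with x hx
  exact not_le.1 hx

theorem ae_cdf_lt_of_lt (z : ℝ) :
    ∀ᵐ x ∂μ, z < x → ProbabilityTheory.cdf μ z < ProbabilityTheory.cdf μ x := by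
  have : μ {x | z < x ∧ ProbabilityTheory.cdf μ x ≤ ProbabilityTheory.cdf μ z} = 0 := by
    refine measure_eq_zero_of_forall_inter_Iic
      (measurableSet_Ioi.inter (measurableSet_le measurable_cdf measurable_const)) fun x hx => ?_
    refine measure_mono_null (t := Ioc z x) (fun y hy => ⟨hy.1.1, hy.2⟩) ?_
    rw [← ProbabilityTheory.measure_cdf μ, StieltjesFunction.measure_Ioc, ENNReal.ofReal_eq_zero]
    linarith [hx.2]
  filter_upwards [measure_eq_zero_iff_ae_notMem.1 this] with x hx hzx
  by_contra h
  exact hx ⟨hzx, not_lt.1 h⟩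

theorem ae_forall_cdf_lt_of_lt :
    ∀ᵐ x ∂μ, ∀ z < x, ProbabilityTheory.cdf μ z < ProbabilityTheory.cdf μ x := by
  have : ∀ᵐ x ∂μ, ∀ q : ℚ, (q : ℝ) < x →
      ProbabilityTheory.cdf μ q < ProbabilityTheory.cdf μ x := ae_all_iff.2 fun q => ae_cdf_lt_of_lt _
  filter_upwards [this] with x hx z hz
  obtain ⟨q, hq1, hq2⟩ := exists_rat_btwn hz
  exact (ProbabilityTheory.monotone_cdf μ hq1.le).trans_lt (hx q hq2)

/-- The cumulative distribution function pushes an atomless measure to the uniform one. -/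
theorem measure_cdf_le (hμ : μ ≪ volume) {v : ℝ} (h0 : 0 ≤ v) (h1 : v ≤ 1) :
    μ {x | ProbabilityTheory.cdf μ x ≤ v} = ENNReal.ofReal v := by
  rcases h1.eq_or_lt with rfl | h1
  · have : {x | ProbabilityTheory.cdf μ x ≤ 1} = univ :=
      eq_univ_of_forall fun x => ProbabilityTheory.cdf_le_one μ x
    rw [this]; simp
  rcases h0.eq_or_lt with rfl | h0
  · rw [ENNReal.ofReal_zero, measure_eq_zero_iff_ae_notMem]
    filter_upwards [ae_cdf_pos (μ := μ)] with x hx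
    exact not_le.2 hx
  obtain ⟨z, hz⟩ : v ∈ range (ProbabilityTheory.cdf μ) := by
    refine mem_range_of_exists_le_of_exists_ge (continuous_cdf_of_ac hμ) ?_ ?_
    · exact (((ProbabilityTheory.tendsto_cdf_atBot μ).eventually (gt_mem_nhds h0)).exists).imp
        fun _ h => h.le
    · exact (((ProbabilityTheory.tendsto_cdf_atTop μ).eventually (lt_mem_nhds h1)).exists).imp
        fun _ h => h.le
  rw [← hz, ProbabilityTheory.ofReal_cdf]
  refine measure_congr ?_
  filter_upwards [ae_cdf_lt_of_lt (μ := μ) z] with x hx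
  refine propext ⟨fun h => ?_, fun h => ProbabilityTheory.monotone_cdf μ h⟩
  by_contra hn
  exact absurd (hx (not_le.1 hn)) (not_lt.2 h)

end Cdf

/-! ### The Kantorovich potential and the reduced cost -/

section Potential

variable (μ ν : Measure ℝ)

/-- The sign of the difference of the cumulative distribution functions. -/
def cdfSign (t : ℝ) : ℝ :=
  if ProbabilityTheory.cdf ν t < ProbabilityTheory.cdf μ t then 1
  else if ProbabilityTheory.cdf μ t < ProbabilityTheory.cdf ν t then -1 else 0

/-- A Kantorovich potential for the distance cost that is constant on each component of the
coincidence set. -/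
def kantorovichPotential (x : ℝ) : ℝ := ∫ t in (0 : ℝ)..x, cdfSign μ ν t

/-- The cost `|y - x|` reduced by the Kantorovich potential. -/
def reducedCost (p : ℝ × ℝ) : ℝ :=
  |p.2 - p.1| - (kantorovichPotential μ ν p.2 - kantorovichPotential μ ν p.1)

theorem measurable_cdfSign : Measurable (cdfSign μ ν) := by
  have h1 := (ProbabilityTheory.monotone_cdf μ).measurable
  have h2 := (ProbabilityTheory.monotone_cdf ν).measurable
  exact Measurable.ite (measurableSet_lt h2 h1) measurable_const
    (Measurable.ite (measurableSet_lt h1 h2) measurable_const measurable_const)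

theorem abs_cdfSign_le (t : ℝ) : |cdfSign μ ν t| ≤ 1 := by
  unfold cdfSign; split_ifs <;> simp

theorem cdfSign_of_mem {t : ℝ} (ht : t ∈ coincidenceSet μ ν) : cdfSign μ ν t = 0 := by
  have : ProbabilityTheory.cdf μ t = ProbabilityTheory.cdf ν t := ht
  simp [cdfSign, this]

theorem intervalIntegrable_cdfSign (x y : ℝ) :
    IntervalIntegrable (cdfSign μ ν) volume x y := by
  refine (intervalIntegrable_const (c := (1 : ℝ))).mono_fun
    (measurable_cdfSign μ ν).aestronglyMeasurable (ae_of_all _ fun t => ?_)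
  simpa using abs_cdfSign_le μ ν t

theorem kantorovichPotential_sub (x y : ℝ) :
    kantorovichPotential μ ν y - kantorovichPotential μ ν x = ∫ t in x..y, cdfSign μ ν t :=
  intervalIntegral.integral_interval_sub_left (intervalIntegrable_cdfSign _ _ _ _)
    (intervalIntegrable_cdfSign _ _ _ _)

theorem abs_kantorovichPotential_sub_le (x y : ℝ) :
    |kantorovichPotential μ ν y - kantorovichPotential μ ν x| ≤ |y - x| := by
  rw [kantorovichPotential_sub]
  simpa using intervalIntegral.norm_integral_le_of_norm_le_const (C := 1) (f := cdfSign μ ν)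
    (a := x) (b := y) fun t _ => abs_cdfSign_le μ ν t

@[fun_prop]
theorem continuous_kantorovichPotential : Continuous (kantorovichPotential μ ν) := by
  refine LipschitzWith.continuous (K := 1) (LipschitzWith.of_dist_le_mul fun x y => ?_)
  simpa [Real.dist_eq] using abs_kantorovichPotential_sub_le μ ν y x

@[fun_prop]
theorem continuous_reducedCost : Continuous (reducedCost μ ν) := by
  unfold reducedCost; fun_prop

theorem reducedCost_nonneg (p : ℝ × ℝ) : 0 ≤ reducedCost μ ν p := by
  have := (le_abs_self _).trans (abs_kantorovichPotential_sub_le μ ν p.1 p.2)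
  unfold reducedCost; linarith

theorem reducedCost_le (p : ℝ × ℝ) : reducedCost μ ν p ≤ 2 * |p.2 - p.1| := by
  have := (neg_abs_le _).trans' (neg_le_neg (abs_kantorovichPotential_sub_le μ ν p.1 p.2))
  unfold reducedCost; linarith

/-- The potential has slope at most 1 in absolute value and slope 0 on `A`, so between the two
points it gains at most the length of the complement of `A`. This is the only quantitative
information on the reduced cost used in the Gibbs estimates near `A`. -/
theorem volume_inter_uIcc_le_reducedCost (p : ℝ × ℝ) :
    volume (coincidenceSet μ ν ∩ uIcc p.1 p.2) ≤ ENNReal.ofReal (reducedCost μ ν p) := by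
  set A := coincidenceSet μ ν
  have hA : MeasurableSet A := measurableSet_coincidenceSet μ ν
  have h1 : volume (A ∩ uIcc p.1 p.2) = volume (A ∩ uIoc p.1 p.2) := by
    refine measure_congr ((ae_eq_refl A).inter ?_)
    rw [uIcc, uIoc]
    exact Ioc_ae_eq_Icc.symm
  have hfin : volume (uIoc p.1 p.2) ≠ ⊤ := by rw [uIoc]; simp
  rw [h1, ENNReal.le_ofReal_iff_toReal_le (measure_ne_top_of_subset inter_subset_right hfin)
    (reducedCost_nonneg μ ν p)]
  have h2 := intervalIntegral.norm_integral_le_integral_norm_uIoc (f := cdfSign μ ν) (a := p.1)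
    (b := p.2) (μ := volume)
  have h3 : ∫ t in uIoc p.1 p.2, ‖cdfSign μ ν t‖ ≤ ∫ t in uIoc p.1 p.2, (1 - A.indicator 1 t) := by
    have hi : IntegrableOn (A.indicator (1 : ℝ → ℝ)) (uIoc p.1 p.2) := by
      refine Integrable.indicator ?_ hA
      exact integrableOn_const hfin
    refine setIntegral_mono_on (intervalIntegrable_iff.1 (intervalIntegrable_cdfSign μ ν _ _)).norm
      ((integrableOn_const hfin).sub hi) measurableSet_uIoc fun t _ => ?_
    by_cases ht : t ∈ A
    · simp [ht, cdfSign_of_mem μ ν ht]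
    · simpa [ht] using abs_cdfSign_le μ ν t
  have h4 : ∫ t in uIoc p.1 p.2, (1 - A.indicator 1 t) = |p.2 - p.1| - volume.real (A ∩ uIoc p.1 p.2) := by
    have hi : IntegrableOn (A.indicator (1 : ℝ → ℝ)) (uIoc p.1 p.2) := by
      refine Integrable.indicator ?_ hA
      exact integrableOn_const hfin
    have hc : IntegrableOn (fun _ => (1 : ℝ)) (uIoc p.1 p.2) := integrableOn_const hfin
    rw [integral_sub hc hi, setIntegral_indicator hA, setIntegral_const]
    simp only [Pi.one_apply, smul_eq_mul, mul_one, integral_const, measureReal_restrict_apply_univ]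
    rw [inter_comm A, uIoc, Real.volume_real_Ioc_of_le min_le_max, max_sub_min_eq_abs]
  rw [← kantorovichPotential_sub, Real.norm_eq_abs] at h2
  have h5 := le_abs_self (kantorovichPotential μ ν p.2 - kantorovichPotential μ ν p.1)
  change volume.real _ ≤ _
  unfold reducedCost
  linarith

end Potential

/-! ### Duality and the structure of optimal plans -/

section Plans

variable {μ ν : Measure ℝ} {R : ℝ}

theorem ae_fst_of_ae {γ : ProbabilityMeasure (ℝ × ℝ)} (hγ : γ ∈ transportPlans μ ν)
    {P : ℝ → Prop} (h : ∀ᵐ x ∂μ, P x) : ∀ᵐ p ∂(γ : Measure (ℝ × ℝ)), P p.1 := by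
  rw [← hγ.1] at h
  exact ae_of_ae_map measurable_fst.aemeasurable h

theorem ae_snd_of_ae {γ : ProbabilityMeasure (ℝ × ℝ)} (hγ : γ ∈ transportPlans μ ν)
    {P : ℝ → Prop} (h : ∀ᵐ x ∂ν, P x) : ∀ᵐ p ∂(γ : Measure (ℝ × ℝ)), P p.2 := by
  rw [← hγ.2] at h
  exact ae_of_ae_map measurable_snd.aemeasurable h

namespace BoundedMarginals

theorem ae_left (hR : BoundedMarginals μ ν R) : ∀ᵐ x ∂μ, x ∈ Icc (-R) R := hR.left

theorem ae_right (hR : BoundedMarginals μ ν R) : ∀ᵐ x ∂ν, x ∈ Icc (-R) R := hR.right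

theorem ae_mem (hR : BoundedMarginals μ ν R) {γ : ProbabilityMeasure (ℝ × ℝ)} (hγ : γ ∈ transportPlans μ ν) :
    ∀ᵐ p ∂(γ : Measure (ℝ × ℝ)), p.1 ∈ Icc (-R) R ∧ p.2 ∈ Icc (-R) R :=
  (ae_fst_of_ae hγ hR.ae_left).and (ae_snd_of_ae hγ hR.ae_right)

theorem integrable_of_continuous (hR : BoundedMarginals μ ν R) {γ : ProbabilityMeasure (ℝ × ℝ)} (hγ : γ ∈ transportPlans μ ν)
    {f : ℝ × ℝ → ℝ} (hf : Continuous f) : Integrable f (γ : Measure (ℝ × ℝ)) := by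
  obtain ⟨C, hC⟩ := (isCompact_Icc.prod isCompact_Icc).exists_bound_of_continuousOn
    (hf.continuousOn (s := Icc (-R) R ×ˢ Icc (-R) R))
  exact Integrable.of_bound hf.aestronglyMeasurable C ((hR.ae_mem hγ).mono fun p hp => hC p hp)

/-- The potential terms depend on the marginals only, so passing to the reduced cost shifts the
energy by a constant. -/
theorem mongeCost_eq (hR : BoundedMarginals μ ν R) [IsProbabilityMeasure μ] [IsProbabilityMeasure ν]
    {γ : ProbabilityMeasure (ℝ × ℝ)} (hγ : γ ∈ transportPlans μ ν) :
    mongeCost γ = ∫ p, reducedCost μ ν p ∂(γ : Measure (ℝ × ℝ))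
      + (∫ y, kantorovichPotential μ ν y ∂ν - ∫ x, kantorovichPotential μ ν x ∂μ) := by
  have h1 : ∫ y, kantorovichPotential μ ν y ∂ν
      = ∫ p, kantorovichPotential μ ν p.2 ∂(γ : Measure (ℝ × ℝ)) := by
    rw [← integral_map (f := kantorovichPotential μ ν) measurable_snd.aemeasurable
      (Continuous.aestronglyMeasurable (by fun_prop)), hγ.2]
  have h2 : ∫ x, kantorovichPotential μ ν x ∂μ
      = ∫ p, kantorovichPotential μ ν p.1 ∂(γ : Measure (ℝ × ℝ)) := by
    rw [← integral_map (f := kantorovichPotential μ ν) measurable_fst.aemeasurable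
      (Continuous.aestronglyMeasurable (by fun_prop)), hγ.1]
  have i0 := hR.integrable_of_continuous hγ (continuous_reducedCost μ ν)
  have i1 := hR.integrable_of_continuous hγ
    (f := fun p => kantorovichPotential μ ν p.2) (by fun_prop)
  have i2 := hR.integrable_of_continuous hγ
    (f := fun p => kantorovichPotential μ ν p.1) (by fun_prop)
  have i3 : Integrable (fun p : ℝ × ℝ => kantorovichPotential μ ν p.2
      - kantorovichPotential μ ν p.1) (γ : Measure (ℝ × ℝ)) := i1.sub i2
  rw [h1, h2, ← integral_sub i1 i2, ← integral_add i0 i3, mongeCost]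
  refine integral_congr_ae (ae_of_all _ fun p => ?_)
  simp [reducedCost]

/-- The monotone rearrangement is an optimal plan. -/
theorem exists_plan_reducedCost_eq_zero (hR : BoundedMarginals μ ν R) [IsProbabilityMeasure μ] [IsProbabilityMeasure ν] :
    ∃ γ ∈ transportPlans μ ν, ∫ p, reducedCost μ ν p ∂(γ : Measure (ℝ × ℝ)) = 0 := by
  set Fμ := ProbabilityTheory.cdf μ
  set Fν := ProbabilityTheory.cdf ν
  have hFν : Continuous Fν := continuous_cdf_of_ac hR.ac_right
  -- The quantile map of ν composed with the distribution function of μ. When that function vanishes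
  -- at x, the set is the whole line and has no infimum; such x are μ-null, and the value 0 there is
  -- arbitrary.
  set T : ℝ → ℝ := fun x => if 0 < Fμ x then sInf {y | Fμ x ≤ Fν y} else 0 with hT
  have hTle : ∀ x, 0 < Fμ x → ∀ y, T x ≤ y ↔ Fμ x ≤ Fν y := by
    intro x hx y
    have hcl : IsClosed {y | Fμ x ≤ Fν y} := isClosed_le continuous_const hFν
    have hne : {y | Fμ x ≤ Fν y}.Nonempty := by
      refine ⟨R, ?_⟩
      have : ν (Iic R) = 1 := (prob_compl_eq_zero_iff measurableSet_Iic).1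
        (measure_mono_null (t := (Icc (-R) R)ᶜ) (fun z hz h => hz h.2) hR.right)
      have h1 : Fν R = 1 := by
        simp only [Fν]
        rw [ProbabilityTheory.cdf_eq_real, measureReal_def, this, ENNReal.toReal_one]
      change Fμ x ≤ Fν R
      rw [h1]
      exact ProbabilityTheory.cdf_le_one μ x
    have hbb : BddBelow {y | Fμ x ≤ Fν y} := by
      obtain ⟨z, hz⟩ := ((ProbabilityTheory.tendsto_cdf_atBot ν).eventually (gt_mem_nhds hx)).exists
      refine ⟨z, fun y hy => ?_⟩
      by_contra h
      exact absurd (le_trans hy (ProbabilityTheory.monotone_cdf ν (not_le.1 h).le)) (not_le.2 hz)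
    simp only [hT, if_pos hx]
    refine ⟨fun h => ?_, fun h => csInf_le hbb h⟩
    exact le_trans (hcl.csInf_mem hne hbb) (ProbabilityTheory.monotone_cdf ν h)
  have hTm : Measurable T := by
    refine measurable_of_Iic fun y => ?_
    have : T ⁻¹' Iic y = ({x | 0 < Fμ x} ∩ {x | Fμ x ≤ Fν y}) ∪ ({x | Fμ x ≤ 0} ∩ {_x | 0 ≤ y}) := by
      ext x
      simp only [mem_preimage, mem_Iic, mem_union, mem_inter_iff, mem_ofPred_eq]
      rcases lt_or_ge 0 (Fμ x) with h | h
      · simp [hTle x h, h]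
      · simp [hT, h, h.not_gt]
    rw [this]
    exact ((measurableSet_lt measurable_const measurable_cdf).inter
      (measurableSet_le measurable_cdf measurable_const)).union
      ((measurableSet_le measurable_cdf measurable_const).inter (MeasurableSet.const _))
  have hmap : μ.map T = ν := by
    have : IsProbabilityMeasure (μ.map T) := Measure.isProbabilityMeasure_map hTm.aemeasurable
    refine Measure.ext_of_Iic _ _ fun y => ?_
    rw [Measure.map_apply hTm measurableSet_Iic, ← ProbabilityTheory.ofReal_cdf,
      ← measure_cdf_le hR.ac_left (ProbabilityTheory.cdf_nonneg ν y)
        (ProbabilityTheory.cdf_le_one ν y)]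
    refine measure_congr ?_
    filter_upwards [ae_cdf_pos (μ := μ)] with x hx
    exact propext (hTle x hx y)
  have hpm : Measurable fun x => (x, T x) := measurable_id.prodMk hTm
  refine ⟨⟨μ.map fun x => (x, T x), Measure.isProbabilityMeasure_map hpm.aemeasurable⟩, ⟨?_, ?_⟩, ?_⟩
  · simp only [ProbabilityMeasure.coe_mk]
    rw [Measure.map_map measurable_fst hpm]
    exact Measure.map_id
  · simp only [ProbabilityMeasure.coe_mk]
    rw [Measure.map_map measurable_snd hpm]
    exact hmap
  · simp only [ProbabilityMeasure.coe_mk]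
    rw [integral_map hpm.aemeasurable (Continuous.aestronglyMeasurable (by fun_prop))]
    refine integral_eq_zero_of_ae ?_
    filter_upwards [ae_cdf_pos (μ := μ), ae_forall_cdf_lt_of_lt (μ := μ)] with x hx hlt
    simp only [reducedCost, kantorovichPotential_sub, Pi.zero_apply]
    rcases le_total x (T x) with h | h
    · have : ∫ t in x..T x, cdfSign μ ν t = ∫ t in x..T x, (1 : ℝ) := by
        rw [intervalIntegral.integral_of_le h, intervalIntegral.integral_of_le h,
          integral_Ioc_eq_integral_Ioo, integral_Ioc_eq_integral_Ioo]
        refine setIntegral_congr_fun measurableSet_Ioo fun t ht => ?_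
        -- Strictly between x and T x the point t has not yet reached the quantile level of x, so
        -- the potential has slope 1 there.
        have h1 : Fν t < Fμ x := by
          by_contra hn
          exact absurd ((hTle x hx t).2 (not_lt.1 hn)) (not_le.2 ht.2)
        have h2 : Fν t < Fμ t := h1.trans_le (ProbabilityTheory.monotone_cdf μ ht.1.le)
        exact if_pos h2
      rw [this, intervalIntegral.integral_const, abs_of_nonneg (sub_nonneg.2 h)]
      simp
    · have : ∫ t in T x..x, cdfSign μ ν t = ∫ t in T x..x, (-1 : ℝ) := by
        rw [intervalIntegral.integral_of_le h, intervalIntegral.integral_of_le h,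
          integral_Ioc_eq_integral_Ioo, integral_Ioc_eq_integral_Ioo]
        refine setIntegral_congr_fun measurableSet_Ioo fun t ht => ?_
        have h1 : Fμ x ≤ Fν t := (hTle x hx t).1 ht.1.le
        -- Slope -1 requires a strict inequality; it comes from the strict increase of F_μ to the
        -- left of μ-almost every x.
        have h2 : Fμ t < Fν t := (hlt t ht.2).trans_le h1
        simp only [cdfSign]
        rw [if_neg h2.le.not_gt, if_pos h2]
      rw [intervalIntegral.integral_symm, this, intervalIntegral.integral_const,
        abs_of_nonpos (sub_nonpos.2 h)]
      simp

theorem wassersteinOne_eq (hR : BoundedMarginals μ ν R) [IsProbabilityMeasure μ] [IsProbabilityMeasure ν] :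
    wassersteinOne μ ν
      = ∫ y, kantorovichPotential μ ν y ∂ν - ∫ x, kantorovichPotential μ ν x ∂μ := by
  obtain ⟨γ, hγ, h0⟩ := hR.exists_plan_reducedCost_eq_zero
  refine IsLeast.csInf_eq ⟨⟨γ, hγ, ?_⟩, ?_⟩
  · rw [hR.mongeCost_eq hγ, h0, zero_add]
  · rintro _ ⟨γ', hγ', rfl⟩
    rw [hR.mongeCost_eq hγ']
    exact le_add_of_nonneg_left (integral_nonneg fun p => reducedCost_nonneg μ ν p)

theorem mongeCost_sub_wassersteinOne (hR : BoundedMarginals μ ν R) [IsProbabilityMeasure μ] [IsProbabilityMeasure ν]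
    {γ : ProbabilityMeasure (ℝ × ℝ)} (hγ : γ ∈ transportPlans μ ν) :
    mongeCost γ - wassersteinOne μ ν = ∫ p, reducedCost μ ν p ∂(γ : Measure (ℝ × ℝ)) := by
  rw [hR.mongeCost_eq hγ, hR.wassersteinOne_eq]
  ring

theorem wassersteinOne_le (hR : BoundedMarginals μ ν R) [IsProbabilityMeasure μ] [IsProbabilityMeasure ν]
    {γ : ProbabilityMeasure (ℝ × ℝ)} (hγ : γ ∈ transportPlans μ ν) :
    wassersteinOne μ ν ≤ mongeCost γ := by
  rw [← sub_nonneg, hR.mongeCost_sub_wassersteinOne hγ]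
  exact integral_nonneg fun p => reducedCost_nonneg μ ν p

theorem ae_reducedCost_eq_zero (hR : BoundedMarginals μ ν R) [IsProbabilityMeasure μ] [IsProbabilityMeasure ν]
    {γ : ProbabilityMeasure (ℝ × ℝ)} (hγ : γ ∈ optimalPlans μ ν) :
    ∀ᵐ p ∂(γ : Measure (ℝ × ℝ)), reducedCost μ ν p = 0 := by
  have h := hR.mongeCost_sub_wassersteinOne hγ.1
  rw [hγ.2, sub_self, eq_comm, integral_eq_zero_iff_of_nonneg (reducedCost_nonneg μ ν)
    (hR.integrable_of_continuous hγ.1 (continuous_reducedCost μ ν))] at h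
  exact h

/-- μ charges neither the complement of its support nor the Lebesgue-null frontier, so almost every
point of `A` is interior. -/
theorem ae_mem_nhds_of_frontier (hμ : μ ≪ volume)
    (hfr : volume (frontier (coincidenceSet μ ν ∩ μ.support)) = 0) :
    ∀ᵐ x ∂μ, x ∈ coincidenceSet μ ν → coincidenceSet μ ν ∈ 𝓝 x := by
  have h1 : ∀ᵐ x ∂μ, x ∉ frontier (coincidenceSet μ ν ∩ μ.support) :=
    measure_eq_zero_iff_ae_notMem.1 (hμ hfr)
  filter_upwards [h1, Measure.support_mem_ae (μ := μ)] with x hx hs hA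
  have : x ∈ interior (coincidenceSet μ ν ∩ μ.support) := by
    by_contra hn
    exact hx ⟨subset_closure ⟨hA, hs⟩, hn⟩
  exact mem_of_superset (mem_interior_iff_mem_nhds.1 this) inter_subset_left

/-- An optimal plan does not move the mass of the coincidence set. -/
theorem ae_eq_of_mem_coincidenceSet (hR : BoundedMarginals μ ν R) [IsProbabilityMeasure μ] [IsProbabilityMeasure ν]
    (hfr : volume (frontier (coincidenceSet μ ν ∩ μ.support)) = 0)
    {γ : ProbabilityMeasure (ℝ × ℝ)} (hγ : γ ∈ optimalPlans μ ν) :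
    ∀ᵐ p ∂(γ : Measure (ℝ × ℝ)), p.1 ∈ coincidenceSet μ ν → p.2 = p.1 := by
  filter_upwards [hR.ae_reducedCost_eq_zero hγ,
    ae_fst_of_ae hγ.1 (ae_mem_nhds_of_frontier hR.ac_left hfr)] with p hp hn hA
  -- Zero reduced cost makes `A` null between the two points, yet `A` contains a whole interval
  -- starting at the first point in the direction of the second.
  by_contra hne
  have h0 := volume_inter_uIcc_le_reducedCost μ ν p
  rw [hp, ENNReal.ofReal_zero, nonpos_iff_eq_zero] at h0
  obtain ⟨δ, hδ, hball⟩ := Metric.mem_nhds_iff.1 (hn hA)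
  rcases lt_or_gt_of_ne hne with h | h
  · have hsub : Ioo (max (p.1 - δ) p.2) p.1 ⊆ coincidenceSet μ ν ∩ uIcc p.1 p.2 := by
      intro t ht
      have ht1 := max_lt_iff.1 ht.1
      refine ⟨hball ?_, ?_⟩
      · rw [Real.ball_eq_Ioo]; exact ⟨ht1.1, by linarith [ht.2]⟩
      · rw [uIcc_of_ge h.le]; exact ⟨ht1.2.le, ht.2.le⟩
    have := measure_mono_null hsub h0
    rw [Real.volume_Ioo, ENNReal.ofReal_eq_zero] at this
    have h3 : max (p.1 - δ) p.2 < p.1 := max_lt (by linarith) h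
    linarith
  · have hsub : Ioo p.1 (min (p.1 + δ) p.2) ⊆ coincidenceSet μ ν ∩ uIcc p.1 p.2 := by
      intro t ht
      have ht1 := lt_min_iff.1 ht.2
      refine ⟨hball ?_, ?_⟩
      · rw [Real.ball_eq_Ioo]; exact ⟨by linarith [ht.1], ht1.1⟩
      · rw [uIcc_of_le h.le]; exact ⟨ht.1.le, ht1.2.le⟩
    have := measure_mono_null hsub h0
    rw [Real.volume_Ioo, ENNReal.ofReal_eq_zero] at this
    have h3 : p.1 < min (p.1 + δ) p.2 := lt_min (by linarith) h
    linarith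

/-- Mass count: the fixed part of `A` already fills `A` in the second marginal, since μ and ν agree
on `A`. -/
theorem measure_compl_prod_coincidenceSet (hR : BoundedMarginals μ ν R) [IsProbabilityMeasure μ] [IsProbabilityMeasure ν]
    (hfr : volume (frontier (coincidenceSet μ ν ∩ μ.support)) = 0)
    {γ : ProbabilityMeasure (ℝ × ℝ)} (hγ : γ ∈ optimalPlans μ ν) :
    (γ : Measure (ℝ × ℝ)) ((coincidenceSet μ ν)ᶜ ×ˢ coincidenceSet μ ν) = 0 := by
  set A := coincidenceSet μ ν
  have hA : MeasurableSet A := measurableSet_coincidenceSet μ ν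
  have h1 : (γ : Measure (ℝ × ℝ)) (A ×ˢ A) = μ A := by
    conv_rhs => rw [← hγ.1.1, Measure.map_apply measurable_fst hA]
    refine measure_congr ?_
    filter_upwards [hR.ae_eq_of_mem_coincidenceSet hfr hγ] with p hp
    refine propext ⟨fun h => h.1, fun h => ⟨h, ?_⟩⟩
    rw [hp h]; exact h
  have h2 : (γ : Measure (ℝ × ℝ)) (A ×ˢ A) + (γ : Measure (ℝ × ℝ)) (Aᶜ ×ˢ A) = ν A := by
    conv_rhs => rw [← hγ.1.2, Measure.map_apply measurable_snd hA]
    rw [← measure_union (disjoint_left.2 fun p hp hp' => hp'.1 hp.1) (hA.compl.prod hA)]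
    congr 1
    ext p
    by_cases h : p.1 ∈ A <;> simp [h]
  have h3 : μ A = ν A := by
    have := congrArg (fun κ => κ univ) (restrict_coincidenceSet_eq hR.ac_left hR.ac_right)
    simpa using this
  rw [h1, h3] at h2
  exact (ENNReal.add_right_inj (measure_ne_top _ _)).1 (h2.trans (add_zero _).symm)

/-- The set on the right constrains only the first coordinate, whose law is the same for all plans.
This is what lets the restriction pass to narrow limits. -/
theorem restrict_compl_prod_compl (hR : BoundedMarginals μ ν R) [IsProbabilityMeasure μ] [IsProbabilityMeasure ν]
    (hfr : volume (frontier (coincidenceSet μ ν ∩ μ.support)) = 0)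
    {γ : ProbabilityMeasure (ℝ × ℝ)} (hγ : γ ∈ optimalPlans μ ν) :
    (γ : Measure (ℝ × ℝ)).restrict ((coincidenceSet μ ν)ᶜ ×ˢ (coincidenceSet μ ν)ᶜ)
      = (γ : Measure (ℝ × ℝ)).restrict ((coincidenceSet μ ν)ᶜ ×ˢ univ) := by
  refine Measure.restrict_congr_set ?_
  filter_upwards [measure_eq_zero_iff_ae_notMem.1 (hR.measure_compl_prod_coincidenceSet hfr hγ)]
    with p hp
  refine propext ⟨fun h => ⟨h.1, mem_univ _⟩, fun h => ⟨h.1, fun h2 => hp ⟨h.1, h2⟩⟩⟩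

end BoundedMarginals

end Plans
end

noncomputable section

/-- The density of `μ` with respect to Lebesgue measure. -/
def lebDensity (μ : Measure ℝ) (x : ℝ) : ℝ := (μ.rnDeriv volume x).toReal

theorem lebDensity_nonneg (μ : Measure ℝ) (x : ℝ) : 0 ≤ lebDensity μ x := ENNReal.toReal_nonneg

@[fun_prop]
theorem measurable_lebDensity (μ : Measure ℝ) : Measurable (lebDensity μ) :=
  (Measure.measurable_rnDeriv _ _).ennreal_toReal

theorem ae_lebDensity_pos {μ : Measure ℝ} [IsFiniteMeasure μ] (hμ : μ ≪ volume) :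
    ∀ᵐ x ∂μ, 0 < lebDensity μ x := by
  filter_upwards [Measure.rnDeriv_pos hμ, hμ.ae_le (μ.rnDeriv_lt_top volume)] with x h1 h2
  exact ENNReal.toReal_pos h1.ne' h2.ne

theorem setLIntegral_eq_lebDensity_mul {μ : Measure ℝ} [IsFiniteMeasure μ] (hμ : μ ≪ volume)
    {A : Set ℝ} (hA : MeasurableSet A) {g : ℝ → ENNReal} (hg : Measurable g) :
    ∫⁻ x in A, g x ∂μ = ∫⁻ x in A, ENNReal.ofReal (lebDensity μ x) * g x := by
  rw [← lintegral_indicator hA, ← lintegral_rnDeriv_mul hμ (hg.indicator hA).aemeasurable,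
    ← lintegral_indicator hA]
  refine lintegral_congr_ae ?_
  filter_upwards [μ.rnDeriv_lt_top volume] with x hx
  by_cases h : x ∈ A
  · simp [h, lebDensity, ENNReal.ofReal_toReal hx.ne]
  · simp [h]

/-! ### Asymptotics of the Gibbs normalizing factor -/

section Gibbs

/-- The normalizing factor of the Gibbs kernel of the reduced cost. -/
def gibbsMass (μ ν : Measure ℝ) (ε x : ℝ) : ℝ :=
  ∫ y, Real.exp (-(reducedCost μ ν (x, y) / ε)) ∂ν

variable {μ ν : Measure ℝ} {R : ℝ}

theorem measurable_gibbsMass [IsProbabilityMeasure ν] (ε : ℝ) : Measurable (gibbsMass μ ν ε) := by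
  have : Continuous fun p : ℝ × ℝ => Real.exp (-(reducedCost μ ν p / ε)) := by fun_prop
  exact this.stronglyMeasurable.integral_prod_right'.measurable

theorem integrable_exp_neg_reducedCost [IsProbabilityMeasure ν] {ε : ℝ} (hε : 0 < ε) (x : ℝ) :
    Integrable (fun y => Real.exp (-(reducedCost μ ν (x, y) / ε))) ν := by
  refine Integrable.of_bound (Continuous.aestronglyMeasurable (by fun_prop)) 1
    (ae_of_all _ fun y => ?_)
  rw [Real.norm_of_nonneg (Real.exp_nonneg _), Real.exp_le_one_iff]
  have := div_nonneg (reducedCost_nonneg μ ν (x, y)) hε.le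
  linarith

theorem gibbsMass_le_one [IsProbabilityMeasure ν] {ε : ℝ} (hε : 0 < ε) (x : ℝ) : gibbsMass μ ν ε x ≤ 1 := by
  have : ∫ y, Real.exp (-(reducedCost μ ν (x, y) / ε)) ∂ν ≤ ∫ _, (1 : ℝ) ∂ν := by
    refine integral_mono (integrable_exp_neg_reducedCost hε x) (integrable_const _) fun y => ?_
    rw [Real.exp_le_one_iff]
    have := div_nonneg (reducedCost_nonneg μ ν (x, y)) hε.le
    linarith
  rwa [integral_const, smul_eq_mul, mul_one, probReal_univ] at this

/-- The reduced cost is at most twice the distance, hence at most 4R. The bound is crude in ε and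
serves only for positivity and for integrability at fixed ε. -/
theorem BoundedMarginals.exp_le_gibbsMass [IsProbabilityMeasure ν] (hR : BoundedMarginals μ ν R) {ε : ℝ} (hε : 0 < ε) {x : ℝ}
    (hx : x ∈ Icc (-R) R) : Real.exp (-(4 * R / ε)) ≤ gibbsMass μ ν ε x := by
  have : ∫ _, Real.exp (-(4 * R / ε)) ∂ν ≤ gibbsMass μ ν ε x := by
    refine integral_mono_ae (integrable_const _) (integrable_exp_neg_reducedCost hε x) ?_
    filter_upwards [hR.ae_right] with y hy
    refine Real.exp_le_exp.2 (neg_le_neg ?_)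
    refine div_le_div_of_nonneg_right ((reducedCost_le μ ν (x, y)).trans ?_) hε.le
    have : |y - x| ≤ 2 * R := abs_le.2 ⟨by linarith [hy.1, hx.2], by linarith [hy.2, hx.1]⟩
    simp only
    linarith
  simpa using this

theorem gibbsMass_nonneg (ε x : ℝ) : 0 ≤ gibbsMass μ ν ε x :=
  integral_nonneg fun _ => Real.exp_nonneg _

/-- After exchanging the integrals, y is fixed and x runs over `A`, where the layer-cake bound
applies. -/
theorem lintegral_gibbsMass_le [IsProbabilityMeasure ν] {ε : ℝ} (hε : 0 < ε) :
    ∫⁻ x in coincidenceSet μ ν, ENNReal.ofReal (gibbsMass μ ν ε x) ≤ ENNReal.ofReal (2 * ε) := by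
  have hm : Measurable fun p : ℝ × ℝ =>
      ENNReal.ofReal (Real.exp (-(reducedCost μ ν p / ε))) := by
    have : Continuous fun p : ℝ × ℝ => Real.exp (-(reducedCost μ ν p / ε)) := by fun_prop
    exact this.measurable.ennreal_ofReal
  calc _ = ∫⁻ x in coincidenceSet μ ν,
        ∫⁻ y, ENNReal.ofReal (Real.exp (-(reducedCost μ ν (x, y) / ε))) ∂ν := by
        refine lintegral_congr fun x => ?_
        exact ofReal_integral_eq_lintegral_ofReal (integrable_exp_neg_reducedCost hε x)
          (ae_of_all _ fun y => Real.exp_nonneg _)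
    _ = ∫⁻ y, (∫⁻ x in coincidenceSet μ ν,
        ENNReal.ofReal (Real.exp (-(reducedCost μ ν (x, y) / ε)))) ∂ν :=
        lintegral_lintegral_swap (f := fun x y =>
          ENNReal.ofReal (Real.exp (-(reducedCost μ ν (x, y) / ε)))) hm.aemeasurable
    _ ≤ ∫⁻ _, ENNReal.ofReal (2 * ε) ∂ν := by
        refine lintegral_mono fun y => ?_
        refine lintegral_exp_neg_div_le (measurableSet_coincidenceSet μ ν) y hε
          (c := fun x => reducedCost μ ν (x, y)) (Continuous.measurable (by fun_prop))
          (fun x => reducedCost_nonneg μ ν _) fun x => ?_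
        rw [uIcc_comm]
        exact volume_inter_uIcc_le_reducedCost μ ν (x, y)
    _ = _ := by simp

/-- The segment from x towards y stays in the ball, hence in `A`, for a length of at least this
minimum. -/
theorem min_le_reducedCost {x d : ℝ}
    (hball : Metric.ball x d ⊆ coincidenceSet μ ν) (y : ℝ) :
    min |x - y| d ≤ reducedCost μ ν (x, y) := by
  have h0 := volume_inter_uIcc_le_reducedCost μ ν (x, y)
  rw [Real.ball_eq_Ioo] at hball
  rcases le_total x y with h | h
  · have hsub : Ioo x (min y (x + d)) ⊆ coincidenceSet μ ν ∩ uIcc x y := fun t ht => by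
      have h2 := lt_min_iff.1 ht.2
      exact ⟨hball ⟨by linarith [ht.1], h2.2⟩, by rw [uIcc_of_le h]; exact ⟨ht.1.le, h2.1.le⟩⟩
    have := (measure_mono hsub).trans h0
    rw [Real.volume_Ioo, ENNReal.ofReal_le_ofReal_iff (reducedCost_nonneg _ _ _)] at this
    refine le_trans (le_of_eq ?_) this
    rw [abs_of_nonpos (by linarith), ← min_sub_sub_right]
    congr 1 <;> ring
  · have hsub : Ioo (max y (x - d)) x ⊆ coincidenceSet μ ν ∩ uIcc x y := fun t ht => by
      have h2 := max_lt_iff.1 ht.1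
      exact ⟨hball ⟨h2.2, by linarith [ht.2]⟩, by rw [uIcc_of_ge h]; exact ⟨h2.1.le, ht.2.le⟩⟩
    have := (measure_mono hsub).trans h0
    rw [Real.volume_Ioo, ENNReal.ofReal_le_ofReal_iff (reducedCost_nonneg _ _ _)] at this
    refine le_trans (le_of_eq ?_) this
    rw [abs_of_nonneg (by linarith), ← min_sub_sub_left]
    congr 1; ring

theorem tendsto_inv_mul_exp_neg_div {d : ℝ} (hd : 0 < d) :
    Tendsto (fun ε : ℝ => (2 * ε)⁻¹ * Real.exp (-(d / ε))) (𝓝[>] 0) (𝓝 0) := by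
  have h1 : Tendsto (fun t : ℝ => t * Real.exp (-t)) atTop (𝓝 0) := by
    simpa using Real.tendsto_pow_mul_exp_neg_atTop_nhds_zero 1
  have h2 : Tendsto (fun ε : ℝ => d / ε) (𝓝[>] 0) atTop := by
    simpa [div_eq_mul_inv] using tendsto_inv_nhdsGT_zero.const_mul_atTop hd
  have := (h1.comp h2).const_mul (2 * d)⁻¹
  rw [mul_zero] at this
  refine this.congr' ?_
  filter_upwards [self_mem_nhdsWithin] with ε hε
  have : ε ≠ 0 := (mem_Ioi.1 hε).ne'
  simp only [Function.comp_apply]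
  field_simp

/-- Since c ≥ min(|x-y|, d), exp(-c/ε) is at most exp(-|x-y|/ε) + exp(-d/ε). Divided by 2ε, the
first term averages to the density of ν at x and the second disappears. Only an upper bound results,
hence the positive part. -/
theorem tendsto_posLog_gibbsMass [IsProbabilityMeasure ν] {x : ℝ} (hx : coincidenceSet μ ν ∈ 𝓝 x)
    (hpos : 0 < lebDensity ν x)
    (hlim : Tendsto (fun r => ν.real (Metric.closedBall x r) / (2 * r)) (𝓝[>] 0)
      (𝓝 (lebDensity ν x))) :
    Tendsto (fun ε => Real.posLog ((2 * ε)⁻¹ * gibbsMass μ ν ε x / lebDensity ν x)) (𝓝[>] 0)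
      (𝓝 0) := by
  obtain ⟨d, hd, hball⟩ := Metric.mem_nhds_iff.1 hx
  have h1 := ((tendsto_integral_exp_kernel ν x _ hlim).add
    (tendsto_inv_mul_exp_neg_div hd)).div_const (lebDensity ν x)
  rw [add_zero, div_self hpos.ne'] at h1
  have h2 := (Real.continuous_posLog.tendsto 1).comp h1
  rw [Real.posLog_one] at h2
  refine tendsto_of_tendsto_of_tendsto_of_le_of_le' tendsto_const_nhds h2
    (Eventually.of_forall fun ε => Real.posLog_nonneg) ?_
  filter_upwards [self_mem_nhdsWithin] with ε hε
  have hε' : 0 < ε := hε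
  have hg := gibbsMass_nonneg (μ := μ) (ν := ν) ε x
  refine Real.posLog_le_posLog (by positivity) (div_le_div_of_nonneg_right ?_ hpos.le)
  rw [← mul_add]
  refine mul_le_mul_of_nonneg_left ?_ (by positivity)
  have hi : Integrable (fun y => Real.exp (-(|x - y| / ε))) ν := by
    refine Integrable.of_bound (Continuous.aestronglyMeasurable (by fun_prop)) 1
      (ae_of_all _ fun y => ?_)
    rw [Real.norm_of_nonneg (Real.exp_nonneg _), Real.exp_le_one_iff]
    have := div_nonneg (abs_nonneg (x - y)) hε'.le
    linarith
  have h3 : ∫ y, Real.exp (-(|x - y| / ε)) ∂ν + Real.exp (-(d / ε))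
      = ∫ y, (Real.exp (-(|x - y| / ε)) + Real.exp (-(d / ε))) ∂ν := by
    rw [integral_add hi (integrable_const _)]; simp
  rw [h3]
  refine integral_mono (integrable_exp_neg_reducedCost hε' x) (hi.add (integrable_const _))
    fun y => ?_
  have h4 := min_le_reducedCost hball y
  simp only
  rcases min_le_iff.1 h4 with h | h
  · have : Real.exp (-(reducedCost μ ν (x, y) / ε)) ≤ Real.exp (-(|x - y| / ε)) :=
      Real.exp_le_exp.2 (neg_le_neg (div_le_div_of_nonneg_right h hε'.le))
    linarith [Real.exp_nonneg (-(d / ε))]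
  · have : Real.exp (-(reducedCost μ ν (x, y) / ε)) ≤ Real.exp (-(d / ε)) :=
      Real.exp_le_exp.2 (neg_le_neg (div_le_div_of_nonneg_right h hε'.le))
    linarith [Real.exp_nonneg (-(|x - y| / ε))]

theorem BoundedMarginals.integrable_log_gibbsMass [IsProbabilityMeasure μ] [IsProbabilityMeasure ν]
     (hR : BoundedMarginals μ ν R) {ε : ℝ}
    (hε : 0 < ε) : Integrable (fun x => Real.log (gibbsMass μ ν ε x)) μ := by
  refine Integrable.of_bound ((measurable_gibbsMass ε).log).aestronglyMeasurable (4 * R / ε) ?_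
  filter_upwards [hR.ae_left] with x hx
  have h1 := hR.exp_le_gibbsMass hε hx
  have h2 := (Real.exp_pos _).trans_le h1
  have h3 := Real.log_nonpos h2.le (gibbsMass_le_one hε x)
  rw [Real.norm_of_nonpos h3]
  have := (Real.le_log_iff_exp_le h2).2 h1
  linarith

/-- The normalizing factors are at most `2 ε` times the density, in the logarithmic mean. -/
theorem BoundedMarginals.eventually_integral_log_gibbsMass_le [IsProbabilityMeasure μ] [IsProbabilityMeasure ν]
     (hR : BoundedMarginals μ ν R)
    (hfr : volume (frontier (coincidenceSet μ ν ∩ μ.support)) = 0)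
    (hlog : Integrable (fun x => Real.log (lebDensity μ x)) μ) {η : ℝ} (hη : 0 < η) :
    ∀ᶠ ε in 𝓝[>] 0, ∫ x in coincidenceSet μ ν, Real.log (gibbsMass μ ν ε x) ∂μ
      - Real.log (2 * ε) * μ.real (coincidenceSet μ ν)
      < ∫ x in coincidenceSet μ ν, Real.log (lebDensity μ x) ∂μ + η := by
  set A := coincidenceSet μ ν with hAdef
  have hA : MeasurableSet A := measurableSet_coincidenceSet μ ν
  set κ := μ.restrict A with hκ
  have hfg : ∀ᵐ x ∂κ, lebDensity ν x = lebDensity μ x := by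
    refine (ae_restrict_iff' hA).2 ?_
    filter_upwards [hR.ac_left.ae_le (ae_rnDeriv_eq_of_mem_coincidenceSet μ ν)] with x hx hxA
    rw [lebDensity, lebDensity, hx hxA]
  have hpos : ∀ᵐ x ∂κ, 0 < lebDensity μ x := ae_restrict_of_ae (ae_lebDensity_pos hR.ac_left)
  -- In the mean over μ the density in the denominator cancels, so the mean of this ratio on `A` is
  -- at most 1 for every ε.
  set r : ℝ → ℝ → ℝ := fun ε x => (2 * ε)⁻¹ * gibbsMass μ ν ε x / lebDensity μ x with hr
  have hrm : ∀ ε, Measurable (r ε) := fun ε =>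
    ((measurable_gibbsMass ε).const_mul _).div (measurable_lebDensity μ)
  have hr0 : ∀ ε, 0 < ε → ∀ x, 0 ≤ r ε x := fun ε hε x =>
    div_nonneg (mul_nonneg (by positivity) (gibbsMass_nonneg _ _)) (lebDensity_nonneg _ _)
  have hrl : ∀ ε, 0 < ε → ∫⁻ x, ENNReal.ofReal (r ε x) ∂κ ≤ 1 := by
    intro ε hε
    rw [hκ, setLIntegral_eq_lebDensity_mul hR.ac_left hA (hrm ε).ennreal_ofReal]
    calc _ ≤ ∫⁻ x in A, ENNReal.ofReal (2 * ε)⁻¹ * ENNReal.ofReal (gibbsMass μ ν ε x) := by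
          refine lintegral_mono fun x => ?_
          rw [← ENNReal.ofReal_mul (lebDensity_nonneg _ _), ← ENNReal.ofReal_mul (by positivity)]
          refine ENNReal.ofReal_le_ofReal ?_
          rcases (lebDensity_nonneg μ x).eq_or_lt with h | h
          · rw [← h, zero_mul]
            exact mul_nonneg (by positivity) (gibbsMass_nonneg _ _)
          · simp only [hr]
            rw [mul_div_cancel₀ _ h.ne']
      _ = ENNReal.ofReal (2 * ε)⁻¹ * ∫⁻ x in A, ENNReal.ofReal (gibbsMass μ ν ε x) :=
          lintegral_const_mul _ (measurable_gibbsMass ε).ennreal_ofReal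
      _ ≤ ENNReal.ofReal (2 * ε)⁻¹ * ENNReal.ofReal (2 * ε) := by
          gcongr; exact lintegral_gibbsMass_le hε
      _ = 1 := by
          rw [← ENNReal.ofReal_mul (by positivity), inv_mul_cancel₀ (by positivity),
            ENNReal.ofReal_one]
  have hri : ∀ ε, 0 < ε → Integrable (r ε) κ := fun ε hε => by
    refine ⟨(hrm ε).aestronglyMeasurable, ?_⟩
    rw [hasFiniteIntegral_iff_ofReal (ae_of_all _ (hr0 ε hε))]
    exact (hrl ε hε).trans_lt ENNReal.one_lt_top
  have hlim := tendsto_integral_posLog κ (l := 𝓝[>] (0 : ℝ)) (r := r) (C := 1)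
    (by filter_upwards [self_mem_nhdsWithin] with ε hε; exact hr0 ε hε)
    (by filter_upwards [self_mem_nhdsWithin] with ε hε; exact hri ε hε)
    (by
      filter_upwards [self_mem_nhdsWithin] with ε hε
      rw [integral_eq_lintegral_of_nonneg_ae (ae_of_all _ (hr0 ε hε))
        (hrm ε).aestronglyMeasurable]
      exact ENNReal.toReal_le_of_le_ofReal zero_le_one (by simpa using hrl ε hε))
    (by
      have h1 : ∀ᵐ x ∂κ, A ∈ 𝓝 x :=
        (ae_restrict_iff' hA).2 (BoundedMarginals.ae_mem_nhds_of_frontier hR.ac_left hfr)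
      have h2 : ∀ᵐ x ∂κ, Tendsto (fun r => ν.real (Metric.closedBall x r) / (2 * r)) (𝓝[>] 0)
          (𝓝 (lebDensity ν x)) :=
        ae_restrict_of_ae (hR.ac_left.ae_le (ae_tendsto_measureReal_closedBall_div ν))
      filter_upwards [h1, h2, hpos, hfg] with x hx1 hx2 hx3 hx4
      have := tendsto_posLog_gibbsMass hx1 (by rw [hx4]; exact hx3) hx2
      simpa only [hr, ← hx4] using this)
  filter_upwards [hlim.eventually (gt_mem_nhds hη), self_mem_nhdsWithin] with ε hlt hε
  have hε' : 0 < ε := hε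
  have hpl : Integrable (fun x => Real.posLog (r ε x)) κ := by
    refine (hri ε hε').mono' (Real.continuous_posLog.measurable.comp (hrm ε)).aestronglyMeasurable
      (ae_of_all _ fun x => ?_)
    rw [Real.norm_of_nonneg Real.posLog_nonneg, Real.posLog_apply]
    exact max_le (hr0 ε hε' x) (Real.log_le_self (hr0 ε hε' x))
  have hl : Integrable (fun x => Real.log (lebDensity μ x)) κ := hlog.integrableOn
  have hgl : Integrable (fun x => Real.log (gibbsMass μ ν ε x)) κ :=
    (hR.integrable_log_gibbsMass hε').integrableOn
  have hc : ∫ _, Real.log (2 * ε) ∂κ = Real.log (2 * ε) * μ.real A := by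
    rw [integral_const, smul_eq_mul, mul_comm, hκ, measureReal_restrict_apply_univ]
  have hsum : Integrable (fun x => Real.log (2 * ε) + Real.log (lebDensity μ x)) κ :=
    (integrable_const _).add hl
  have hle : ∫ x, Real.log (gibbsMass μ ν ε x) ∂κ
      ≤ ∫ x, (Real.log (2 * ε) + Real.log (lebDensity μ x) + Real.posLog (r ε x)) ∂κ := by
    refine integral_mono_ae hgl (hsum.add hpl) ?_
    have hmem : ∀ᵐ x ∂κ, x ∈ Icc (-R) R := ae_restrict_of_ae hR.ae_left
    filter_upwards [hpos, hmem] with x hx hxR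
    have hg : 0 < gibbsMass μ ν ε x := (Real.exp_pos _).trans_le (hR.exp_le_gibbsMass hε' hxR)
    have h1 : gibbsMass μ ν ε x = 2 * ε * lebDensity μ x * r ε x := by
      simp only [hr]; field_simp
    have h2 : 0 < r ε x := by simp only [hr]; positivity
    have h3 : Real.log (r ε x) ≤ Real.posLog (r ε x) := by
      rw [Real.posLog_apply]; exact le_max_right _ _
    conv_lhs => rw [h1]
    rw [Real.log_mul (by positivity) h2.ne', Real.log_mul (by positivity) hx.ne']
    linarith
  rw [integral_add hsum hpl, integral_add (integrable_const _) hl, hc] at hle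
  linarith

end Gibbs

/-! ### The lower bound inequality -/

section LowerBound

variable {μ ν : Measure ℝ} {R : ℝ}

theorem measureReal_prod_univ {γ : ProbabilityMeasure (ℝ × ℝ)} (hγ : γ ∈ transportPlans μ ν)
    {B : Set ℝ} (hB : MeasurableSet B) : (γ : Measure (ℝ × ℝ)).real (B ×ˢ univ) = μ.real B := by
  rw [measureReal_def, measureReal_def]
  conv_rhs => rw [← hγ.1, Measure.map_apply measurable_fst hB]
  rw [prod_univ]

theorem setIntegral_fst_eq {γ : ProbabilityMeasure (ℝ × ℝ)} (hγ : γ ∈ transportPlans μ ν)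
    {B : Set ℝ} (hB : MeasurableSet B) {f : ℝ → ℝ} (hf : Measurable f) :
    ∫ p in B ×ˢ univ, f p.1 ∂(γ : Measure (ℝ × ℝ)) = ∫ x in B, f x ∂μ := by
  have h := setIntegral_map (μ := (γ : Measure (ℝ × ℝ))) (f := f) (g := Prod.fst) hB
    hf.aestronglyMeasurable measurable_fst.aemeasurable
  rw [hγ.1] at h
  rw [h, prod_univ]

theorem integrable_fst {γ : ProbabilityMeasure (ℝ × ℝ)} (hγ : γ ∈ transportPlans μ ν)
    {f : ℝ → ℝ} (hf : Integrable f μ) : Integrable (fun p => f p.1) (γ : Measure (ℝ × ℝ)) := by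
  rw [← hγ.1] at hf
  exact hf.comp_measurable measurable_fst

/-- Lower bound of the entropy of a plan by testing with the Gibbs kernel on the coincidence set
and with a bounded continuous function on its complement. -/
theorem BoundedMarginals.le_relEnt_plan [IsProbabilityMeasure μ] [IsProbabilityMeasure ν]
     (hR : BoundedMarginals μ ν R)
    {γ : ProbabilityMeasure (ℝ × ℝ)} (hγ : γ ∈ transportPlans μ ν) {ε : ℝ} (hε : 0 < ε)
    (ψ : BoundedContinuousFunction (ℝ × ℝ) ℝ) :
    ((∫ p in (coincidenceSet μ ν)ᶜ ×ˢ univ, ψ p ∂(γ : Measure (ℝ × ℝ))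
      - ∫ p in (coincidenceSet μ ν)ᶜ ×ˢ univ, Real.exp (ψ p) ∂(μ.prod ν)
      + μ.real (coincidenceSet μ ν)ᶜ
      - ε⁻¹ * ∫ p, reducedCost μ ν p ∂(γ : Measure (ℝ × ℝ))
      - ∫ x in coincidenceSet μ ν, Real.log (gibbsMass μ ν ε x) ∂μ : ℝ) : EReal)
      ≤ relEnt (γ : Measure (ℝ × ℝ)) (μ.prod ν) := by
  set A := coincidenceSet μ ν with hAdef
  have hA : MeasurableSet A := measurableSet_coincidenceSet μ ν
  set S : Set (ℝ × ℝ) := A ×ˢ univ with hS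
  have hSm : MeasurableSet S := hA.prod MeasurableSet.univ
  have hSc : Sᶜ = Aᶜ ×ˢ univ := by rw [hS, prod_univ, prod_univ, preimage_compl]
  -- For μ-almost every x, the exponential of this function of y is a probability density with
  -- respect to ν.
  set a : ℝ × ℝ → ℝ := fun p => -(reducedCost μ ν p / ε) - Real.log (gibbsMass μ ν ε p.1) with ha
  classical
  set φ : ℝ × ℝ → ℝ := S.piecewise a ψ with hφ
  have hci := hR.integrable_of_continuous hγ (continuous_reducedCost μ ν)
  have hli := integrable_fst hγ (hR.integrable_log_gibbsMass (ν := ν) hε)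
  have hai : Integrable a (γ : Measure (ℝ × ℝ)) := (hci.div_const ε).neg.sub hli
  have hψi : Integrable ψ (γ : Measure (ℝ × ℝ)) := ψ.integrable _
  have hφi : Integrable φ (γ : Measure (ℝ × ℝ)) :=
    Integrable.piecewise hSm hai.integrableOn hψi.integrableOn
  have hlgm : Measurable fun x => Real.log (gibbsMass μ ν ε x) := (measurable_gibbsMass ε).log
  have hφγ : ∫ p in Aᶜ ×ˢ univ, ψ p ∂(γ : Measure (ℝ × ℝ))
      - ε⁻¹ * ∫ p, reducedCost μ ν p ∂(γ : Measure (ℝ × ℝ))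
      - ∫ x in A, Real.log (gibbsMass μ ν ε x) ∂μ ≤ ∫ p, φ p ∂(γ : Measure (ℝ × ℝ)) := by
    rw [hφ, integral_piecewise hSm hai.integrableOn hψi.integrableOn, hSc]
    have h1 : ∫ p in S, a p ∂(γ : Measure (ℝ × ℝ))
        = -(ε⁻¹ * ∫ p in S, reducedCost μ ν p ∂(γ : Measure (ℝ × ℝ)))
          - ∫ x in A, Real.log (gibbsMass μ ν ε x) ∂μ := by
      have hci' : Integrable (fun p => -(ε⁻¹ * reducedCost μ ν p))
          ((γ : Measure (ℝ × ℝ)).restrict S) := (hci.const_mul _).neg.integrableOn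
      rw [← setIntegral_fst_eq hγ hA hlgm, ← integral_const_mul, ← integral_neg,
        ← integral_sub hci' hli.integrableOn]
      refine integral_congr_ae (ae_of_all _ fun p => ?_)
      simp only [ha]; ring
    -- Enlarging the domain to the whole plane only weakens the bound, as the reduced cost is
    -- nonnegative; it makes the full excess cost appear.
    have h2 : ∫ p in S, reducedCost μ ν p ∂(γ : Measure (ℝ × ℝ))
        ≤ ∫ p, reducedCost μ ν p ∂(γ : Measure (ℝ × ℝ)) :=
      setIntegral_le_integral hci (ae_of_all _ (reducedCost_nonneg μ ν))
    have h3 := mul_le_mul_of_nonneg_left h2 (inv_nonneg.2 hε.le)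
    linarith
  have hψe : Integrable (fun p => Real.exp (ψ p)) (μ.prod ν) := by
    refine Integrable.of_bound (Continuous.aestronglyMeasurable (by fun_prop)) (Real.exp ‖ψ‖)
      (ae_of_all _ fun p => ?_)
    rw [Real.norm_of_nonneg (Real.exp_nonneg _)]
    exact Real.exp_le_exp.2 ((le_abs_self _).trans (ψ.norm_coe_le_norm p))
  have ham : Measurable a :=
    ((continuous_reducedCost μ ν).measurable.div_const ε).neg.sub (hlgm.comp measurable_fst)
  have hmemx : ∀ᵐ p ∂(μ.prod ν), p.1 ∈ Icc (-R) R := Measure.quasiMeasurePreserving_fst.ae hR.ae_left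
  have hae : Integrable (fun p => Real.exp (a p)) (μ.prod ν) := by
    refine Integrable.of_bound ham.exp.aestronglyMeasurable (Real.exp (4 * R / ε)) ?_
    filter_upwards [hmemx] with p hp
    rw [Real.norm_of_nonneg (Real.exp_nonneg _)]
    refine Real.exp_le_exp.2 ?_
    have h1 := hR.exp_le_gibbsMass hε hp
    have h2 := (Real.le_log_iff_exp_le ((Real.exp_pos _).trans_le h1)).2 h1
    have h3 := div_nonneg (reducedCost_nonneg μ ν p) hε.le
    simp only [ha]; linarith
  have hexpφ : (fun p => Real.exp (φ p))
      = S.piecewise (fun p => Real.exp (a p)) fun p => Real.exp (ψ p) := by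
    ext p
    by_cases hp : p ∈ S <;> simp [hφ, hp]
  have hφe : Integrable (fun p => Real.exp (φ p)) (μ.prod ν) := by
    rw [hexpφ]; exact Integrable.piecewise hSm hae.integrableOn hψe.integrableOn
  -- The Gibbs part contributes exactly μ(A). Subtracted from the total mass 1, it leaves the mass
  -- μ(Aᶜ) that belongs to the dual functional on the complement.
  have hφm : ∫ p, Real.exp (φ p) ∂(μ.prod ν)
      = μ.real A + ∫ p in Aᶜ ×ˢ univ, Real.exp (ψ p) ∂(μ.prod ν) := by
    rw [hexpφ, integral_piecewise hSm hae.integrableOn hψe.integrableOn, hSc]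
    congr 1
    have hae' := hae.integrableOn (s := S)
    rw [hS] at hae' ⊢
    rw [setIntegral_prod _ hae']
    have : ∀ᵐ x ∂μ.restrict A, ∫ y in univ, Real.exp (a (x, y)) ∂ν = 1 := by
      filter_upwards [ae_restrict_of_ae hR.ae_left] with x hx
      have h1 : 0 < gibbsMass μ ν ε x := (Real.exp_pos _).trans_le (hR.exp_le_gibbsMass hε hx)
      have h2 : ∀ y, Real.exp (a (x, y))
          = (gibbsMass μ ν ε x)⁻¹ * Real.exp (-(reducedCost μ ν (x, y) / ε)) := fun y => by
        simp only [ha]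
        rw [Real.exp_sub, Real.exp_log h1, div_eq_inv_mul]
      simp_rw [h2]
      rw [Measure.restrict_univ, integral_const_mul]
      exact inv_mul_cancel₀ h1.ne'
    rw [integral_congr_ae this]
    simp
  refine le_trans (EReal.coe_le_coe_iff.2 ?_) (le_relEnt hφi hφe)
  rw [hφm, probReal_univ, probReal_compl_eq_one_sub hA]
  linarith

/-- The indicator of `B` is not continuous, but it depends on x alone and every plan has first
marginal μ. An L¹(μ) approximation by a bounded continuous function is therefore uniform over all
plans. -/
theorem continuous_setIntegral_prod_univ (μ ν : Measure ℝ) [IsFiniteMeasure μ] {B : Set ℝ}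
    (hB : MeasurableSet B) (ψ : BoundedContinuousFunction (ℝ × ℝ) ℝ) :
    Continuous fun γ : transportPlans μ ν =>
      ∫ p in B ×ˢ univ, ψ p ∂((γ : ProbabilityMeasure (ℝ × ℝ)) : Measure (ℝ × ℝ)) := by
  refine continuous_of_uniform_approx_of_continuous fun V hV => ?_
  obtain ⟨η, hη, hηV⟩ := Metric.mem_uniformity_dist.1 hV
  have hBi : Integrable (B.indicator fun _ => (1 : ℝ)) μ := (integrable_const _).indicator hB
  obtain ⟨χ, hχ, hχi⟩ := hBi.exists_boundedContinuous_integral_sub_le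
    (show 0 < η / (2 * (‖ψ‖ + 1)) by positivity)
  set g : BoundedContinuousFunction (ℝ × ℝ) ℝ :=
    (χ.compContinuous ⟨Prod.fst, continuous_fst⟩) * ψ with hg
  have hgp : ∀ p, g p = χ p.1 * ψ p := fun p => rfl
  refine ⟨fun γ => ∫ p, g p ∂((γ : ProbabilityMeasure (ℝ × ℝ)) : Measure (ℝ × ℝ)),
    (ProbabilityMeasure.continuous_integral_boundedContinuousFunction g).comp continuous_subtype_val,
    fun γ => hηV ?_⟩
  have hprod : B ×ˢ (univ : Set ℝ) = Prod.fst ⁻¹' B := prod_univ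
  have hBm : MeasurableSet (B ×ˢ (univ : Set ℝ)) := hB.prod MeasurableSet.univ
  have hψi : Integrable ψ ((γ : ProbabilityMeasure (ℝ × ℝ)) : Measure (ℝ × ℝ)) := ψ.integrable _
  have hgi : Integrable g ((γ : ProbabilityMeasure (ℝ × ℝ)) : Measure (ℝ × ℝ)) := g.integrable _
  rw [Real.dist_eq, ← integral_indicator hBm, ← integral_sub (hψi.indicator hBm) hgi]
  have hmap : ∫ p, ‖B.indicator (fun _ => (1 : ℝ)) p.1 - χ p.1‖
      ∂((γ : ProbabilityMeasure (ℝ × ℝ)) : Measure (ℝ × ℝ))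
      = ∫ x, ‖B.indicator (fun _ => (1 : ℝ)) x - χ x‖ ∂μ := by
    conv_rhs => rw [← γ.2.1]
    rw [integral_map measurable_fst.aemeasurable]
    rw [γ.2.1]
    exact (hBi.sub hχi).norm.aestronglyMeasurable
  have hni : Integrable (fun p : ℝ × ℝ => ‖B.indicator (fun _ => (1 : ℝ)) p.1 - χ p.1‖)
      ((γ : ProbabilityMeasure (ℝ × ℝ)) : Measure (ℝ × ℝ)) := by
    have := (hBi.sub hχi).norm
    rw [← γ.2.1] at this
    exact this.comp_measurable measurable_fst
  calc |∫ p, ((B ×ˢ univ).indicator ψ p - g p)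
        ∂((γ : ProbabilityMeasure (ℝ × ℝ)) : Measure (ℝ × ℝ))|
      ≤ ∫ p, ‖B.indicator (fun _ => (1 : ℝ)) p.1 - χ p.1‖ * ‖ψ‖
        ∂((γ : ProbabilityMeasure (ℝ × ℝ)) : Measure (ℝ × ℝ)) := by
        rw [← Real.norm_eq_abs]
        refine norm_integral_le_of_norm_le (hni.mul_const _) (ae_of_all _ fun p => ?_)
        have : (B ×ˢ univ).indicator ψ p - g p
            = (B.indicator (fun _ => (1 : ℝ)) p.1 - χ p.1) * ψ p := by
          rw [hgp, hprod]
          by_cases hp : p.1 ∈ B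
          · rw [indicator_of_mem (show p ∈ Prod.fst ⁻¹' B from hp), indicator_of_mem hp]; ring
          · rw [indicator_of_notMem (show p ∉ Prod.fst ⁻¹' B from hp), indicator_of_notMem hp]; ring
        rw [this, norm_mul]
        exact mul_le_mul_of_nonneg_left (ψ.norm_coe_le_norm p) (norm_nonneg _)
    _ = (∫ x, ‖B.indicator (fun _ => (1 : ℝ)) x - χ x‖ ∂μ) * ‖ψ‖ := by
        rw [integral_mul_const, hmap]
    _ ≤ η / (2 * (‖ψ‖ + 1)) * ‖ψ‖ := by gcongr
    _ < η := by
        have h0 := norm_nonneg ψ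
        rw [div_mul_eq_mul_div, div_lt_iff₀ (by positivity)]
        nlinarith

theorem BoundedMarginals.continuous_mongeCost (hR : BoundedMarginals μ ν R) :
    Continuous fun γ : transportPlans μ ν => mongeCost γ.1 := by
  set g : BoundedContinuousFunction (ℝ × ℝ) ℝ := BoundedContinuousFunction.ofNormedAddCommGroup
    (fun p => min |p.2 - p.1| (2 * R)) (by fun_prop) (2 * R) (fun p => by
      rw [Real.norm_of_nonneg (le_min (abs_nonneg _) (by linarith [hR.pos]))]
      exact min_le_right _ _) with hg
  refine ((ProbabilityMeasure.continuous_integral_boundedContinuousFunction g).comp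
    continuous_subtype_val).congr fun γ => ?_
  refine integral_congr_ae ?_
  filter_upwards [hR.ae_mem γ.2] with p hp
  change min |p.2 - p.1| (2 * R) = |p.2 - p.1|
  refine min_eq_left (abs_le.2 ?_)
  constructor <;> linarith [hp.1.1, hp.1.2, hp.2.1, hp.2.2]

/-- The lower bound inequality of the `Γ`-convergence, along an arbitrary filter. -/
theorem BoundedMarginals.eventually_lt_rescaledCost [IsProbabilityMeasure μ] [IsProbabilityMeasure ν]
     (hR : BoundedMarginals μ ν R)
    (hfr : volume (frontier (coincidenceSet μ ν ∩ μ.support)) = 0)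
    (hlog : Integrable (fun x => Real.log (lebDensity μ x)) μ)
    {l : Filter ℝ} (hl : l ≤ 𝓝[>] 0) {u : ℝ → transportPlans μ ν} {γ : transportPlans μ ν}
    (hu : Tendsto u l (𝓝 γ)) {c : ℝ} (hc : (c : EReal) < limitCost μ ν γ) :
    ∀ᶠ ε in l, (c : EReal) < rescaledCost μ ν ε (u ε) := by
  set A := coincidenceSet μ ν with hAdef
  have hA : MeasurableSet A := measurableSet_coincidenceSet μ ν
  have hpos : ∀ᶠ ε in l, (0 : ℝ) < ε := hl self_mem_nhdsWithin
  -- Below 1/2 the absolute value of log(2ε) is -log(2ε).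
  have hsmall : ∀ᶠ ε in l, ε < 1 / 2 :=
    hl (mem_nhdsWithin_of_mem_nhds (gt_mem_nhds (by norm_num)))
  have hlow : ∀ {ε : ℝ} {γ' : transportPlans μ ν} {w : ℝ},
      (w : EReal) ≤ relEnt (γ'.1 : Measure (ℝ × ℝ)) (μ.prod ν) →
      (((1 / ε) * (mongeCost γ'.1 - wassersteinOne μ ν) + w
        - |Real.log (2 * ε)| * μ.real A : ℝ) : EReal) ≤ rescaledCost μ ν ε γ' := by
    intro ε γ' w hw
    rw [rescaledCost, EReal.coe_sub, EReal.coe_add]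
    exact EReal.sub_le_sub (add_le_add_right hw _) le_rfl
  by_cases hopt : γ.1 ∈ optimalPlans μ ν
  · rw [limitCost, if_pos hopt, hR.restrict_compl_prod_compl hfr hopt] at hc
    set I := ∫ x in A, Real.log (μ.rnDeriv volume x).toReal ∂μ with hI
    have hc' : ((c + I : ℝ) : EReal)
        < relEnt ((γ.1 : Measure (ℝ × ℝ)).restrict (Aᶜ ×ˢ univ)) (μ.prod ν) := by
      rw [EReal.coe_add]
      exact EReal.add_lt_of_lt_sub hc
    rw [relEnt_restrict _ _ (hA.compl.prod MeasurableSet.univ)] at hc'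
    obtain ⟨ψ, hψ⟩ := exists_boundedContinuous_lt_of_lt_relEnt hc'
    rw [measureReal_restrict_apply_univ, measureReal_prod_univ γ.2 hA.compl] at hψ
    set V := ∫ p in Aᶜ ×ˢ univ, ψ p ∂(γ.1 : Measure (ℝ × ℝ)) with hV
    set E := ∫ p in Aᶜ ×ˢ univ, Real.exp (ψ p) ∂(μ.prod ν) with hE
    set η := (V - E + μ.real Aᶜ - (c + I)) / 2 with hη
    have hη0 : 0 < η := by simp only [hη]; linarith
    have h1 := ((continuous_setIntegral_prod_univ μ ν hA.compl ψ).tendsto γ).comp hu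
    have h2 := h1.eventually (lt_mem_nhds (show V - η < V by linarith))
    have h3 := hl (hR.eventually_integral_log_gibbsMass_le hfr hlog hη0)
    filter_upwards [hpos, hsmall, h2, h3] with ε hε hε2 h2 h3
    refine lt_of_lt_of_le (EReal.coe_lt_coe_iff.2 ?_) (hlow (hR.le_relEnt_plan (u ε).2 hε ψ))
    rw [hR.mongeCost_sub_wassersteinOne (u ε).2, abs_of_nonpos
      (Real.log_nonpos (by linarith) (by linarith)), one_div]
    simp only [Function.comp_apply] at h2
    have h4 : ∫ x in A, Real.log (lebDensity μ x) ∂μ = I := rfl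
    rw [h4] at h3
    linarith
  · have hgap : 0 < mongeCost γ.1 - wassersteinOne μ ν := by
      refine sub_pos.2 (lt_of_le_of_ne (hR.wassersteinOne_le γ.2) fun h => hopt ⟨γ.2, h.symm⟩)
    set g := mongeCost γ.1 - wassersteinOne μ ν with hg
    have h1 : ∀ᶠ ε in l, g / 2 < mongeCost (u ε).1 - wassersteinOne μ ν := by
      have := ((hR.continuous_mongeCost.tendsto γ).comp hu).sub_const (wassersteinOne μ ν)
      exact this.eventually (lt_mem_nhds (by linarith))
    -- Away from optimality the energy gap divided by ε beats the logarithmic renormalization,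
    -- because ε log ε → 0.
    have h2 : ∀ᶠ ε in l, (c + 1) * ε + |Real.log (2 * ε)| * μ.real A * ε < g / 2 := by
      have hlim : Tendsto (fun ε : ℝ => (c + 1) * ε + |2 * ε * Real.log (2 * ε)| / 2 * μ.real A)
          (𝓝 0) (𝓝 ((c + 1) * 0 + |2 * 0 * Real.log (2 * 0)| / 2 * μ.real A)) := by
        have hc : Continuous fun ε : ℝ =>
            (c + 1) * ε + |2 * ε * Real.log (2 * ε)| / 2 * μ.real A := by
          have := Real.continuous_mul_log.comp (continuous_const_mul (2 : ℝ))
          exact (continuous_const_mul _).add ((this.abs.div_const 2).mul_const _)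
        exact hc.tendsto 0
      have h5 := (hlim.mono_left nhdsWithin_le_nhds).mono_left hl
      have h6 := h5.eventually (gt_mem_nhds (show (c + 1) * 0 +
        |2 * 0 * Real.log (2 * 0)| / 2 * μ.real A < g / 2 by simp; linarith))
      filter_upwards [h6, hpos] with ε h6 hε
      rw [abs_mul, abs_of_pos (by linarith : 0 < 2 * ε)] at h6
      linarith
    filter_upwards [h1, h2, hpos] with ε h1 h2 hε
    have h0 : ((0 : ℝ) : EReal) ≤ relEnt ((u ε).1 : Measure (ℝ × ℝ)) (μ.prod ν) := by
      have := le_relEnt (γ := ((u ε).1 : Measure (ℝ × ℝ))) (ρ := μ.prod ν) (φ := fun _ => 0)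
        (integrable_const _) (integrable_const _)
      simpa using this
    refine lt_of_lt_of_le (EReal.coe_lt_coe_iff.2 ?_) (hlow h0)
    have h7 : (c + 1 + |Real.log (2 * ε)| * μ.real A) * ε
        < mongeCost (u ε).1 - wassersteinOne μ ν := by linarith
    rw [← lt_div_iff₀ hε] at h7
    rw [one_div_mul_eq_div]
    linarith

end LowerBound
end

noncomputable section

/-! ### Block diagonal plans on a grid -/

section BlockKernel

variable {κ : Measure ℝ} {ϱ : ℝ → ℝ} {ε R : ℝ}

/-- The mass of `ϱ κ` on the cell of the grid of size `ε` that contains `x`. -/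
def cellMass (κ : Measure ℝ) (ϱ : ℝ → ℝ) (ε x : ℝ) : ℝ :=
  ∫ z in {z | ⌊z / ε⌋ = ⌊x / ε⌋}, ϱ z ∂κ

/-- The density of the block diagonal plan with marginals `ϱ κ` on the grid of size `ε`. -/
def blockKernel (κ : Measure ℝ) (ϱ : ℝ → ℝ) (ε : ℝ) (p : ℝ × ℝ) : ℝ :=
  if ⌊p.1 / ε⌋ = ⌊p.2 / ε⌋ then ϱ p.1 * ϱ p.2 / cellMass κ ϱ ε p.1 else 0

theorem measurable_cell (ε : ℝ) : Measurable fun x : ℝ => ⌊x / ε⌋ :=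
  Int.measurable_floor.comp (measurable_id.div_const ε)

theorem measurableSet_cell (ε : ℝ) (k : ℤ) : MeasurableSet {z : ℝ | ⌊z / ε⌋ = k} :=
  measurable_cell ε (measurableSet_singleton k)

theorem measurable_cellMass (κ : Measure ℝ) (ϱ : ℝ → ℝ) (ε : ℝ) : Measurable (cellMass κ ϱ ε) :=
  (measurable_of_countable fun k : ℤ => ∫ z in {z | ⌊z / ε⌋ = k}, ϱ z ∂κ).comp (measurable_cell ε)

theorem measurable_blockKernel (hϱ : Measurable ϱ) : Measurable (blockKernel κ ϱ ε) :=
  Measurable.ite (measurableSet_eq_fun ((measurable_cell ε).comp measurable_fst)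
    ((measurable_cell ε).comp measurable_snd))
    (((hϱ.comp measurable_fst).mul (hϱ.comp measurable_snd)).div
      ((measurable_cellMass κ ϱ ε).comp measurable_fst)) measurable_const

theorem cellMass_nonneg (h0 : ∀ x, 0 ≤ ϱ x) (x : ℝ) : 0 ≤ cellMass κ ϱ ε x :=
  integral_nonneg fun z => h0 z

theorem blockKernel_nonneg (h0 : ∀ x, 0 ≤ ϱ x) (p : ℝ × ℝ) : 0 ≤ blockKernel κ ϱ ε p := by
  unfold blockKernel
  split_ifs
  · exact div_nonneg (mul_nonneg (h0 _) (h0 _)) (cellMass_nonneg h0 _)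
  · exact le_rfl

theorem blockKernel_swap (p : ℝ × ℝ) : blockKernel κ ϱ ε p.swap = blockKernel κ ϱ ε p := by
  unfold blockKernel
  by_cases h : ⌊p.1 / ε⌋ = ⌊p.2 / ε⌋
  · simp only [Prod.fst_swap, Prod.snd_swap, cellMass, h]
    rw [mul_comm (ϱ p.1)]
  · simp only [Prod.fst_swap, Prod.snd_swap, if_neg h, if_neg (Ne.symm h)]

theorem blockKernel_le (h0 : ∀ x, 0 ≤ ϱ x) (h1 : ∀ x, ϱ x ≤ 1) (p : ℝ × ℝ) :
    blockKernel κ ϱ ε p ≤ (cellMass κ ϱ ε p.1)⁻¹ := by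
  unfold blockKernel
  split_ifs
  · rw [div_eq_mul_inv]
    exact mul_le_of_le_one_left (inv_nonneg.2 (cellMass_nonneg h0 _))
      (mul_le_one₀ (h1 _) (h0 _) (h1 _))
  · exact inv_nonneg.2 (cellMass_nonneg h0 _)

theorem abs_sub_mul_blockKernel_le (h0 : ∀ x, 0 ≤ ϱ x) (hε : 0 < ε) (p : ℝ × ℝ) :
    |p.1 - p.2| * blockKernel κ ϱ ε p ≤ ε * blockKernel κ ϱ ε p := by
  by_cases h : ⌊p.1 / ε⌋ = ⌊p.2 / ε⌋
  · refine mul_le_mul_of_nonneg_right ?_ (blockKernel_nonneg h0 p)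
    have := Int.abs_sub_lt_one_of_floor_eq_floor h
    rw [← sub_div, abs_div, abs_of_pos hε, div_lt_one hε] at this
    exact this.le
  · simp [blockKernel, h]

theorem integrable_blockKernel [IsFiniteMeasure κ] (hϱ : Measurable ϱ) (h0 : ∀ x, 0 ≤ ϱ x)
    (h1 : ∀ x, ϱ x ≤ 1) (x : ℝ) : Integrable (fun y => blockKernel κ ϱ ε (x, y)) κ := by
  refine Integrable.of_bound
    ((measurable_blockKernel hϱ).comp measurable_prodMk_left).aestronglyMeasurable
    (cellMass κ ϱ ε x)⁻¹ (ae_of_all _ fun y => ?_)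
  rw [Real.norm_of_nonneg (blockKernel_nonneg h0 _)]
  exact blockKernel_le h0 h1 (x, y)

/-- On a cell of positive mass this is the normalization. On a cell of zero mass ϱ vanishes almost
everywhere, which agrees with the convention for division by 0. -/
theorem ae_integral_blockKernel [IsFiniteMeasure κ] (hϱ : Measurable ϱ) (h0 : ∀ x, 0 ≤ ϱ x)
    (h1 : ∀ x, ϱ x ≤ 1) : ∀ᵐ x ∂κ, ∫ y, blockKernel κ ϱ ε (x, y) ∂κ = ϱ x := by
  have hi : Integrable ϱ κ := Integrable.of_bound hϱ.aestronglyMeasurable 1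
    (ae_of_all _ fun x => by rw [Real.norm_of_nonneg (h0 x)]; exact h1 x)
  have hz : ∀ᵐ x ∂κ, cellMass κ ϱ ε x = 0 → ϱ x = 0 := by
    have : ∀ k : ℤ, ∀ᵐ x ∂κ, ∫ z in {z | ⌊z / ε⌋ = k}, ϱ z ∂κ = 0 → ⌊x / ε⌋ = k → ϱ x = 0 := by
      intro k
      by_cases hk : ∫ z in {z | ⌊z / ε⌋ = k}, ϱ z ∂κ = 0
      · rw [integral_eq_zero_iff_of_nonneg h0 hi.integrableOn] at hk
        filter_upwards [(ae_restrict_iff' (measurableSet_cell ε k)).1 hk] with x hx _ hxk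
        exact hx hxk
      · exact ae_of_all _ fun x h => absurd h hk
    filter_upwards [ae_all_iff.2 this] with x hx h
    exact hx _ h rfl
  filter_upwards [hz] with x hx
  have h2 : ∀ y, blockKernel κ ϱ ε (x, y)
      = {z | ⌊z / ε⌋ = ⌊x / ε⌋}.indicator (fun y => ϱ x / cellMass κ ϱ ε x * ϱ y) y := by
    intro y
    by_cases h : ⌊y / ε⌋ = ⌊x / ε⌋
    · rw [indicator_of_mem (by exact h), blockKernel, if_pos h.symm]; ring
    · rw [indicator_of_notMem (by exact h), blockKernel, if_neg (Ne.symm h)]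
  simp_rw [h2]
  rw [integral_indicator (measurableSet_cell ε _), integral_const_mul]
  change ϱ x / cellMass κ ϱ ε x * cellMass κ ϱ ε x = ϱ x
  by_cases hM : cellMass κ ϱ ε x = 0
  · rw [hx hM]; simp
  · exact div_mul_cancel₀ _ hM

theorem cell_eq_Ico (hε : 0 < ε) (x : ℝ) :
    {z : ℝ | ⌊z / ε⌋ = ⌊x / ε⌋} = Ico (⌊x / ε⌋ * ε) (⌊x / ε⌋ * ε + ε) := by
  ext z
  rw [mem_ofPred_eq, Int.floor_eq_iff, le_div_iff₀ hε, div_lt_iff₀ hε, add_mul, one_mul]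
  rfl

/-- The number of cells of the grid that meet `[-R, R]` is at most `(2 R + 2 ε) / ε`. -/
theorem lintegral_div_cellMass_le [IsFiniteMeasure κ] (hϱ : Measurable ϱ) (h0 : ∀ x, 0 ≤ ϱ x)
    (h1 : ∀ x, ϱ x ≤ 1) (hε : 0 < ε) (hκ : κ (Icc (-R) R)ᶜ = 0) :
    ∫⁻ x, ENNReal.ofReal (ϱ x / cellMass κ ϱ ε x) ∂κ ≤ ENNReal.ofReal ((2 * R + 2 * ε) / ε) := by
  have hi : Integrable ϱ κ := Integrable.of_bound hϱ.aestronglyMeasurable 1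
    (ae_of_all _ fun x => by rw [Real.norm_of_nonneg (h0 x)]; exact h1 x)
  -- The factor ε⁻¹ spreads each value evenly over its cell of length ε. After Fubini, ϱ divided by
  -- the cell mass is integrated over one cell, which gives at most 1. The margin ε around [-R, R]
  -- contains every cell that meets it.
  set G : ℝ × ℝ → ENNReal := fun p => {p : ℝ × ℝ | ⌊p.1 / ε⌋ = ⌊p.2 / ε⌋}.indicator
    (fun p => ENNReal.ofReal ε⁻¹ * ENNReal.ofReal (ϱ p.1 / cellMass κ ϱ ε p.1)) p with hG
  have hGm : Measurable G := by
    refine Measurable.indicator ?_ (measurableSet_eq_fun ((measurable_cell ε).comp measurable_fst)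
      ((measurable_cell ε).comp measurable_snd))
    exact (((hϱ.comp measurable_fst).div
      ((measurable_cellMass κ ϱ ε).comp measurable_fst)).ennreal_ofReal).const_mul _
  have hx : ∀ᵐ x ∂κ, ENNReal.ofReal (ϱ x / cellMass κ ϱ ε x)
      = ∫⁻ z in Icc (-R - ε) (R + ε), G (x, z) := by
    have hxm : ∀ᵐ x ∂κ, x ∈ Icc (-R) R := hκ
    filter_upwards [hxm] with x hxR
    have h2 : ∀ z, G (x, z) = {z : ℝ | ⌊z / ε⌋ = ⌊x / ε⌋}.indicator
        (fun _ => ENNReal.ofReal ε⁻¹ * ENNReal.ofReal (ϱ x / cellMass κ ϱ ε x)) z := by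
      intro z
      by_cases h : ⌊z / ε⌋ = ⌊x / ε⌋
      · rw [indicator_of_mem (by exact h), hG]
        exact indicator_of_mem (by exact h.symm) _
      · rw [indicator_of_notMem (by exact h), hG]
        exact indicator_of_notMem (by exact Ne.symm h) _
    simp_rw [h2]
    have hsub : {z : ℝ | ⌊z / ε⌋ = ⌊x / ε⌋} ∩ Icc (-R - ε) (R + ε)
        = {z : ℝ | ⌊z / ε⌋ = ⌊x / ε⌋} := by
      refine inter_eq_left.2 fun z hz => ?_
      have := Int.abs_sub_lt_one_of_floor_eq_floor (show ⌊z / ε⌋ = ⌊x / ε⌋ from hz)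
      rw [← sub_div, abs_div, abs_of_pos hε, div_lt_one hε, abs_lt] at this
      constructor <;> linarith [hxR.1, hxR.2]
    rw [lintegral_indicator (measurableSet_cell ε _), setLIntegral_const,
      Measure.restrict_apply (measurableSet_cell ε _), hsub, cell_eq_Ico hε, Real.volume_Ico,
      add_sub_cancel_left, mul_right_comm, ← ENNReal.ofReal_mul (by positivity),
      inv_mul_cancel₀ hε.ne', ENNReal.ofReal_one, one_mul]
  have hz : ∀ z, ∫⁻ x, G (x, z) ∂κ ≤ ENNReal.ofReal ε⁻¹ := by
    intro z
    have h2 : ∀ x, G (x, z) = {x : ℝ | ⌊x / ε⌋ = ⌊z / ε⌋}.indicator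
        (fun x => ENNReal.ofReal (ε⁻¹ * (cellMass κ ϱ ε z)⁻¹ * ϱ x)) x := by
      intro x
      by_cases h : ⌊x / ε⌋ = ⌊z / ε⌋
      · rw [indicator_of_mem (by exact h), hG]
        simp only
        rw [indicator_of_mem (by exact h), ← ENNReal.ofReal_mul (by positivity)]
        congr 1
        simp only [cellMass, h]
        ring
      · rw [indicator_of_notMem (by exact h), hG]
        exact indicator_of_notMem (by exact h) _
    simp_rw [h2]
    have hM := cellMass_nonneg (κ := κ) (ε := ε) h0 z
    rw [lintegral_indicator (measurableSet_cell ε _),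
      ← ofReal_integral_eq_lintegral_ofReal (hi.integrableOn.const_mul _)
        (ae_of_all _ fun x => mul_nonneg (mul_nonneg (by positivity) (by positivity)) (h0 x)),
      integral_const_mul]
    refine ENNReal.ofReal_le_ofReal ?_
    change ε⁻¹ * (cellMass κ ϱ ε z)⁻¹ * cellMass κ ϱ ε z ≤ ε⁻¹
    rw [mul_assoc]
    exact mul_le_of_le_one_right (by positivity) (inv_mul_le_one)
  calc _ = ∫⁻ x, (∫⁻ z in Icc (-R - ε) (R + ε), G (x, z)) ∂κ := lintegral_congr_ae hx
    _ = ∫⁻ z in Icc (-R - ε) (R + ε), (∫⁻ x, G (x, z) ∂κ) :=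
        lintegral_lintegral_swap (f := fun x z => G (x, z)) hGm.aemeasurable
    _ ≤ ∫⁻ _ in Icc (-R - ε) (R + ε), ENNReal.ofReal ε⁻¹ := lintegral_mono hz
    _ = ENNReal.ofReal ((2 * R + 2 * ε) / ε) := by
        rw [setLIntegral_const, Real.volume_Icc, ← ENNReal.ofReal_mul (by positivity)]
        congr 1
        field_simp
        ring

end BlockKernel

/-! ### The symmetrized exponential kernel -/

section ExpKernel

variable {μ : Measure ℝ} {A : Set ℝ}

/-- The symmetric exponential kernel of size `ε`, with marginals at most one. -/
def expKernel (μ : Measure ℝ) (ε : ℝ) (p : ℝ × ℝ) : ℝ :=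
  (2 * ε)⁻¹ * Real.exp (-(|p.1 - p.2| / ε)) * min (lebDensity μ p.1)⁻¹ (lebDensity μ p.2)⁻¹

/-- The first marginal of the exponential kernel on `A`, relative to `μ`. -/
def expKernelMarginal (μ : Measure ℝ) (A : Set ℝ) (ε x : ℝ) : ℝ :=
  ∫ y in A, expKernel μ ε (x, y) ∂μ

theorem measurable_expKernel (μ : Measure ℝ) (ε : ℝ) : Measurable (expKernel μ ε) := by
  unfold expKernel; fun_prop

theorem expKernel_nonneg {ε : ℝ} (hε : 0 < ε) (p : ℝ × ℝ) : 0 ≤ expKernel μ ε p :=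
  mul_nonneg (by positivity)
    (le_min (inv_nonneg.2 (lebDensity_nonneg _ _)) (inv_nonneg.2 (lebDensity_nonneg _ _)))

theorem expKernel_swap (ε : ℝ) (p : ℝ × ℝ) : expKernel μ ε p.swap = expKernel μ ε p := by
  simp only [expKernel, Prod.fst_swap, Prod.snd_swap]
  rw [abs_sub_comm, min_comm]

theorem measurable_expKernelMarginal [IsFiniteMeasure μ] (ε : ℝ) :
    Measurable (expKernelMarginal μ A ε) :=
  (measurable_expKernel μ ε).stronglyMeasurable.integral_prod_right'.measurable

theorem expKernelMarginal_nonneg {ε : ℝ} (hε : 0 < ε) (x : ℝ) :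
    0 ≤ expKernelMarginal μ A ε x := integral_nonneg fun _ => expKernel_nonneg hε _

/-- With f the density of μ, the minimum keeps the kernel symmetric while f(y) min(1/f(x), 1/f(y)) ≤
1, including where f(y) = 0; what is left is the Lebesgue integral of the exponential. -/
theorem lintegral_expKernel_le [IsFiniteMeasure μ] (hμ : μ ≪ volume) (hA : MeasurableSet A)
    {ε : ℝ} (hε : 0 < ε) (x : ℝ) :
    ∫⁻ y in A, ENNReal.ofReal (expKernel μ ε (x, y)) ∂μ ≤ 1 := by
  have hm : Measurable fun y => ENNReal.ofReal (expKernel μ ε (x, y)) :=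
    ((measurable_expKernel μ ε).comp measurable_prodMk_left).ennreal_ofReal
  rw [setLIntegral_eq_lebDensity_mul hμ hA hm]
  calc _ ≤ ∫⁻ y in A, ENNReal.ofReal (2 * ε)⁻¹ * ENNReal.ofReal (Real.exp (-(|x - y| / ε))) := by
        refine lintegral_mono fun y => ?_
        rw [← ENNReal.ofReal_mul (lebDensity_nonneg _ _), ← ENNReal.ofReal_mul (by positivity)]
        refine ENNReal.ofReal_le_ofReal ?_
        have h1 := lebDensity_nonneg μ y
        have h2 : lebDensity μ y * min (lebDensity μ x)⁻¹ (lebDensity μ y)⁻¹ ≤ 1 :=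
          (mul_le_mul_of_nonneg_left (min_le_right _ _) h1).trans mul_inv_le_one
        have h3 : 0 ≤ (2 * ε)⁻¹ * Real.exp (-(|x - y| / ε)) := by positivity
        calc _ = (2 * ε)⁻¹ * Real.exp (-(|x - y| / ε))
              * (lebDensity μ y * min (lebDensity μ x)⁻¹ (lebDensity μ y)⁻¹) := by
              simp only [expKernel]; ring
          _ ≤ _ := mul_le_of_le_one_right h3 h2
    _ = ENNReal.ofReal (2 * ε)⁻¹ * ∫⁻ y in A, ENNReal.ofReal (Real.exp (-(|x - y| / ε))) :=
        lintegral_const_mul _ (by fun_prop)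
    _ ≤ ENNReal.ofReal (2 * ε)⁻¹ * ENNReal.ofReal (2 * ε) := by
        gcongr
        refine lintegral_exp_neg_div_le hA x hε (c := fun y => |x - y|) (by fun_prop)
          (fun y => abs_nonneg _) fun y => (measure_mono inter_subset_right).trans ?_
        rw [uIcc, Real.volume_Icc, max_sub_min_eq_abs, abs_sub_comm]
    _ = 1 := by
        rw [← ENNReal.ofReal_mul (by positivity), inv_mul_cancel₀ (by positivity),
          ENNReal.ofReal_one]

theorem integrable_expKernel [IsFiniteMeasure μ] (hμ : μ ≪ volume) (hA : MeasurableSet A)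
    {ε : ℝ} (hε : 0 < ε) (x : ℝ) :
    Integrable (fun y => expKernel μ ε (x, y)) (μ.restrict A) := by
  refine ⟨((measurable_expKernel μ ε).comp measurable_prodMk_left).aestronglyMeasurable, ?_⟩
  rw [hasFiniteIntegral_iff_ofReal (ae_of_all _ fun y => expKernel_nonneg hε _)]
  exact (lintegral_expKernel_le hμ hA hε x).trans_lt ENNReal.one_lt_top

theorem expKernelMarginal_le_one [IsFiniteMeasure μ] (hμ : μ ≪ volume) (hA : MeasurableSet A)
    {ε : ℝ} (hε : 0 < ε) (x : ℝ) : expKernelMarginal μ A ε x ≤ 1 := by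
  rw [expKernelMarginal, integral_eq_lintegral_of_nonneg_ae
    (ae_of_all _ fun y => expKernel_nonneg hε _) (integrable_expKernel hμ hA hε x).1]
  exact ENNReal.toReal_le_of_le_ofReal zero_le_one
    (by simpa using lintegral_expKernel_le hμ hA hε x)

theorem integrable_lebDensity (μ : Measure ℝ) [IsFiniteMeasure μ] :
    Integrable (lebDensity μ) volume := Measure.integrable_toReal_rnDeriv

/-- The truncation of an integrable function at its value at a Lebesgue point has the expected
averages. -/
theorem ae_tendsto_average_min {g : ℝ → ℝ} (hg : Integrable g volume) :
    ∀ᵐ x, Tendsto (fun r => (∫ y in Metric.closedBall x r, min (g x) (g y)) / (2 * r))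
      (𝓝[>] 0) (𝓝 (g x)) := by
  filter_upwards [IsUnifLocDoublingMeasure.ae_tendsto_average_norm_sub volume
    hg.locallyIntegrable 1] with x hx
  have h := hx (l := 𝓝[>] (0 : ℝ)) (fun _ => x) id tendsto_id (by
    filter_upwards [self_mem_nhdsWithin] with r hr
    simpa using (mem_Ioi.1 hr).le)
  have h2 : Tendsto (fun r => g x - ⨍ y in Metric.closedBall x (id r), ‖g y - g x‖) (𝓝[>] 0)
      (𝓝 (g x - 0)) := h.const_sub _
  rw [sub_zero] at h2
  have key : ∀ r : ℝ, 0 < r →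
      IntegrableOn (fun y => min (g x) (g y)) (Metric.closedBall x r) ∧
      volume.real (Metric.closedBall x r) = 2 * r ∧
      IntegrableOn (fun y => ‖g y - g x‖) (Metric.closedBall x r) := by
    intro r hr
    have hc : IntegrableOn (fun _ => g x) (Metric.closedBall x r) volume :=
      integrableOn_const (isCompact_closedBall x r).measure_lt_top.ne
    refine ⟨hc.inf hg.integrableOn, ?_, (hg.integrableOn.sub hc).norm⟩
    rw [measureReal_def, Real.volume_closedBall, ENNReal.toReal_ofReal (by positivity)]
  -- Squeeze: g(x) - |g(y) - g(x)| ≤ min(g(x), g(y)) ≤ g(x), and the oscillation averages to 0 at a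
  -- Lebesgue point.
  refine tendsto_of_tendsto_of_tendsto_of_le_of_le' h2 tendsto_const_nhds ?_ ?_
  · filter_upwards [self_mem_nhdsWithin] with r hr
    have hr' : 0 < r := hr
    obtain ⟨i1, hv, i2⟩ := key r hr
    have hc : IntegrableOn (fun _ => g x) (Metric.closedBall x r) volume :=
      integrableOn_const (isCompact_closedBall x r).measure_lt_top.ne
    have h3 : ∫ y in Metric.closedBall x r, (g x - ‖g y - g x‖)
        ≤ ∫ y in Metric.closedBall x r, min (g x) (g y) := by
      refine integral_mono (hc.sub i2) i1 fun y => ?_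
      refine le_min ?_ ?_
      · simp
      · have := neg_abs_le (g y - g x)
        simp only [Real.norm_eq_abs]; linarith
    rw [integral_sub hc i2, setIntegral_const, hv, smul_eq_mul] at h3
    rw [id, setAverage_eq, hv, smul_eq_mul, le_div_iff₀ (by positivity), sub_mul,
      mul_comm (2 * r)⁻¹, inv_mul_cancel_right₀ (by positivity)]
    linarith
  · filter_upwards [self_mem_nhdsWithin] with r hr
    have hr' : 0 < r := hr
    obtain ⟨i1, hv, i2⟩ := key r hr
    have hc : IntegrableOn (fun _ => g x) (Metric.closedBall x r) volume :=
      integrableOn_const (isCompact_closedBall x r).measure_lt_top.ne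
    have h3 : ∫ y in Metric.closedBall x r, min (g x) (g y)
        ≤ ∫ y in Metric.closedBall x r, g x := integral_mono i1 hc fun y => min_le_left _ _
    rw [setIntegral_const, hv, smul_eq_mul] at h3
    rw [div_le_iff₀ (by positivity)]
    linarith

/-- With g the density cut off outside `A` and x in `A`, one has g(y) min(1/g(x), 1/g(y)) =
min(g(x), g(y))/g(x) for y in `A`. The marginal is thus an exponential average of min(g(x), g),
divided by its limit g(x). -/
theorem ae_tendsto_expKernelMarginal [IsFiniteMeasure μ] (hμ : μ ≪ volume)
    (hA : MeasurableSet A) :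
    ∀ᵐ x ∂μ.restrict A, Tendsto (fun ε => expKernelMarginal μ A ε x) (𝓝[>] 0) (𝓝 1) := by
  set g := A.indicator (lebDensity μ) with hg
  have hgi : Integrable g volume := (integrable_lebDensity μ).indicator hA
  have hgm : Measurable g := (measurable_lebDensity μ).indicator hA
  have hg0 : ∀ y, 0 ≤ g y := fun y => indicator_nonneg (fun y _ => lebDensity_nonneg μ y) y
  have hmem : ∀ᵐ x ∂μ.restrict A, x ∈ A := ae_restrict_mem hA
  filter_upwards [hmem, ae_restrict_of_ae (ae_lebDensity_pos hμ),
    ae_restrict_of_ae (hμ.ae_le (ae_tendsto_average_min hgi))] with x hxA hpos hav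
  have hgx : g x = lebDensity μ x := indicator_of_mem hxA _
  rw [← hgx] at hpos
  set h : ℝ → ℝ := fun y => min (g x) (g y) with hh
  have hhm : Measurable h := measurable_const.min hgm
  have hh0 : ∀ y, 0 ≤ h y := fun y => le_min (hg0 x) (hg0 y)
  have hhi : Integrable h volume := by
    refine hgi.mono' hhm.aestronglyMeasurable (ae_of_all _ fun y => ?_)
    rw [Real.norm_of_nonneg (hh0 y)]
    exact min_le_right _ _
  set κ : Measure ℝ := volume.withDensity fun y => ENNReal.ofReal (h y) with hκ
  have : IsFiniteMeasure κ := isFiniteMeasure_withDensity_ofReal hhi.2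
  have hκr : ∀ r, κ.real (Metric.closedBall x r) = ∫ y in Metric.closedBall x r, h y := by
    intro r
    rw [measureReal_def, hκ, withDensity_apply _ Metric.isClosed_closedBall.measurableSet,
      integral_eq_lintegral_of_nonneg_ae (ae_of_all _ hh0) hhm.aestronglyMeasurable]
  have hlim := tendsto_integral_exp_kernel κ x (g x) (by simp_rw [hκr]; exact hav)
  have h1 := hlim.const_mul (g x)⁻¹
  rw [inv_mul_cancel₀ hpos.ne'] at h1
  refine h1.congr' ?_
  filter_upwards [self_mem_nhdsWithin] with ε hε
  have hε' : 0 < ε := hε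
  have hkm : Measurable fun y => ENNReal.ofReal (expKernel μ ε (x, y)) :=
    ((measurable_expKernel μ ε).comp measurable_prodMk_left).ennreal_ofReal
  rw [expKernelMarginal, integral_eq_lintegral_of_nonneg_ae
    (ae_of_all _ fun y => expKernel_nonneg hε _) (integrable_expKernel hμ hA hε' x).1,
    setLIntegral_eq_lebDensity_mul hμ hA hkm,
    ← lintegral_indicator hA, ← mul_assoc, ← integral_const_mul,
    integral_eq_lintegral_of_nonneg_ae (ae_of_all _ fun y => by
      simp only [Pi.zero_apply]
      exact mul_nonneg (mul_nonneg (inv_nonneg.2 hpos.le) (by positivity)) (Real.exp_nonneg _))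
      (Measurable.aestronglyMeasurable (by fun_prop)), hκ,
    lintegral_withDensity_eq_lintegral_mul _ hhm.ennreal_ofReal (by fun_prop)]
  congr 1
  refine lintegral_congr fun y => ?_
  rw [Pi.mul_apply, ← ENNReal.ofReal_mul (hh0 y)]
  by_cases hy : y ∈ A
  · rw [indicator_of_mem hy, ← ENNReal.ofReal_mul (lebDensity_nonneg _ _)]
    congr 1
    have hgy : g y = lebDensity μ y := indicator_of_mem hy _
    simp only [hh, expKernel, ← hgx, ← hgy]
    have : min (g x) (g y) * (g x)⁻¹ = g y * min (g x)⁻¹ (g y)⁻¹ := by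
      rcases (hg0 y).eq_or_lt with h0 | h0
      · rw [← h0, min_eq_right hpos.le]; simp
      · rcases le_total (g x) (g y) with hle | hle
        · rw [min_eq_left hle, min_eq_right ((inv_le_inv₀ h0 hpos).2 hle),
            mul_inv_cancel₀ hpos.ne', mul_inv_cancel₀ h0.ne']
        · rw [min_eq_right hle, min_eq_left ((inv_le_inv₀ hpos h0).2 hle)]
    calc _ = (2 * ε)⁻¹ * Real.exp (-(|x - y| / ε)) * (min (g x) (g y) * (g x)⁻¹) := by ring
      _ = _ := by rw [this]; ring
  · rw [indicator_of_notMem hy]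
    have hgy : g y = 0 := indicator_of_notMem hy _
    simp [hh, hgy, min_eq_right hpos.le]

end ExpKernel
end

noncomputable section

/-! ### Integration against kernels, and a convexity inequality -/

section Kernels

theorem integral_kernel_mul {κ : Measure ℝ} [IsFiniteMeasure κ] {k : ℝ × ℝ → ℝ}
    (hk : Measurable k) (hk0 : ∀ p, 0 ≤ k p) (hki : ∀ x, Integrable (fun y => k (x, y)) κ)
    {a h : ℝ → ℝ} (ha : ∀ᵐ x ∂κ, ∫ y, k (x, y) ∂κ = a x) (hh : Measurable h)
    (hah : Integrable (fun x => a x * h x) κ) :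
    Integrable (fun p => k p * h p.1) (κ.prod κ) ∧
      ∫ p, k p * h p.1 ∂(κ.prod κ) = ∫ x, a x * h x ∂κ := by
  have hm : AEStronglyMeasurable (fun p => k p * h p.1) (κ.prod κ) :=
    (hk.mul (hh.comp measurable_fst)).aestronglyMeasurable
  have hi : Integrable (fun p => k p * h p.1) (κ.prod κ) := by
    rw [integrable_prod_iff hm]
    refine ⟨ae_of_all _ fun x => (hki x).mul_const (h x), hah.norm.congr ?_⟩
    filter_upwards [ha] with x hx
    have h1 : ∀ y, ‖k (x, y) * h x‖ = k (x, y) * ‖h x‖ := fun y => by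
      rw [norm_mul, Real.norm_of_nonneg (hk0 _)]
    have h2 : 0 ≤ a x := by rw [← hx]; exact integral_nonneg fun y => hk0 _
    simp_rw [h1]
    rw [integral_mul_const, hx, norm_mul, Real.norm_of_nonneg h2]
  refine ⟨hi, ?_⟩
  rw [integral_prod _ hi]
  refine integral_congr_ae ?_
  filter_upwards [ha] with x hx
  rw [integral_mul_const, hx]

theorem map_fst_withDensity_prod {κ : Measure ℝ} [IsFiniteMeasure κ] {k : ℝ × ℝ → ENNReal}
    (hk : Measurable k) (h : ∀ᵐ x ∂κ, ∫⁻ y, k (x, y) ∂κ = 1) :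
    ((κ.prod κ).withDensity k).map Prod.fst = κ := by
  ext B hB
  rw [Measure.map_apply measurable_fst hB, withDensity_apply _ (measurable_fst hB), ← prod_univ,
    ← Measure.prod_restrict, lintegral_prod _ hk.aemeasurable, Measure.restrict_univ,
    lintegral_congr_ae (ae_restrict_of_ae h)]
  simp

theorem map_snd_withDensity_prod {κ : Measure ℝ} [IsFiniteMeasure κ] {k : ℝ × ℝ → ENNReal}
    (hk : Measurable k) (hs : ∀ p, k p.swap = k p) (h : ∀ᵐ x ∂κ, ∫⁻ y, k (x, y) ∂κ = 1) :
    ((κ.prod κ).withDensity k).map Prod.snd = κ := by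
  ext B hB
  rw [Measure.map_apply measurable_snd hB, withDensity_apply _ (measurable_snd hB), ← univ_prod,
    ← Measure.prod_restrict, lintegral_prod_symm _ hk.aemeasurable, Measure.restrict_univ]
  have h' : ∀ᵐ y ∂κ, ∫⁻ x, k (x, y) ∂κ = 1 := by
    filter_upwards [h] with y hy
    rw [← hy]
    exact lintegral_congr fun x => hs (y, x)
  rw [lintegral_congr_ae (ae_restrict_of_ae h')]
  simp

/-- Convexity of `s log s` along a decomposition of the density into two parts. -/
theorem add_mul_log_add_le {a b t : ℝ} (ha : 0 ≤ a) (hb : 0 ≤ b) (ht0 : 0 < t) (ht1 : t < 1) :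
    (a + b) * Real.log (a + b)
      ≤ a * (Real.log a - Real.log (1 - t)) + b * (Real.log b - Real.log t) := by
  have h1 : 0 < 1 - t := by linarith
  have hc := Real.convexOn_mul_log.2 (x := a / (1 - t)) (y := b / t) (div_nonneg ha h1.le)
    (div_nonneg hb ht0.le) h1.le ht0.le (by ring)
  simp only [smul_eq_mul] at hc
  rw [mul_div_cancel₀ _ h1.ne', mul_div_cancel₀ _ ht0.ne', ← mul_assoc, ← mul_assoc,
    mul_div_cancel₀ _ h1.ne', mul_div_cancel₀ _ ht0.ne'] at hc
  refine hc.trans (add_le_add ?_ ?_)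
  · rcases ha.eq_or_lt with rfl | h
    · simp
    · rw [Real.log_div h.ne' h1.ne']
  · rcases hb.eq_or_lt with rfl | h
    · simp
    · rw [Real.log_div h.ne' ht0.ne']

end Kernels

/-! ### Energy of the recovery kernel -/

section RecoveryKernel

variable {μ : Measure ℝ} {A : Set ℝ} {ε R : ℝ}

/-- The part of the mass that is not transported by the exponential kernel. -/
def expKernelDefect (μ : Measure ℝ) (A : Set ℝ) (ε x : ℝ) : ℝ := 1 - expKernelMarginal μ A ε x

/-- The density, relative to the square of `μ` restricted to `A`, of a plan near the diagonal:
the exponential kernel completed by a block diagonal plan. -/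
def recoveryKernel (μ : Measure ℝ) (A : Set ℝ) (ε : ℝ) (p : ℝ × ℝ) : ℝ :=
  expKernel μ ε p + blockKernel (μ.restrict A) (expKernelDefect μ A ε) ε p

theorem measurable_expKernelDefect [IsFiniteMeasure μ] : Measurable (expKernelDefect μ A ε) :=
  (measurable_expKernelMarginal ε).const_sub 1

theorem expKernelDefect_nonneg [IsFiniteMeasure μ] (hμ : μ ≪ volume) (hA : MeasurableSet A)
    (hε : 0 < ε) (x : ℝ) : 0 ≤ expKernelDefect μ A ε x :=
  sub_nonneg.2 (expKernelMarginal_le_one hμ hA hε x)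

theorem expKernelDefect_le_one (hε : 0 < ε) (x : ℝ) : expKernelDefect μ A ε x ≤ 1 :=
  sub_le_self _ (expKernelMarginal_nonneg hε x)

theorem measurable_recoveryKernel [IsFiniteMeasure μ] : Measurable (recoveryKernel μ A ε) :=
  (measurable_expKernel μ ε).add (measurable_blockKernel measurable_expKernelDefect)

theorem recoveryKernel_nonneg [IsFiniteMeasure μ] (hμ : μ ≪ volume) (hA : MeasurableSet A)
    (hε : 0 < ε) (p : ℝ × ℝ) : 0 ≤ recoveryKernel μ A ε p :=
  add_nonneg (expKernel_nonneg hε p) (blockKernel_nonneg (expKernelDefect_nonneg hμ hA hε) p)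

theorem recoveryKernel_swap (p : ℝ × ℝ) : recoveryKernel μ A ε p.swap = recoveryKernel μ A ε p := by
  rw [recoveryKernel, recoveryKernel, expKernel_swap, blockKernel_swap]

theorem integrable_recoveryKernel [IsFiniteMeasure μ] (hμ : μ ≪ volume) (hA : MeasurableSet A)
    (hε : 0 < ε) (x : ℝ) : Integrable (fun y => recoveryKernel μ A ε (x, y)) (μ.restrict A) :=
  (integrable_expKernel hμ hA hε x).add (integrable_blockKernel measurable_expKernelDefect
    (expKernelDefect_nonneg hμ hA hε) (expKernelDefect_le_one hε) x)

theorem ae_integral_recoveryKernel [IsFiniteMeasure μ] (hμ : μ ≪ volume) (hA : MeasurableSet A)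
    (hε : 0 < ε) : ∀ᵐ x ∂μ.restrict A, ∫ y in A, recoveryKernel μ A ε (x, y) ∂μ = 1 := by
  filter_upwards [ae_integral_blockKernel (κ := μ.restrict A) (ε := ε)
    (measurable_expKernelDefect (μ := μ) (A := A) (ε := ε))
    (expKernelDefect_nonneg hμ hA hε) (expKernelDefect_le_one hε)] with x hx
  simp only [recoveryKernel]
  rw [integral_add (integrable_expKernel hμ hA hε x)
    (integrable_blockKernel measurable_expKernelDefect
      (expKernelDefect_nonneg hμ hA hε) (expKernelDefect_le_one hε) x), hx, expKernelDefect,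
    expKernelMarginal]
  ring

theorem ae_lintegral_recoveryKernel [IsFiniteMeasure μ] (hμ : μ ≪ volume) (hA : MeasurableSet A)
    (hε : 0 < ε) :
    ∀ᵐ x ∂μ.restrict A, ∫⁻ y in A, ENNReal.ofReal (recoveryKernel μ A ε (x, y)) ∂μ = 1 := by
  filter_upwards [ae_integral_recoveryKernel hμ hA hε] with x hx
  rw [← ofReal_integral_eq_lintegral_ofReal (integrable_recoveryKernel hμ hA hε x)
    (ae_of_all _ fun y => recoveryKernel_nonneg hμ hA hε _), hx, ENNReal.ofReal_one]

theorem integrable_recoveryKernel_prod [IsFiniteMeasure μ] (hμ : μ ≪ volume)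
    (hA : MeasurableSet A) (hε : 0 < ε) :
    Integrable (recoveryKernel μ A ε) ((μ.restrict A).prod (μ.restrict A)) := by
  have := (integral_kernel_mul (κ := μ.restrict A) measurable_recoveryKernel
    (recoveryKernel_nonneg hμ hA hε) (integrable_recoveryKernel hμ hA hε) (a := fun _ => 1)
    (h := fun _ => 1) (ae_integral_recoveryKernel hμ hA hε) measurable_const
    (integrable_const _)).1
  simpa using this

theorem ae_prod_mem_Icc [IsFiniteMeasure μ] (hR : μ (Icc (-R) R)ᶜ = 0) :
    ∀ᵐ p ∂((μ.restrict A).prod (μ.restrict A)), p.1 ∈ Icc (-R) R ∧ p.2 ∈ Icc (-R) R := by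
  have h : ∀ᵐ x ∂μ.restrict A, x ∈ Icc (-R) R := ae_restrict_of_ae hR
  exact (Measure.quasiMeasurePreserving_fst.ae h).and (Measure.quasiMeasurePreserving_snd.ae h)

theorem integrable_dist_mul_recoveryKernel [IsFiniteMeasure μ] (hμ : μ ≪ volume)
    (hA : MeasurableSet A) (hε : 0 < ε) (hR : μ (Icc (-R) R)ᶜ = 0) :
    Integrable (fun p => |p.1 - p.2| * recoveryKernel μ A ε p)
      ((μ.restrict A).prod (μ.restrict A)) := by
  refine ((integrable_recoveryKernel_prod hμ hA hε).const_mul (2 * R)).mono'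
    ((Continuous.measurable (by fun_prop)).mul measurable_recoveryKernel).aestronglyMeasurable ?_
  filter_upwards [ae_prod_mem_Icc hR] with p hp
  have h0 := recoveryKernel_nonneg hμ hA hε p
  rw [Real.norm_of_nonneg (mul_nonneg (abs_nonneg _) h0)]
  refine mul_le_mul_of_nonneg_right (abs_le.2 ?_) h0
  constructor <;> linarith [hp.1.1, hp.1.2, hp.2.1, hp.2.2]

/-- The entropy of the recovery kernel plus its transport cost. -/
def recoveryEnergy (μ : Measure ℝ) (A : Set ℝ) (ε : ℝ) : ℝ :=
  ∫ p, (recoveryKernel μ A ε p * Real.log (recoveryKernel μ A ε p)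
    + ε⁻¹ * (|p.1 - p.2| * recoveryKernel μ A ε p)) ∂((μ.restrict A).prod (μ.restrict A))

/-- Convexity with weights 1 - t and t separates the two parts. In the exponential part, the term
-|x-y|/ε of the logarithm cancels the transport cost. In the block part, with M the cell mass, log s
≤ s - 1 at s = εt/M bounds -log M, and the resulting -1 pays for the transport cost inside a cell.
-/
theorem recoveryKernel_energy_le [IsFiniteMeasure μ] (hμ : μ ≪ volume)
    (hA : MeasurableSet A) (hε : 0 < ε) {t : ℝ} (ht0 : 0 < t) (ht1 : t < 1) {p : ℝ × ℝ}
    (hp : 0 < lebDensity μ p.1) :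
    recoveryKernel μ A ε p * Real.log (recoveryKernel μ A ε p)
      + ε⁻¹ * (|p.1 - p.2| * recoveryKernel μ A ε p)
      ≤ expKernel μ ε p * (-Real.log (2 * ε) - Real.log (1 - t) - Real.log (lebDensity μ p.1))
        + blockKernel (μ.restrict A) (expKernelDefect μ A ε) ε p *
          (ε * t / cellMass (μ.restrict A) (expKernelDefect μ A ε) ε p.1
            - (Real.log ε + 2 * Real.log t)) := by
  set a := expKernel μ ε p with ha
  set b := blockKernel (μ.restrict A) (expKernelDefect μ A ε) ε p with hb
  set M := cellMass (μ.restrict A) (expKernelDefect μ A ε) ε p.1 with hM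
  have ha0 : 0 ≤ a := expKernel_nonneg hε p
  have hb0 : 0 ≤ b := blockKernel_nonneg (expKernelDefect_nonneg hμ hA hε) p
  have hk : recoveryKernel μ A ε p = a + b := rfl
  have h1 := add_mul_log_add_le ha0 hb0 ht0 ht1
  have h2 : a * Real.log a
      ≤ a * (-Real.log (2 * ε) - Real.log (lebDensity μ p.1) - ε⁻¹ * |p.1 - p.2|) := by
    rcases ha0.eq_or_lt with h | h
    · rw [← h]; simp
    refine mul_le_mul_of_nonneg_left ?_ ha0
    have hle : a ≤ (2 * ε)⁻¹ * Real.exp (-(|p.1 - p.2| / ε)) * (lebDensity μ p.1)⁻¹ :=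
      mul_le_mul_of_nonneg_left (min_le_left _ _) (by positivity)
    refine (Real.log_le_log h hle).trans (le_of_eq ?_)
    rw [Real.log_mul (by positivity) (by positivity), Real.log_mul (by positivity) (by positivity),
      Real.log_inv, Real.log_exp, Real.log_inv]
    ring
  have h3 : b * Real.log b ≤ b * (ε * t / M - 1 - Real.log ε - Real.log t) := by
    rcases hb0.eq_or_lt with h | h
    · rw [← h]; simp
    refine mul_le_mul_of_nonneg_left ?_ hb0
    have hle : b ≤ M⁻¹ :=
      blockKernel_le (expKernelDefect_nonneg hμ hA hε) (expKernelDefect_le_one hε) p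
    have hM0 : 0 < M := inv_pos.1 (h.trans_le hle)
    have h4 := Real.log_le_sub_one_of_pos (show 0 < ε * t / M by positivity)
    rw [Real.log_div (by positivity) hM0.ne', Real.log_mul hε.ne' ht0.ne'] at h4
    have h5 := Real.log_le_log h hle
    rw [Real.log_inv] at h5
    linarith
  have h4 : ε⁻¹ * (|p.1 - p.2| * b) ≤ b := by
    have := mul_le_mul_of_nonneg_left (abs_sub_mul_blockKernel_le (κ := μ.restrict A)
      (expKernelDefect_nonneg hμ hA hε) hε p) (inv_nonneg.2 hε.le)
    rwa [inv_mul_cancel_left₀ hε.ne'] at this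
  rw [hk]
  nlinarith

/-- Integrating the pointwise bound, the terms εt/M add up to at most εt times the number of cells,
which is the harmless t(2R + 2ε). Integrability comes from the same bound above and from -s log s ≤
1 below. -/
theorem integrable_recoveryEnergy_and_le [IsFiniteMeasure μ] (hμ : μ ≪ volume)
    (hA : MeasurableSet A) (hε : 0 < ε) (hR : μ (Icc (-R) R)ᶜ = 0) (hR0 : 0 < R)
    (hlog : Integrable (fun x => Real.log (lebDensity μ x)) μ)
    {t : ℝ} (ht0 : 0 < t) (ht1 : t < 1) :
    Integrable (fun p => recoveryKernel μ A ε p * Real.log (recoveryKernel μ A ε p)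
      + ε⁻¹ * (|p.1 - p.2| * recoveryKernel μ A ε p)) ((μ.restrict A).prod (μ.restrict A)) ∧
    recoveryEnergy μ A ε ≤ (-Real.log (2 * ε) - Real.log (1 - t))
        * (μ.real A - ∫ x in A, expKernelDefect μ A ε x ∂μ)
      - ∫ x in A, expKernelMarginal μ A ε x * Real.log (lebDensity μ x) ∂μ
      + t * (2 * R + 2 * ε)
      - (Real.log ε + 2 * Real.log t) * ∫ x in A, expKernelDefect μ A ε x ∂μ := by
  set κ := μ.restrict A with hκ
  set ϱ := expKernelDefect μ A ε with hϱ
  have hϱ0 : ∀ x, 0 ≤ ϱ x := expKernelDefect_nonneg hμ hA hε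
  have hϱ1 : ∀ x, ϱ x ≤ 1 := expKernelDefect_le_one hε
  have hϱm : Measurable ϱ := measurable_expKernelDefect
  have hm0 : ∀ x, 0 ≤ expKernelMarginal μ A ε x := expKernelMarginal_nonneg hε
  have hm1 : ∀ x, expKernelMarginal μ A ε x ≤ 1 := expKernelMarginal_le_one hμ hA hε
  have hmm : Measurable (expKernelMarginal μ A ε) := measurable_expKernelMarginal ε
  have hϱi : Integrable ϱ κ := Integrable.of_bound hϱm.aestronglyMeasurable 1
    (ae_of_all _ fun x => by rw [Real.norm_of_nonneg (hϱ0 x)]; exact hϱ1 x)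
  have hmi : Integrable (expKernelMarginal μ A ε) κ :=
    Integrable.of_bound hmm.aestronglyMeasurable 1
      (ae_of_all _ fun x => by rw [Real.norm_of_nonneg (hm0 x)]; exact hm1 x)
  have hml : Integrable (fun x => expKernelMarginal μ A ε x * Real.log (lebDensity μ x)) κ := by
    refine hlog.integrableOn.norm.mono' (hmm.mul (by fun_prop)).aestronglyMeasurable
      (ae_of_all _ fun x => ?_)
    rw [norm_mul, Real.norm_of_nonneg (hm0 x)]
    exact mul_le_of_le_one_left (norm_nonneg _) (hm1 x)
  have hmean : ∫ x, expKernelMarginal μ A ε x ∂κ = μ.real A - ∫ x, ϱ x ∂κ := by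
    have : ∫ x, ϱ x ∂κ = ∫ x, (1 - expKernelMarginal μ A ε x) ∂κ := rfl
    rw [this, integral_sub (integrable_const _) hmi, integral_const, hκ,
      measureReal_restrict_apply_univ]
    simp
  set c := -Real.log (2 * ε) - Real.log (1 - t) with hc
  have h1 := integral_kernel_mul (κ := κ) (measurable_expKernel μ ε) (expKernel_nonneg hε)
    (integrable_expKernel hμ hA hε) (a := expKernelMarginal μ A ε)
    (h := fun x => c - Real.log (lebDensity μ x)) (ae_of_all _ fun x => rfl) (by fun_prop)
    (by simp_rw [mul_sub]; exact (hmi.mul_const c).sub hml)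
  have h1v : ∫ x, expKernelMarginal μ A ε x * (c - Real.log (lebDensity μ x)) ∂κ
      = c * (μ.real A - ∫ x, ϱ x ∂κ)
        - ∫ x, expKernelMarginal μ A ε x * Real.log (lebDensity μ x) ∂κ := by
    simp_rw [mul_sub]
    rw [integral_sub (hmi.mul_const c) hml, integral_mul_const, hmean]
    ring
  set M := cellMass κ ϱ ε with hM
  have hMm : Measurable M := measurable_cellMass κ ϱ ε
  have hdl := lintegral_div_cellMass_le hϱm hϱ0 hϱ1 hε (R := R) (κ := κ)
    (Measure.absolutelyContinuous_of_le Measure.restrict_le_self hR)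
  have hd0 : ∀ x, 0 ≤ ϱ x / M x := fun x => div_nonneg (hϱ0 x) (cellMass_nonneg hϱ0 x)
  have hdi : Integrable (fun x => ϱ x / M x) κ := by
    refine ⟨(hϱm.div hMm).aestronglyMeasurable, ?_⟩
    rw [hasFiniteIntegral_iff_ofReal (ae_of_all _ hd0)]
    exact hdl.trans_lt ENNReal.ofReal_lt_top
  have hdv : ∫ x, ϱ x / M x ∂κ ≤ (2 * R + 2 * ε) / ε := by
    rw [integral_eq_lintegral_of_nonneg_ae (ae_of_all _ hd0) hdi.1]
    exact ENNReal.toReal_le_of_le_ofReal (by positivity) hdl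
  set c' := Real.log ε + 2 * Real.log t with hc'
  have hform : ∀ x, ϱ x * (ε * t / M x - c') = ε * t * (ϱ x / M x) - c' * ϱ x := fun x => by ring
  have h2 := integral_kernel_mul (κ := κ) (measurable_blockKernel (κ := κ) (ε := ε) hϱm)
    (blockKernel_nonneg hϱ0) (integrable_blockKernel hϱm hϱ0 hϱ1) (a := ϱ)
    (h := fun x => ε * t / M x - c') (ae_integral_blockKernel hϱm hϱ0 hϱ1)
    ((hMm.const_div _).sub_const _)
    (by simp_rw [hform]; exact (hdi.const_mul _).sub (hϱi.const_mul _))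
  have h2v : ∫ x, ϱ x * (ε * t / M x - c') ∂κ ≤ t * (2 * R + 2 * ε) - c' * ∫ x, ϱ x ∂κ := by
    simp_rw [hform]
    rw [integral_sub (hdi.const_mul _) (hϱi.const_mul _), integral_const_mul, integral_const_mul]
    have h3 := mul_le_mul_of_nonneg_left hdv (show 0 ≤ ε * t by positivity)
    have h4 : ε * t * ((2 * R + 2 * ε) / ε) = t * (2 * R + 2 * ε) := by field_simp
    linarith
  have hpos : ∀ᵐ p ∂(κ.prod κ), 0 < lebDensity μ p.1 :=
    Measure.quasiMeasurePreserving_fst.ae (ae_restrict_of_ae (ae_lebDensity_pos hμ))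
  have hle : ∀ᵐ p ∂(κ.prod κ), recoveryKernel μ A ε p * Real.log (recoveryKernel μ A ε p)
      + ε⁻¹ * (|p.1 - p.2| * recoveryKernel μ A ε p)
      ≤ expKernel μ ε p * (c - Real.log (lebDensity μ p.1))
        + blockKernel κ ϱ ε p * (ε * t / M p.1 - c') := by
    filter_upwards [hpos] with p hp
    exact recoveryKernel_energy_le hμ hA hε ht0 ht1 hp
  have hi : Integrable (fun p => recoveryKernel μ A ε p * Real.log (recoveryKernel μ A ε p)
      + ε⁻¹ * (|p.1 - p.2| * recoveryKernel μ A ε p)) (κ.prod κ) := by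
    have hk : Measurable (recoveryKernel μ A ε) := measurable_recoveryKernel
    refine ((h1.1.add h2.1).norm.add (integrable_const (1 : ℝ))).mono'
      ((hk.mul hk.log).add (((Continuous.measurable (by fun_prop)).mul
        hk).const_mul _)).aestronglyMeasurable ?_
    filter_upwards [hle] with p hp
    have h5 := neg_mul_log_le_one _ (recoveryKernel_nonneg hμ hA hε p)
    have h6 : 0 ≤ ε⁻¹ * (|p.1 - p.2| * recoveryKernel μ A ε p) :=
      mul_nonneg (by positivity) (mul_nonneg (abs_nonneg _) (recoveryKernel_nonneg hμ hA hε p))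
    simp only [Pi.add_apply, Real.norm_eq_abs]
    refine abs_le.2 ⟨?_, ?_⟩
    · have := abs_nonneg (expKernel μ ε p * (c - Real.log (lebDensity μ p.1))
        + blockKernel κ ϱ ε p * (ε * t / M p.1 - c'))
      linarith
    · have := le_abs_self (expKernel μ ε p * (c - Real.log (lebDensity μ p.1))
        + blockKernel κ ϱ ε p * (ε * t / M p.1 - c'))
      linarith
  refine ⟨hi, ?_⟩
  have h7 := integral_mono_ae hi (h1.1.add h2.1) hle
  simp only [Pi.add_apply] at h7
  rw [integral_add h1.1 h2.1, h1.2, h2.2, h1v] at h7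
  rw [recoveryEnergy]
  linarith

theorem tendsto_integral_expKernelDefect [IsFiniteMeasure μ] (hμ : μ ≪ volume)
    (hA : MeasurableSet A) :
    Tendsto (fun ε => ∫ x in A, expKernelDefect μ A ε x ∂μ) (𝓝[>] 0) (𝓝 0) := by
  have := tendsto_integral_filter_of_dominated_convergence (μ := μ.restrict A) (l := 𝓝[>] (0 : ℝ))
    (F := fun ε x => expKernelDefect μ A ε x) (f := fun _ => (0 : ℝ)) (fun _ => 1)
    (Eventually.of_forall fun ε => measurable_expKernelDefect.aestronglyMeasurable) ?_
    (integrable_const _) ?_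
  · simpa using this
  · filter_upwards [self_mem_nhdsWithin] with ε hε
    refine ae_of_all _ fun x => ?_
    rw [Real.norm_of_nonneg (expKernelDefect_nonneg hμ hA hε x)]
    exact expKernelDefect_le_one hε x
  · filter_upwards [ae_tendsto_expKernelMarginal hμ hA] with x hx
    have := hx.const_sub 1
    rwa [sub_self] at this

theorem tendsto_integral_expKernelMarginal_mul_log [IsFiniteMeasure μ] (hμ : μ ≪ volume)
    (hA : MeasurableSet A) (hlog : Integrable (fun x => Real.log (lebDensity μ x)) μ) :
    Tendsto (fun ε => ∫ x in A, expKernelMarginal μ A ε x * Real.log (lebDensity μ x) ∂μ) (𝓝[>] 0)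
      (𝓝 (∫ x in A, Real.log (lebDensity μ x) ∂μ)) := by
  refine tendsto_integral_filter_of_dominated_convergence (fun x => ‖Real.log (lebDensity μ x)‖)
    (Eventually.of_forall fun ε =>
      ((measurable_expKernelMarginal ε).mul (by fun_prop)).aestronglyMeasurable) ?_
    hlog.integrableOn.norm ?_
  · filter_upwards [self_mem_nhdsWithin] with ε hε
    refine ae_of_all _ fun x => ?_
    rw [norm_mul, Real.norm_of_nonneg (expKernelMarginal_nonneg hε x)]
    exact mul_le_of_le_one_left (norm_nonneg _) (expKernelMarginal_le_one hμ hA hε x)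
  · filter_upwards [ae_tendsto_expKernelMarginal hμ hA] with x hx
    simpa using hx.mul_const (Real.log (lebDensity μ x))

/-- The energy of the recovery kernel is asymptotically optimal. -/
theorem eventually_recoveryEnergy_le [IsFiniteMeasure μ] (hμ : μ ≪ volume)
    (hA : MeasurableSet A) (hR : μ (Icc (-R) R)ᶜ = 0) (hR0 : 0 < R)
    (hlog : Integrable (fun x => Real.log (lebDensity μ x)) μ) {η : ℝ} (hη : 0 < η) :
    ∀ᶠ ε in 𝓝[>] 0, recoveryEnergy μ A ε + Real.log (2 * ε) * μ.real A
      < -∫ x in A, Real.log (lebDensity μ x) ∂μ + η := by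
  -- The weight is fixed before ε → 0, so that -2 log t stays a constant in front of the vanishing
  -- defect.
  obtain ⟨t, ht0, ht1, ht⟩ : ∃ t : ℝ, 0 < t ∧ t < 1 ∧
      -Real.log (1 - t) * μ.real A + t * (2 * R) < η := by
    have hcont : ContinuousAt (fun t : ℝ => -Real.log (1 - t) * μ.real A + t * (2 * R)) 0 := by
      have : ContinuousAt (fun t : ℝ => Real.log (1 - t)) 0 :=
        ContinuousAt.log (by fun_prop) (by norm_num)
      exact (this.neg.mul_const _).add (by fun_prop)
    have h1 := hcont.eventually (gt_mem_nhds (show -Real.log (1 - 0) * μ.real A + 0 * (2 * R) < η by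
      simpa using hη))
    have h2 : ∀ᶠ t : ℝ in 𝓝[>] 0, 0 < t ∧ t < 1 ∧
        -Real.log (1 - t) * μ.real A + t * (2 * R) < η := by
      filter_upwards [self_mem_nhdsWithin, mem_nhdsWithin_of_mem_nhds h1,
        mem_nhdsWithin_of_mem_nhds (gt_mem_nhds one_pos)] with t h0 h1 h2
      exact ⟨h0, h2, h1⟩
    exact h2.exists
  set I := ∫ x in A, Real.log (lebDensity μ x) ∂μ with hI
  -- After log(2ε) μ(A) is added, the two occurrences of log ε times the total defect cancel and
  -- only log 2 remains: the defect has to vanish, but at no particular rate.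
  have hlim : Tendsto (fun ε : ℝ =>
      (Real.log 2 - 2 * Real.log t) * ∫ x in A, expKernelDefect μ A ε x ∂μ
      - Real.log (1 - t) * (μ.real A - ∫ x in A, expKernelDefect μ A ε x ∂μ)
      - ∫ x in A, expKernelMarginal μ A ε x * Real.log (lebDensity μ x) ∂μ
      + t * (2 * R + 2 * ε)) (𝓝[>] 0)
      (𝓝 ((Real.log 2 - 2 * Real.log t) * 0 - Real.log (1 - t) * (μ.real A - 0) - I
        + t * (2 * R + 2 * 0))) := by
    have h1 := tendsto_integral_expKernelDefect hμ hA
    have h2 := tendsto_integral_expKernelMarginal_mul_log hμ hA hlog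
    have h3 : Tendsto (fun ε : ℝ => t * (2 * R + 2 * ε)) (𝓝[>] 0) (𝓝 (t * (2 * R + 2 * 0))) :=
      (Continuous.tendsto (by fun_prop) 0).mono_left nhdsWithin_le_nhds
    exact (((h1.const_mul _).sub ((h1.const_sub _).const_mul _)).sub h2).add h3
  filter_upwards [hlim.eventually (gt_mem_nhds (show _ < -I + η by linarith)),
    self_mem_nhdsWithin] with ε hlt hε
  have hε' : 0 < ε := hε
  have h := (integrable_recoveryEnergy_and_le hμ hA hε' hR hR0 hlog ht0 ht1).2
  have h5 : Real.log (2 * ε) = Real.log 2 + Real.log ε := Real.log_mul two_ne_zero hε'.ne'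
  rw [h5] at h ⊢
  linarith

end RecoveryKernel
end

noncomputable section

/-! ### The upper bound inequality -/

section Recovery

/-- The entropy of a sum of two measures carried by disjoint sets. -/
theorem relEnt_restrict_add_withDensity {X : Type*} [MeasurableSpace X] {m γ : Measure X}
    [IsFiniteMeasure m] [IsFiniteMeasure γ] {U V : Set X} (hU : MeasurableSet U)
    (hV : MeasurableSet V) (hUV : Disjoint U V) (hγ : relEnt (γ.restrict U) m < ⊤) {k : X → ℝ}
    (hk : Measurable k) (hk0 : ∀ x, 0 ≤ k x) (hki : Integrable k (m.restrict V))
    (hkl : Integrable (fun x => k x * Real.log (k x)) (m.restrict V)) :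
    relEnt (γ.restrict U + (m.restrict V).withDensity fun x => ENNReal.ofReal (k x)) m
      = relEnt (γ.restrict U) m + ((∫ x in V, k x * Real.log (k x) ∂m : ℝ) : EReal) := by
  obtain ⟨hac, hl⟩ := ac_and_integrable_of_relEnt_lt_top MeasurableSet.univ (by simp)
    (measure_lt_top _ _) hγ
  have hrl := (integrable_mul_log_rnDeriv_iff hac).2 hl
  set rn := (γ.restrict U).rnDeriv m with hrn
  set D₁ : X → ℝ := U.indicator fun x => (rn x).toReal with hD₁
  set D₂ : X → ℝ := V.indicator k with hD₂
  have hlog : ∀ (S : Set X) (f : X → ℝ) (x : X), S.indicator f x * Real.log (S.indicator f x)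
      = S.indicator (fun x => f x * Real.log (f x)) x := fun S f x => by
    by_cases hx : x ∈ S <;> simp [hx]
  have hof : ∀ (S : Set X) (f : X → ℝ), (fun x => ENNReal.ofReal (S.indicator f x))
      = S.indicator fun x => ENNReal.ofReal (f x) := fun S f => by
    ext x; by_cases hx : x ∈ S <;> simp [hx]
  have hrm : Measurable fun x => (rn x).toReal :=
    (Measure.measurable_rnDeriv _ _).ennreal_toReal
  have hm₁ : Measurable D₁ := hrm.indicator hU
  have hm₂ : Measurable D₂ := hk.indicator hV
  have h0₁ : ∀ x, 0 ≤ D₁ x := fun x => indicator_nonneg (fun _ _ => ENNReal.toReal_nonneg) x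
  have h0₂ : ∀ x, 0 ≤ D₂ x := fun x => indicator_nonneg (fun _ _ => hk0 _) x
  have hi₁ : Integrable D₁ m := Measure.integrable_toReal_rnDeriv.indicator hU
  have hi₂ : Integrable D₂ m := (integrable_indicator_iff hV).2 hki
  have hl₁ : Integrable (fun x => D₁ x * Real.log (D₁ x)) m := by
    simp only [hD₁, hlog]; exact hrl.indicator hU
  have hl₂ : Integrable (fun x => D₂ x * Real.log (D₂ x)) m := by
    simp only [hD₂, hlog]; exact (integrable_indicator_iff hV).2 hkl
  have hγD : γ.restrict U = m.withDensity fun x => ENNReal.ofReal (D₁ x) := by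
    have h1 : γ.restrict U = (m.restrict U).withDensity rn := by
      rw [← restrict_withDensity hU, hrn, Measure.withDensity_rnDeriv_eq _ _ hac,
        Measure.restrict_restrict hU, inter_self]
    simp only [hD₁, hof]
    rw [withDensity_indicator hU]
    conv_lhs => rw [h1]
    refine withDensity_congr_ae (ae_restrict_of_ae ?_)
    filter_upwards [(γ.restrict U).rnDeriv_lt_top m] with x hx
    rw [ENNReal.ofReal_toReal hx.ne]
  have hkD : (m.restrict V).withDensity (fun x => ENNReal.ofReal (k x))
      = m.withDensity fun x => ENNReal.ofReal (D₂ x) := by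
    simp only [hD₂, hof]
    rw [withDensity_indicator hV]
  have hsum : γ.restrict U + (m.restrict V).withDensity (fun x => ENNReal.ofReal (k x))
      = m.withDensity fun x => ENNReal.ofReal (D₁ x + D₂ x) := by
    rw [hkD]
    conv_lhs => rw [hγD]
    rw [← withDensity_add_left hm₁.ennreal_ofReal]
    congr 1
    ext x
    rw [Pi.add_apply, ENNReal.ofReal_add (h0₁ x) (h0₂ x)]
  have hlsum : (fun x => (D₁ x + D₂ x) * Real.log (D₁ x + D₂ x))
      = fun x => D₁ x * Real.log (D₁ x) + D₂ x * Real.log (D₂ x) := by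
    ext x
    by_cases hx : x ∈ U
    · have : D₂ x = 0 := indicator_of_notMem (disjoint_left.1 hUV hx) _
      simp [this]
    · have : D₁ x = 0 := indicator_of_notMem hx _
      simp [this]
  have hrel : relEnt (m.withDensity fun x => ENNReal.ofReal (D₁ x + D₂ x)) m
      = ((∫ x, (D₁ x + D₂ x) * Real.log (D₁ x + D₂ x) ∂m : ℝ) : EReal) :=
    relEnt_withDensity (hm₁.add hm₂) (fun x => add_nonneg (h0₁ x) (h0₂ x)) (hi₁.add hi₂)
      (by rw [hlsum]; exact hl₁.add hl₂)
  rw [hsum, hrel, hlsum, integral_add hl₁ hl₂, EReal.coe_add, hγD,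
    relEnt_withDensity hm₁ h0₁ hi₁ hl₁]
  congr 2
  simp only [hD₂, hlog]
  rw [integral_indicator hV]

variable {μ ν : Measure ℝ} {R : ℝ}

/-- For an optimal plan, one coordinate avoids `A` exactly when the other does, up to a null set. -/
theorem BoundedMarginals.map_snd_restrict [IsProbabilityMeasure μ] [IsProbabilityMeasure ν]
    (hR : BoundedMarginals μ ν R)
    (hfr : volume (frontier (coincidenceSet μ ν ∩ μ.support)) = 0)
    {γ : ProbabilityMeasure (ℝ × ℝ)} (hγ : γ ∈ optimalPlans μ ν) :
    ((γ : Measure (ℝ × ℝ)).restrict ((coincidenceSet μ ν)ᶜ ×ˢ univ)).map Prod.snd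
      = ν.restrict (coincidenceSet μ ν)ᶜ := by
  have hA : MeasurableSet (coincidenceSet μ ν)ᶜ := (measurableSet_coincidenceSet μ ν).compl
  have h : (γ : Measure (ℝ × ℝ)).restrict ((coincidenceSet μ ν)ᶜ ×ˢ univ)
      = (γ : Measure (ℝ × ℝ)).restrict (Prod.snd ⁻¹' (coincidenceSet μ ν)ᶜ) := by
    refine Measure.restrict_congr_set ?_
    filter_upwards [measure_eq_zero_iff_ae_notMem.1 (hR.measure_compl_prod_coincidenceSet hfr hγ),
      hR.ae_eq_of_mem_coincidenceSet hfr hγ] with p hp1 hp2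
    refine propext ⟨fun h h2 => hp1 ⟨h.1, h2⟩, fun h => ⟨fun h2 => h ?_, mem_univ _⟩⟩
    rw [hp2 h2]; exact h2
  rw [h, ← Measure.restrict_map measurable_snd hA, hγ.1.2]

/-- Competitors for the upper bound inequality: near the coincidence set, an optimal plan is
replaced by the recovery kernel. -/
theorem BoundedMarginals.exists_recoveryPlan [IsProbabilityMeasure μ] [IsProbabilityMeasure ν]
    (hR : BoundedMarginals μ ν R)
    (hfr : volume (frontier (coincidenceSet μ ν ∩ μ.support)) = 0)
    (hlog : Integrable (fun x => Real.log (lebDensity μ x)) μ)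
    {γ : ProbabilityMeasure (ℝ × ℝ)} (hγ : γ ∈ optimalPlans μ ν)
    (hent : relEnt ((γ : Measure (ℝ × ℝ)).restrict ((coincidenceSet μ ν)ᶜ ×ˢ univ)) (μ.prod ν) < ⊤)
    {ε : ℝ} (hε : 0 < ε) :
    ∃ γ' : transportPlans μ ν,
      rescaledCost μ ν ε γ'
        = relEnt ((γ : Measure (ℝ × ℝ)).restrict ((coincidenceSet μ ν)ᶜ ×ˢ univ)) (μ.prod ν)
          + ((recoveryEnergy μ (coincidenceSet μ ν) ε
            - |Real.log (2 * ε)| * μ.real (coincidenceSet μ ν) : ℝ) : EReal) ∧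
      ∀ (f : ℝ × ℝ → ℝ) (K : NNReal), LipschitzWith K f →
        |∫ p, f p ∂(γ'.1 : Measure (ℝ × ℝ)) - ∫ p, f p ∂(γ : Measure (ℝ × ℝ))|
          ≤ K * (mongeCost γ'.1 - wassersteinOne μ ν) := by
  set A := coincidenceSet μ ν with hAdef
  have hA : MeasurableSet A := measurableSet_coincidenceSet μ ν
  have hμ := hR.ac_left
  set κ := μ.restrict A with hκ
  have hκν : κ = ν.restrict A := restrict_coincidenceSet_eq hR.ac_left hR.ac_right
  set U : Set (ℝ × ℝ) := Aᶜ ×ˢ univ with hU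
  have hUm : MeasurableSet U := hA.compl.prod MeasurableSet.univ
  set V : Set (ℝ × ℝ) := A ×ˢ A with hV
  have hVm : MeasurableSet V := hA.prod hA
  have hUV : Disjoint U V := disjoint_left.2 fun p hp hp' => hp.1 hp'.1
  have hκκ : κ.prod κ = (μ.prod ν).restrict V := by
    conv_lhs => rw [hκν]
    rw [← hκν, hκ]
    conv_lhs => rw [← hκ, hκν, ← hκν]
    rw [hV, ← Measure.prod_restrict, ← hκν]
  set k := recoveryKernel μ A ε with hk
  have hkm : Measurable k := measurable_recoveryKernel
  have hk0 : ∀ p, 0 ≤ k p := recoveryKernel_nonneg hμ hA hε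
  have hki : Integrable k (κ.prod κ) := integrable_recoveryKernel_prod hμ hA hε
  have hdi : Integrable (fun p => |p.1 - p.2| * k p) (κ.prod κ) :=
    integrable_dist_mul_recoveryKernel hμ hA hε hR.left
  have hei := (integrable_recoveryEnergy_and_le hμ hA hε hR.left hR.pos hlog
    (t := 1 / 2) (by norm_num) (by norm_num)).1
  have hkl : Integrable (fun p => k p * Real.log (k p)) (κ.prod κ) := by
    refine (hei.sub (hdi.const_mul ε⁻¹)).congr (ae_of_all _ fun p => ?_)
    simp only [Pi.sub_apply]
    exact add_sub_cancel_right _ _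
  set ζ : Measure (ℝ × ℝ) := (κ.prod κ).withDensity fun p => ENNReal.ofReal (k p) with hζ
  have hζf : IsFiniteMeasure ζ := isFiniteMeasure_withDensity_ofReal hki.2
  have hζ1 : ζ.map Prod.fst = κ :=
    map_fst_withDensity_prod hkm.ennreal_ofReal (ae_lintegral_recoveryKernel hμ hA hε)
  have hζ2 : ζ.map Prod.snd = κ :=
    map_snd_withDensity_prod hkm.ennreal_ofReal (fun p => by rw [hk, recoveryKernel_swap])
      (ae_lintegral_recoveryKernel hμ hA hε)
  set G : Measure (ℝ × ℝ) := (γ : Measure (ℝ × ℝ)).restrict U + ζ with hG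
  have hG1 : G.map Prod.fst = μ := by
    rw [hG, Measure.map_add _ _ measurable_fst, hζ1, hU, prod_univ,
      ← Measure.restrict_map measurable_fst hA.compl, hγ.1.1, hκ, add_comm]
    exact Measure.restrict_add_restrict_compl hA
  have hG2 : G.map Prod.snd = ν := by
    rw [hG, Measure.map_add _ _ measurable_snd, hζ2, hR.map_snd_restrict hfr hγ, hκν, add_comm]
    exact Measure.restrict_add_restrict_compl hA
  have hGp : IsProbabilityMeasure G := by
    refine ⟨?_⟩
    have : G.map Prod.fst univ = 1 := by rw [hG1]; exact measure_univ
    rwa [Measure.map_apply measurable_fst MeasurableSet.univ, preimage_univ] at this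
  set γ' : transportPlans μ ν := ⟨⟨G, hGp⟩, hG1, hG2⟩ with hγ'
  have hγ'G : (γ'.1 : Measure (ℝ × ℝ)) = G := rfl
  -- The replaced part of γ is diagonal with the same first marginal as ζ, so the two integrals
  -- differ by the variation of f from the diagonal. Applied to the distance this gives the excess
  -- cost, and applied to a Lipschitz function the distance between the plans.
  have hdiff : ∀ f : ℝ × ℝ → ℝ, Continuous f →
      Integrable f ζ ∧ Integrable (fun p => f (p.1, p.1)) ζ ∧
      ∫ p, f p ∂G - ∫ p, f p ∂(γ : Measure (ℝ × ℝ)) = ∫ p, (f p - f (p.1, p.1)) ∂ζ := by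
    intro f hf
    have hfd : Continuous fun p : ℝ × ℝ => f (p.1, p.1) := by fun_prop
    have i1 := hR.integrable_of_continuous γ'.2 hf
    have i2 := hR.integrable_of_continuous hγ.1 hf
    have i3 := hR.integrable_of_continuous γ'.2 hfd
    rw [hγ'G, hG, integrable_add_measure] at i1 i3
    refine ⟨i1.2, i3.2, ?_⟩
    have h1 : ∫ p in Uᶜ, f p ∂(γ : Measure (ℝ × ℝ)) = ∫ x in A, f (x, x) ∂μ := by
      have hUc : Uᶜ = A ×ˢ univ := by rw [hU, prod_univ, prod_univ, preimage_compl, compl_compl]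
      rw [← setIntegral_fst_eq hγ.1 hA (f := fun x => f (x, x))
        (Continuous.measurable (by fun_prop)), hUc]
      refine integral_congr_ae ((ae_restrict_iff' (hA.prod MeasurableSet.univ)).2 ?_)
      filter_upwards [hR.ae_eq_of_mem_coincidenceSet hfr hγ] with p hp hpA
      have : p = (p.1, p.1) := Prod.ext rfl (hp hpA.1)
      conv_lhs => rw [this]
    have h2 : ∫ p, f (p.1, p.1) ∂ζ = ∫ x in A, f (x, x) ∂μ := by
      rw [← hκ, ← hζ1, integral_map measurable_fst.aemeasurable
        (Continuous.aestronglyMeasurable (by fun_prop))]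
    rw [hG, integral_add_measure i1.1 i1.2, ← integral_add_compl hUm i2, h1,
      integral_sub i1.2 i3.2, h2]
    ring
  have hcost : mongeCost γ'.1 - wassersteinOne μ ν = ∫ p, |p.2 - p.1| ∂ζ := by
    rw [← hγ.2, mongeCost, mongeCost, hγ'G, (hdiff (fun p => |p.2 - p.1|) (by fun_prop)).2.2]
    simp
  have hcost2 : ∫ p, |p.2 - p.1| ∂ζ = ∫ p, |p.1 - p.2| * k p ∂(κ.prod κ) := by
    rw [hζ, integral_withDensity_eq_integral_toReal_smul hkm.ennreal_ofReal
      (ae_of_all _ fun _ => ENNReal.ofReal_lt_top)]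
    refine integral_congr_ae (ae_of_all _ fun p => ?_)
    simp only
    rw [ENNReal.toReal_ofReal (hk0 p), smul_eq_mul, mul_comm, abs_sub_comm]
  refine ⟨γ', ?_, fun f K hf => ?_⟩
  · have hrel := relEnt_restrict_add_withDensity hUm hVm hUV hent hkm hk0 (by rwa [← hκκ])
      (by rwa [← hκκ])
    rw [← hκκ] at hrel
    rw [rescaledCost, hγ'G, hG, hζ, hrel, hcost, hcost2, recoveryEnergy,
      integral_add hkl (hdi.const_mul _), integral_const_mul, one_div, add_left_comm,
      ← EReal.coe_add, add_sub_assoc, ← EReal.coe_sub]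
    congr 2
    ring
  · rw [hγ'G, (hdiff f hf.continuous).2.2, hcost, ← integral_const_mul, ← Real.norm_eq_abs]
    refine norm_integral_le_of_norm_le
      ((hdiff (fun p => |p.2 - p.1|) (by fun_prop)).1.const_mul _) (ae_of_all _ fun p => ?_)
    have := hf.dist_le_mul p (p.1, p.1)
    rw [Real.dist_eq, Prod.dist_eq, dist_self, max_eq_right dist_nonneg, Real.dist_eq] at this
    exact this

/-- The upper bound inequality of the `Γ`-convergence. -/
theorem BoundedMarginals.exists_recoverySequence [IsProbabilityMeasure μ] [IsProbabilityMeasure ν]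
    (hR : BoundedMarginals μ ν R)
    (hfr : volume (frontier (coincidenceSet μ ν ∩ μ.support)) = 0)
    (hlog : Integrable (fun x => Real.log (lebDensity μ x)) μ) (γ : transportPlans μ ν) :
    ∃ u : ℝ → transportPlans μ ν, Tendsto u (𝓝[>] 0) (𝓝 γ) ∧
      ∀ c : ℝ, limitCost μ ν γ < c → ∀ᶠ ε in 𝓝[>] 0, rescaledCost μ ν ε (u ε) < c := by
  set A := coincidenceSet μ ν with hAdef
  have hA : MeasurableSet A := measurableSet_coincidenceSet μ ν
  by_cases hopt : γ.1 ∈ optimalPlans μ ν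
  swap
  · refine ⟨fun _ => γ, tendsto_const_nhds, fun c hc => ?_⟩
    rw [limitCost, if_neg hopt] at hc
    exact absurd hc not_top_lt
  have hlim : limitCost μ ν γ = relEnt ((γ.1 : Measure (ℝ × ℝ)).restrict (Aᶜ ×ˢ univ)) (μ.prod ν)
      - ((∫ x in A, Real.log (lebDensity μ x) ∂μ : ℝ) : EReal) := by
    rw [limitCost, if_pos hopt, hR.restrict_compl_prod_compl hfr hopt]
    rfl
  -- When the limit energy is `⊤` there is nothing to recover, and a constant family suffices.
  by_cases hent : relEnt ((γ.1 : Measure (ℝ × ℝ)).restrict (Aᶜ ×ˢ univ)) (μ.prod ν) < ⊤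
  swap
  · refine ⟨fun _ => γ, tendsto_const_nhds, fun c hc => ?_⟩
    rw [hlim, not_lt_top_iff.1 hent, EReal.top_sub_coe] at hc
    exact absurd hc not_top_lt
  obtain ⟨e, he⟩ : ∃ e : ℝ, relEnt ((γ.1 : Measure (ℝ × ℝ)).restrict (Aᶜ ×ˢ univ)) (μ.prod ν)
      = (e : EReal) := by
    obtain ⟨hac, hl⟩ := ac_and_integrable_of_relEnt_lt_top MeasurableSet.univ (by simp)
      (measure_lt_top _ _) hent
    exact ⟨_, relEnt_eq_integral hac hl⟩
  have hex := fun ε (hε : 0 < ε) => hR.exists_recoveryPlan hfr hlog hopt hent hε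
  have : Nonempty (transportPlans μ ν) := ⟨γ⟩
  choose! u hu1 hu2 using hex
  set I := ∫ x in A, Real.log (lebDensity μ x) ∂μ with hI
  have hval : ∀ ε, 0 < ε → rescaledCost μ ν ε (u ε)
      = ((e + (recoveryEnergy μ A ε - |Real.log (2 * ε)| * μ.real A) : ℝ) : EReal) :=
    fun ε hε => by rw [hu1 ε hε, he, EReal.coe_add]
  have hup : ∀ η : ℝ, 0 < η → ∀ᶠ ε in 𝓝[>] 0,
      e + (recoveryEnergy μ A ε - |Real.log (2 * ε)| * μ.real A) < e - I + η := by
    intro η hη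
    filter_upwards [eventually_recoveryEnergy_le hR.ac_left hA hR.left hR.pos hlog hη,
      self_mem_nhdsWithin, mem_nhdsWithin_of_mem_nhds (gt_mem_nhds (show (0 : ℝ) < 1 / 2 by
        norm_num))] with ε h hε hε2
    have hε' : 0 < ε := hε
    have hε3 : ε < 1 / 2 := hε2
    rw [abs_of_nonpos (Real.log_nonpos (by linarith) (by linarith))]
    linarith
  refine ⟨u, ?_, fun c hc => ?_⟩
  · have hbound : ∀ᶠ ε in 𝓝[>] (0 : ℝ), mongeCost (u ε).1 - wassersteinOne μ ν
        ≤ ε * (e - I + 1) + |2 * ε * Real.log (2 * ε)| / 2 * μ.real A := by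
      filter_upwards [hup 1 one_pos, self_mem_nhdsWithin] with ε h hε
      have hε' : 0 < ε := hε
      have h0 : ((0 : ℝ) : EReal) ≤ relEnt ((u ε).1 : Measure (ℝ × ℝ)) (μ.prod ν) := by
        have := le_relEnt (γ := ((u ε).1 : Measure (ℝ × ℝ))) (ρ := μ.prod ν) (φ := fun _ => 0)
          (integrable_const _) (integrable_const _)
        simpa using this
      have h1 : (((1 / ε) * (mongeCost (u ε).1 - wassersteinOne μ ν) + 0
          - |Real.log (2 * ε)| * μ.real A : ℝ) : EReal) ≤ rescaledCost μ ν ε (u ε) := by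
        rw [rescaledCost, EReal.coe_sub, EReal.coe_add]
        exact EReal.sub_le_sub (add_le_add_right h0 _) le_rfl
      rw [hval ε hε', EReal.coe_le_coe_iff, one_div_mul_eq_div] at h1
      have h2 : (mongeCost (u ε).1 - wassersteinOne μ ν) / ε
          ≤ e - I + 1 + |Real.log (2 * ε)| * μ.real A := by linarith
      rw [div_le_iff₀ hε'] at h2
      rw [abs_mul, abs_of_pos (by linarith : 0 < 2 * ε)]
      linarith
    have hzero : Tendsto (fun ε : ℝ => ε * (e - I + 1)
        + |2 * ε * Real.log (2 * ε)| / 2 * μ.real A) (𝓝[>] 0) (𝓝 0) := by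
      have hc : Continuous fun ε : ℝ =>
          ε * (e - I + 1) + |2 * ε * Real.log (2 * ε)| / 2 * μ.real A := by
        have := Real.continuous_mul_log.comp (continuous_const_mul (2 : ℝ))
        exact (continuous_mul_const _).add ((this.abs.div_const 2).mul_const _)
      have := hc.tendsto 0
      simp only [mul_zero, zero_mul, abs_zero, zero_div, add_zero] at this
      exact this.mono_left nhdsWithin_le_nhds
    rw [tendsto_subtype_rng, tendsto_iff_forall_lipschitz_integral_tendsto]
    rintro f - ⟨K, hK⟩
    rw [tendsto_iff_dist_tendsto_zero]
    have hKz := hzero.const_mul (K : ℝ)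
    rw [mul_zero] at hKz
    refine tendsto_of_tendsto_of_tendsto_of_le_of_le' tendsto_const_nhds hKz
      (Eventually.of_forall fun ε => dist_nonneg) ?_
    filter_upwards [hbound, self_mem_nhdsWithin] with ε h hε
    rw [Real.dist_eq]
    exact (hu2 ε hε f K hK).trans (mul_le_mul_of_nonneg_left h K.2)
  · rw [hlim, he, ← EReal.coe_sub, EReal.coe_lt_coe_iff] at hc
    filter_upwards [hup (c - (e - I)) (by linarith), self_mem_nhdsWithin] with ε h hε
    rw [hval ε hε, EReal.coe_lt_coe_iff]
    linarith

end Recovery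
end

noncomputable section

/-! ### Sufficient conditions for logarithmic integrability -/

section LogDist

theorem lintegral_Ioo_comp_min_le (a b : ℝ) {φ : ℝ → ENNReal} (hφ : Measurable φ) :
    ∫⁻ x in Ioo a b, φ (min (x - a) (b - x)) ≤ 2 * ∫⁻ s in Ioo 0 (b - a), φ s := by
  have h1 : ∫⁻ x in Ioo a b, φ (x - a) = ∫⁻ s in Ioo 0 (b - a), φ s := by
    rw [← lintegral_indicator measurableSet_Ioo, ← lintegral_indicator measurableSet_Ioo,
      ← lintegral_sub_right_eq_self ((Ioo 0 (b - a)).indicator φ) a]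
    refine lintegral_congr fun x => ?_
    simp only [indicator, mem_Ioo, sub_pos, sub_lt_sub_iff_right]
  have h2 : ∫⁻ x in Ioo a b, φ (b - x) = ∫⁻ s in Ioo 0 (b - a), φ s := by
    rw [← lintegral_indicator measurableSet_Ioo, ← lintegral_indicator measurableSet_Ioo,
      ← lintegral_sub_left_eq_self ((Ioo 0 (b - a)).indicator φ) b]
    refine lintegral_congr fun x => ?_
    simp only [indicator, mem_Ioo, sub_pos, sub_lt_sub_iff_left, and_comm]
  calc ∫⁻ x in Ioo a b, φ (min (x - a) (b - x))
      ≤ ∫⁻ x in Ioo a b, (φ (x - a) + φ (b - x)) := by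
        refine lintegral_mono fun x => ?_
        rcases min_choice (x - a) (b - x) with h | h <;> rw [h]
        exacts [le_self_add, le_add_self]
    _ = 2 * ∫⁻ s in Ioo 0 (b - a), φ s := by
        rw [lintegral_add_left (by fun_prop), h1, h2, two_mul]

/-- For l > 1 the function -log s changes sign on (0, l). Adding |log l| + log l, which is
nonnegative, makes it nonnegative throughout and leaves an explicit integral. -/
theorem lintegral_neg_log_le {l : ℝ} (hl : 0 < l) :
    ∫⁻ s in Ioo 0 l, ENNReal.ofReal (-Real.log s) ≤ ENNReal.ofReal (l * |Real.log l| + l) := by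
  have hi : IntegrableOn (fun s => |Real.log l| + Real.log l - Real.log s) (Ioo 0 l) := by
    refine IntegrableOn.mono_set ?_ Ioo_subset_Ioc_self
    rw [← intervalIntegrable_iff_integrableOn_Ioc_of_le hl.le]
    exact intervalIntegrable_const.sub intervalIntegral.intervalIntegrable_log'
  have h0 : ∀ s ∈ Ioo 0 l, 0 ≤ |Real.log l| + Real.log l - Real.log s := fun s hs => by
    have := Real.log_le_log hs.1 hs.2.le
    linarith [abs_nonneg (Real.log l)]
  calc ∫⁻ s in Ioo 0 l, ENNReal.ofReal (-Real.log s)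
      ≤ ∫⁻ s in Ioo 0 l, ENNReal.ofReal (|Real.log l| + Real.log l - Real.log s) :=
        lintegral_mono fun s => ENNReal.ofReal_le_ofReal (by
          linarith [neg_abs_le (Real.log l)])
    _ = ENNReal.ofReal (l * |Real.log l| + l) := by
        rw [← ofReal_integral_eq_lintegral_ofReal hi
          ((ae_restrict_iff' measurableSet_Ioo).2 (ae_of_all _ h0)),
          ← integral_Ioc_eq_integral_Ioo, ← intervalIntegral.integral_of_le hl.le,
          intervalIntegral.integral_sub intervalIntegrable_const
            intervalIntegral.intervalIntegrable_log', integral_log]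
        congr 1
        simp
        ring

theorem lintegral_rpow_neg {l τ : ℝ} (hl : 0 < l) (hτ : τ < 1) :
    ∫⁻ s in Ioo 0 l, ENNReal.ofReal (s ^ (-τ)) = ENNReal.ofReal (l ^ (1 - τ) / (1 - τ)) := by
  have hi : IntegrableOn (fun s : ℝ => s ^ (-τ)) (Ioo 0 l) := by
    refine IntegrableOn.mono_set ?_ Ioo_subset_Ioc_self
    rw [← intervalIntegrable_iff_integrableOn_Ioc_of_le hl.le]
    exact intervalIntegral.intervalIntegrable_rpow' (by linarith)
  rw [← ofReal_integral_eq_lintegral_ofReal hi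
    ((ae_restrict_iff' measurableSet_Ioo).2 (ae_of_all _ fun s hs => Real.rpow_nonneg hs.1.le _)),
    ← integral_Ioc_eq_integral_Ioo, ← intervalIntegral.integral_of_le hl.le,
    integral_rpow (Or.inl (by linarith)), neg_add_eq_sub, Real.zero_rpow (by linarith), sub_zero]

variable {ι : Type*} {U : Set ℝ} {a b : ι → ℝ}

theorem IsDisjointIntervalUnion.tsum_measure_le (h : IsDisjointIntervalUnion U a b)
    (m : Measure ℝ) : ∑' i, m (Ioo (a i) (b i)) ≤ m U := by
  rw [h.eq_iUnion]
  exact tsum_meas_le_meas_iUnion_of_disjoint m (fun _ => measurableSet_Ioo) h.disjoint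

variable {μ : Measure ℝ} [IsFiniteMeasure μ]

/-- A bounded density and summability of `l |log l|` over the lengths `l` of the intervals imply
the logarithmic integrability condition. -/
theorem IsDisjointIntervalUnion.logDistSummable_of_bounded (h : IsDisjointIntervalUnion U a b)
    (hU : volume U < ⊤) (hμ : μ ≪ volume) {A : Set ℝ} (hUA : U ⊆ A) {C : ℝ}
    (hC : ∀ᵐ x ∂(volume.restrict A), μ.rnDeriv volume x ≤ ENNReal.ofReal C)
    (hs : Summable fun i => |a i - b i| * |Real.log (|a i - b i|)|) : LogDistSummable μ a b := by
  have hlen : ∀ i, |a i - b i| = b i - a i := fun i => by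
    rw [abs_sub_comm, abs_of_pos (sub_pos.2 (h.lt i))]
  simp only [hlen] at hs
  have hterm : ∀ i, ∫⁻ x in Ioo (a i) (b i), ENNReal.ofReal (-Real.log (min (x - a i) (b i - x))) ∂μ
      ≤ ENNReal.ofReal C * (2 * (ENNReal.ofReal ((b i - a i) * |Real.log (b i - a i)|)
        + volume (Ioo (a i) (b i)))) := by
    intro i
    have hl := sub_pos.2 (h.lt i)
    have hsub : Ioo (a i) (b i) ⊆ A := by
      refine Subset.trans ?_ hUA
      rw [h.eq_iUnion]; exact subset_iUnion (fun i => Ioo (a i) (b i)) i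
    rw [setLIntegral_eq_lebDensity_mul hμ measurableSet_Ioo (by fun_prop)]
    calc _ ≤ ∫⁻ x in Ioo (a i) (b i),
            ENNReal.ofReal C * ENNReal.ofReal (-Real.log (min (x - a i) (b i - x))) := by
          refine lintegral_mono_ae ?_
          filter_upwards [ae_restrict_of_ae_restrict_of_subset hsub hC] with x hx
          exact mul_le_mul' (ENNReal.ofReal_toReal_le.trans hx) le_rfl
      _ = ENNReal.ofReal C * ∫⁻ x in Ioo (a i) (b i),
            ENNReal.ofReal (-Real.log (min (x - a i) (b i - x))) :=
          lintegral_const_mul _ (by fun_prop)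
      _ ≤ _ := by
          gcongr
          refine (lintegral_Ioo_comp_min_le (a i) (b i)
            (φ := fun s => ENNReal.ofReal (-Real.log s)) (by fun_prop)).trans ?_
          gcongr
          rw [Real.volume_Ioo, ← ENNReal.ofReal_add (by positivity) hl.le]
          exact lintegral_neg_log_le hl
  refine (ENNReal.tsum_le_tsum hterm).trans_lt ?_
  rw [ENNReal.tsum_mul_left, ENNReal.tsum_mul_left, ENNReal.tsum_add]
  exact ENNReal.mul_lt_top ENNReal.ofReal_lt_top (ENNReal.mul_lt_top (by simp)
    (ENNReal.add_lt_top.2 ⟨hs.tsum_ofReal_lt_top, (h.tsum_measure_le _).trans_lt hU⟩))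

/-- Summability of a power less than one of the lengths of the intervals implies the logarithmic
integrability condition. -/
theorem IsDisjointIntervalUnion.logDistSummable_of_rpow (h : IsDisjointIntervalUnion U a b)
    (hU : volume U < ⊤) (hμ : μ ≪ volume) (hlog : Integrable (fun x => Real.log (lebDensity μ x)) μ)
    {δ : ℝ} (hδ : 0 < δ) (hs : Summable fun i => |a i - b i| ^ (1 - δ)) :
    LogDistSummable μ a b := by
  have hlen : ∀ i, |a i - b i| = b i - a i := fun i => by
    rw [abs_sub_comm, abs_of_pos (sub_pos.2 (h.lt i))]
  simp only [hlen] at hs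
  -- τ < 1 makes s^(-τ) integrable at 0. τ ≤ δ makes l^(1-τ) at most a constant times l^(1-δ) for
  -- the lengths l, which are bounded by `D`.
  set τ := min δ (1 / 2) with hτ
  have hτ0 : 0 < τ := lt_min hδ (by norm_num)
  have hτ1 : τ < 1 := (min_le_right _ _).trans_lt (by norm_num)
  have hτδ : τ ≤ δ := min_le_left _ _
  set D := (volume U).toReal with hD
  have hlD : ∀ i, b i - a i ≤ D := fun i => by
    rw [hD, ← ENNReal.ofReal_le_iff_le_toReal hU.ne, ← Real.volume_Ioo]
    refine measure_mono ?_
    rw [h.eq_iUnion]; exact subset_iUnion (fun i => Ioo (a i) (b i)) i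
  -- A finite measure, by the finite entropy of μ; it collects the f log f terms over all intervals
  -- at once.
  set κ := μ.withDensity fun x => ENNReal.ofReal |Real.log (lebDensity μ x)| with hκ
  have hκU : κ U < ⊤ := by
    refine (measure_mono (subset_univ _)).trans_lt ?_
    rw [hκ, withDensity_apply _ MeasurableSet.univ, setLIntegral_univ]
    have := hlog.2
    simp only [hasFiniteIntegral_iff_norm, Real.norm_eq_abs] at this
    exact this
  have hm := measurable_lebDensity (μ := μ)
  set φ : ℝ → ENNReal := fun s => ENNReal.ofReal (s ^ (-τ)) with hφ
  have hφm : Measurable φ := by fun_prop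
  have hpt : ∀ i, ∀ x ∈ Ioo (a i) (b i),
      ENNReal.ofReal (lebDensity μ x) * ENNReal.ofReal (-Real.log (min (x - a i) (b i - x)))
        ≤ ENNReal.ofReal τ⁻¹ * (ENNReal.ofReal (lebDensity μ x)
          * ENNReal.ofReal |Real.log (lebDensity μ x)| + (1 + φ (min (x - a i) (b i - x)))) := by
    intro i x hx
    set f := lebDensity μ x with hf
    have hf0 : 0 ≤ f := lebDensity_nonneg _ x
    set d := min (x - a i) (b i - x) with hd
    have hd0 : 0 < d := lt_min (sub_pos.2 hx.1) (sub_pos.2 hx.2)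
    have hdp : 0 ≤ d ^ (-τ) := Real.rpow_nonneg hd0.le _
    rw [← ENNReal.ofReal_one, hφ, ← ENNReal.ofReal_add zero_le_one hdp, ← ENNReal.ofReal_mul hf0,
      ← ENNReal.ofReal_mul hf0, ← ENNReal.ofReal_add (by positivity) (by positivity),
      ← ENNReal.ofReal_mul (by positivity)]
    refine ENNReal.ofReal_le_ofReal ?_
    rw [inv_mul_eq_div, le_div_iff₀ hτ0]
    -- Young's inequality at s = -τ log d, for which exp s = d^(-τ): the density is traded for its
    -- entropy and an integrable power of the distance.
    have h1 := mul_le_mul_log_add_exp f (-(Real.log d) * τ) hf0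
    rw [neg_mul_comm, mul_comm f, ← Real.rpow_def_of_pos hd0] at h1
    have h2 := mul_le_mul_of_nonneg_left (le_abs_self (Real.log f)) hf0
    nlinarith
  have hterm : ∀ i, ∫⁻ x in Ioo (a i) (b i), ENNReal.ofReal (-Real.log (min (x - a i) (b i - x))) ∂μ
      ≤ ENNReal.ofReal τ⁻¹ * (κ (Ioo (a i) (b i)) + (volume (Ioo (a i) (b i))
        + 2 * (ENNReal.ofReal (D ^ (δ - τ) / (1 - τ)) * ENNReal.ofReal ((b i - a i) ^ (1 - δ))))) := by
    intro i
    have hl := sub_pos.2 (h.lt i)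
    rw [setLIntegral_eq_lebDensity_mul hμ measurableSet_Ioo (by fun_prop)]
    refine (setLIntegral_mono' measurableSet_Ioo (hpt i)).trans ?_
    rw [lintegral_const_mul _ (by fun_prop), lintegral_add_left (by fun_prop),
      lintegral_add_left measurable_const, setLIntegral_one,
      ← setLIntegral_eq_lebDensity_mul hμ measurableSet_Ioo (by fun_prop), hκ,
      withDensity_apply _ measurableSet_Ioo]
    gcongr
    refine (lintegral_Ioo_comp_min_le _ _ hφm).trans ?_
    gcongr
    rw [lintegral_rpow_neg hl hτ1, ← ENNReal.ofReal_mul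
      (div_nonneg (Real.rpow_nonneg ENNReal.toReal_nonneg _) (by linarith))]
    refine ENNReal.ofReal_le_ofReal ?_
    rw [div_mul_eq_mul_div]
    refine div_le_div_of_nonneg_right ?_ (by linarith)
    rw [show 1 - τ = (δ - τ) + (1 - δ) by ring, Real.rpow_add hl]
    exact mul_le_mul_of_nonneg_right (Real.rpow_le_rpow hl.le (hlD i) (by linarith))
      (Real.rpow_nonneg hl.le _)
  refine (ENNReal.tsum_le_tsum hterm).trans_lt ?_
  rw [ENNReal.tsum_mul_left, ENNReal.tsum_add, ENNReal.tsum_add, ENNReal.tsum_mul_left,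
    ENNReal.tsum_mul_left]
  exact ENNReal.mul_lt_top ENNReal.ofReal_lt_top (ENNReal.add_lt_top.2
    ⟨(h.tsum_measure_le _).trans_lt hκU, ENNReal.add_lt_top.2
      ⟨(h.tsum_measure_le _).trans_lt hU, ENNReal.mul_lt_top (by simp)
        (ENNReal.mul_lt_top ENNReal.ofReal_lt_top hs.tsum_ofReal_lt_top)⟩⟩)

end LogDist
end

noncomputable section

/-! ### Abstract Γ-convergence -/

section GammaLimit

variable {X ι : Type*} [TopologicalSpace X] {G : ι → X → EReal} {G₀ : X → EReal} {l : Filter ι}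

theorem gammaTendsto_of_eventually
    (hinf : ∀ (x : X) (u : ι → X), Tendsto u l (𝓝 x) → ∀ c : ℝ, (c : EReal) < G₀ x →
      ∀ᶠ i in l, (c : EReal) < G i (u i))
    (hsup : ∀ x : X, ∃ u : ι → X, Tendsto u l (𝓝 x) ∧ ∀ c : ℝ, G₀ x < c → ∀ᶠ i in l, G i (u i) < c) :
    GammaTendsto G l G₀ := by
  refine fun x => ⟨fun u hu => ?_, ?_⟩
  · rw [← EReal.ge_of_forall_gt_iff_ge]
    exact fun c hc => le_liminf_of_le (by isBoundedDefault)
      ((hinf x u hu c hc).mono fun _ h => h.le)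
  · obtain ⟨u, hu, h⟩ := hsup x
    refine ⟨u, hu, ?_⟩
    rw [← EReal.le_of_forall_lt_iff_le]
    exact fun c hc => limsup_le_of_le (by isBoundedDefault) ((h c hc).mono fun _ h => h.le)

/-- The fundamental theorem of `Γ`-convergence on a compact space. -/
theorem exists_isLeast_and_tendsto_of_gamma [CompactSpace X] [l.NeBot]
    (hinf : ∀ (x : X) (u : ι → X) (l' : Filter ι), l' ≤ l → Tendsto u l' (𝓝 x) →
      ∀ c : ℝ, (c : EReal) < G₀ x → ∀ᶠ i in l', (c : EReal) < G i (u i))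
    (hsup : ∀ x : X, ∃ u : ι → X, Tendsto u l (𝓝 x) ∧ ∀ c : ℝ, G₀ x < c → ∀ᶠ i in l, G i (u i) < c)
    {v : ι → X} (hv : ∀ᶠ i in l, ∀ x, G i (v i) ≤ G i x) :
    ∃ x₀, (∀ x, G₀ x₀ ≤ G₀ x) ∧ Tendsto (fun i => G i (v i)) l (𝓝 (G₀ x₀)) := by
  -- Ultrafilters play the role of convergent subsequences: along each of them the minimizers
  -- converge by compactness, and the limit minimizes `G₀`. All these limits share one minimal
  -- value, so the bound holds along `l` itself.
  have key : ∀ W : Ultrafilter ι, (W : Filter ι) ≤ l → ∃ x₀, (∀ x, G₀ x₀ ≤ G₀ x) ∧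
      ∀ c : ℝ, (c : EReal) < G₀ x₀ → ∀ᶠ i in (W : Filter ι), (c : EReal) < G i (v i) := by
    intro W hW
    have hlim : Tendsto v (W : Filter ι) (𝓝 (W.map v).lim) := (W.map v).le_nhds_lim
    refine ⟨_, fun x => le_of_not_gt fun hx => ?_, hinf _ v W hW hlim⟩
    obtain ⟨c, hc1, hc2⟩ := EReal.lt_iff_exists_real_btwn.1 hx
    obtain ⟨u, -, hu⟩ := hsup x
    obtain ⟨i, h1, h2, h3⟩ := ((hinf _ v W hW hlim c hc2).and
      (((hu c hc1).filter_mono hW).and (hv.filter_mono hW))).exists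
    exact absurd (h1.trans_le (h3 _)) h2.not_gt
  obtain ⟨x₀, hx₀, -⟩ := key (Ultrafilter.of l) (Ultrafilter.of_le l)
  refine ⟨x₀, hx₀, tendsto_order.2 ⟨fun c hc => ?_, fun c hc => ?_⟩⟩
  · obtain ⟨r, hr1, hr2⟩ := EReal.lt_iff_exists_real_btwn.1 hc
    refine mem_iff_ultrafilter.2 fun W hW => ?_
    obtain ⟨x₁, hx₁, h⟩ := key W hW
    have := le_antisymm (hx₀ x₁) (hx₁ x₀)
    exact (h r (this ▸ hr2)).mono fun i hi => hr1.trans hi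
  · obtain ⟨r, hr1, hr2⟩ := EReal.lt_iff_exists_real_btwn.1 hc
    obtain ⟨u, -, hu⟩ := hsup x₀
    filter_upwards [hu r hr1, hv] with i h1 h2
    exact ((h2 _).trans_lt h1).trans hr2

end GammaLimit

/-! ### Existence of minimizers and the expansion of the minimum -/

section Penalized

variable {μ ν : Measure ℝ} {R : ℝ}

theorem isClosed_transportPlans [IsProbabilityMeasure μ] [IsProbabilityMeasure ν] :
    IsClosed (transportPlans μ ν) := by
  have h : transportPlans μ ν
      = {γ : ProbabilityMeasure (ℝ × ℝ) |
          γ.map (continuous_fst.measurable.aemeasurable) = (⟨μ, ‹_›⟩ : ProbabilityMeasure ℝ)}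
        ∩ {γ : ProbabilityMeasure (ℝ × ℝ) |
          γ.map (continuous_snd.measurable.aemeasurable) = (⟨ν, ‹_›⟩ : ProbabilityMeasure ℝ)} := by
    ext γ
    exact ⟨fun h => ⟨Subtype.ext h.1, Subtype.ext h.2⟩,
      fun h => ⟨congrArg Subtype.val h.1, congrArg Subtype.val h.2⟩⟩
  rw [h]
  exact (isClosed_eq (ProbabilityMeasure.continuous_map continuous_fst) continuous_const).inter
    (isClosed_eq (ProbabilityMeasure.continuous_map continuous_snd) continuous_const)

theorem BoundedMarginals.compactSpace_transportPlans [IsProbabilityMeasure μ]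
    [IsProbabilityMeasure ν] (hR : BoundedMarginals μ ν R) :
    CompactSpace (transportPlans μ ν) := by
  rw [← isCompact_iff_compactSpace, ← (isClosed_transportPlans (μ := μ) (ν := ν)).closure_eq]
  refine isCompact_closure_of_isTightMeasureSet
    (isTightMeasureSet_iff_exists_isCompact_measure_compl_le.2 fun ε _ =>
      ⟨Icc (-R) R ×ˢ Icc (-R) R, isCompact_Icc.prod isCompact_Icc, ?_⟩)
  rintro _ ⟨γ, hγ, rfl⟩
  have : (γ : Measure (ℝ × ℝ)) (Icc (-R) R ×ˢ Icc (-R) R)ᶜ = 0 := hR.ae_mem hγ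
  rw [this]
  exact bot_le

theorem relEnt_nonneg {X : Type*} [MeasurableSpace X] (γ ρ : Measure X) [IsProbabilityMeasure γ]
    [IsProbabilityMeasure ρ] : 0 ≤ relEnt γ ρ := by
  have := le_relEnt (γ := γ) (ρ := ρ) (φ := fun _ => 0) (integrable_const _) (integrable_const _)
  simpa using this

theorem coe_lt_penalizedCost_iff {ε : ℝ} (hε : 0 < ε) {γ : transportPlans μ ν} {c : ℝ} :
    (c : EReal) < penalizedCost μ ν ε γ ↔
      (((c - mongeCost γ.1) / ε : ℝ) : EReal) < relEnt (γ.1 : Measure (ℝ × ℝ)) (μ.prod ν) := by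
  unfold penalizedCost
  induction relEnt (γ.1 : Measure (ℝ × ℝ)) (μ.prod ν) with
  | bot => simp [EReal.coe_mul_bot_of_pos hε]
  | coe r =>
    rw [← EReal.coe_mul, ← EReal.coe_add, EReal.coe_lt_coe_iff, EReal.coe_lt_coe_iff,
      div_lt_iff₀ hε, sub_lt_iff_lt_add', mul_comm r]
  | top => simp [EReal.coe_mul_top_of_pos hε, EReal.coe_lt_top]

/-- The rescaled functional is an increasing affine function of the penalized one. Comparing real
thresholds transfers minimizers and minimal values without arithmetic on infinite values. -/
theorem coe_lt_rescaledCost_iff {ε : ℝ} (hε : 0 < ε) {γ : transportPlans μ ν} {c : ℝ} :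
    (((c - wassersteinOne μ ν) / ε - |Real.log (2 * ε)| * μ.real (coincidenceSet μ ν) : ℝ) : EReal)
      < rescaledCost μ ν ε γ ↔ (c : EReal) < penalizedCost μ ν ε γ := by
  rw [coe_lt_penalizedCost_iff hε]
  unfold rescaledCost
  induction relEnt (γ.1 : Measure (ℝ × ℝ)) (μ.prod ν) with
  | bot => simp
  | coe r =>
    rw [← EReal.coe_add, ← EReal.coe_sub, EReal.coe_lt_coe_iff, EReal.coe_lt_coe_iff,
      sub_lt_sub_iff_right, one_div_mul_eq_div, ← sub_lt_iff_lt_add', ← sub_div,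
      sub_sub_sub_cancel_right]
  | top =>
    rw [EReal.coe_add_top, EReal.top_sub_coe]
    exact iff_of_true (EReal.coe_lt_top _) (EReal.coe_lt_top _)

/-- By duality the entropy is a supremum of functionals that are continuous for narrow convergence,
and the transport energy is continuous on plans. -/
theorem BoundedMarginals.lowerSemicontinuous_penalizedCost [IsProbabilityMeasure μ]
    [IsProbabilityMeasure ν] (hR : BoundedMarginals μ ν R) {ε : ℝ} (hε : 0 < ε) :
    LowerSemicontinuous (penalizedCost μ ν ε) := by
  intro γ y hy
  obtain ⟨c, hyc, hc⟩ := EReal.lt_iff_exists_real_btwn.1 hy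
  rw [coe_lt_penalizedCost_iff hε] at hc
  obtain ⟨ψ, hψ⟩ := exists_boundedContinuous_lt_of_lt_relEnt hc
  have hcont : Continuous fun γ' : transportPlans μ ν => mongeCost γ'.1 + ε *
      (∫ p, ψ p ∂(γ'.1 : Measure (ℝ × ℝ)) - ∫ p, Real.exp (ψ p) ∂(μ.prod ν) + 1) :=
    hR.continuous_mongeCost.add (continuous_const.mul (((
      (ProbabilityMeasure.continuous_integral_boundedContinuousFunction ψ).comp
        continuous_subtype_val).sub continuous_const).add continuous_const))
  rw [probReal_univ, div_lt_iff₀ hε, sub_lt_iff_lt_add', mul_comm _ ε] at hψ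
  filter_upwards [hcont.continuousAt.eventually (lt_mem_nhds hψ)] with γ' h
  refine hyc.trans ((coe_lt_penalizedCost_iff hε).2 ?_)
  obtain ⟨C, hC⟩ : ∃ C, ∀ p, ‖Real.exp (ψ p)‖ ≤ C := ⟨Real.exp ‖ψ‖, fun p => by
    rw [Real.norm_of_nonneg (Real.exp_nonneg _), Real.exp_le_exp]
    exact (le_abs_self _).trans (ψ.norm_coe_le_norm p)⟩
  refine lt_of_lt_of_le ?_ (le_relEnt (φ := ψ) (ψ.integrable _)
    (Integrable.of_bound (Continuous.aestronglyMeasurable (by fun_prop)) C (ae_of_all _ hC)))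
  rw [EReal.coe_lt_coe_iff, probReal_univ, div_lt_iff₀ hε, sub_lt_iff_lt_add', mul_comm _ ε]
  exact h

theorem BoundedMarginals.exists_isLeast_penalizedCost [IsProbabilityMeasure μ]
    [IsProbabilityMeasure ν] (hR : BoundedMarginals μ ν R) {ε : ℝ} (hε : 0 < ε) :
    ∃ (j : ℝ) (γ : transportPlans μ ν), penalizedCost μ ν ε γ = (j : EReal) ∧
      ∀ γ', (j : EReal) ≤ penalizedCost μ ν ε γ' := by
  have := hR.compactSpace_transportPlans
  have hprod : (⟨μ.prod ν, inferInstance⟩ : ProbabilityMeasure (ℝ × ℝ)) ∈ transportPlans μ ν :=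
    ⟨by simp, by simp⟩
  set γ₀ : transportPlans μ ν := ⟨_, hprod⟩ with hγ₀
  obtain ⟨γ, -, hγ⟩ := LowerSemicontinuousOn.exists_isMinOn (s := univ) ⟨γ₀, mem_univ _⟩
    isCompact_univ ((hR.lowerSemicontinuous_penalizedCost hε).lowerSemicontinuousOn _)
  have hmin : ∀ γ', penalizedCost μ ν ε γ ≤ penalizedCost μ ν ε γ' := fun γ' => hγ (mem_univ γ')
  -- The product plan has zero entropy, so the minimum is finite.
  have hself : relEnt (μ.prod ν) (μ.prod ν) = 0 := by
    have := relEnt_withDensity (ρ := μ.prod ν) (D := fun _ => 1) measurable_const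
      (fun _ => zero_le_one) (integrable_const _) (by simp)
    simpa using this
  have htop : penalizedCost μ ν ε γ ≠ ⊤ := by
    refine ((hmin γ₀).trans_lt ?_).ne
    have : penalizedCost μ ν ε γ₀ = mongeCost γ₀.1 + ε * relEnt (μ.prod ν) (μ.prod ν) := rfl
    rw [this, hself, mul_zero, add_zero]
    exact EReal.coe_lt_top _
  have hbot : penalizedCost μ ν ε γ ≠ ⊥ := by
    have : ((mongeCost γ.1 - ε : ℝ) : EReal) < penalizedCost μ ν ε γ := by
      rw [coe_lt_penalizedCost_iff hε, sub_sub_cancel_left, neg_div, div_self hε.ne']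
      exact lt_of_lt_of_le (by exact_mod_cast neg_one_lt_zero) (relEnt_nonneg _ _)
    exact (bot_le.trans_lt this).ne'
  exact ⟨_, γ, (EReal.coe_toReal htop hbot).symm, fun γ' => by
    rw [EReal.coe_toReal htop hbot]; exact hmin γ'⟩

theorem limitCost_ne_bot [IsProbabilityMeasure μ] [IsProbabilityMeasure ν]
    (γ : transportPlans μ ν) : limitCost μ ν γ ≠ ⊥ := by
  unfold limitCost
  split_ifs with h
  · set B := (coincidenceSet μ ν)ᶜ ×ˢ (coincidenceSet μ ν)ᶜ
    have := le_relEnt (γ := (γ.1 : Measure (ℝ × ℝ)).restrict B) (ρ := μ.prod ν) (φ := fun _ => 0)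
      (integrable_const _) (integrable_const _)
    have hb : relEnt ((γ.1 : Measure (ℝ × ℝ)).restrict B) (μ.prod ν) ≠ ⊥ :=
      ((EReal.bot_lt_coe _).trans_le this).ne'
    generalize relEnt ((γ.1 : Measure (ℝ × ℝ)).restrict B) (μ.prod ν) = e at hb ⊢
    induction e with
    | bot => exact absurd rfl hb
    | coe r => rw [← EReal.coe_sub]; exact EReal.coe_ne_bot _
    | top => rw [EReal.top_sub_coe]; exact top_ne_bot
  · exact top_ne_bot

/-- The first order expansion of the minimal penalized energy. -/
theorem BoundedMarginals.exists_expansion [IsProbabilityMeasure μ] [IsProbabilityMeasure ν]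
    (hR : BoundedMarginals μ ν R)
    (hfr : volume (frontier (coincidenceSet μ ν ∩ μ.support)) = 0)
    (hlog : Integrable (fun x => Real.log (lebDensity μ x)) μ)
    (hfin : ∃ γ, limitCost μ ν γ < ⊤) :
    ∃ (j : ℝ → ℝ) (m : ℝ),
      (∀ ε : ℝ, 0 < ε → IsLeast (range (penalizedCost μ ν ε)) ((j ε : ℝ) : EReal)) ∧
      IsLeast (range (limitCost μ ν)) ((m : ℝ) : EReal) ∧
      (fun ε : ℝ => j ε -
          (wassersteinOne μ ν + ε * |Real.log (2 * ε)| * μ.real (coincidenceSet μ ν) + ε * m))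
        =o[𝓝[>] 0] fun ε : ℝ => ε := by
  have := hR.compactSpace_transportPlans
  have : Nonempty (transportPlans μ ν) := ⟨hfin.choose⟩
  have hex := fun ε (hε : 0 < ε) => hR.exists_isLeast_penalizedCost hε
  choose! j v hv hj using hex
  set W := wassersteinOne μ ν with hW
  set L : ℝ → ℝ := fun ε => |Real.log (2 * ε)| * μ.real (coincidenceSet μ ν) with hL
  have hmin : ∀ ε, 0 < ε → ∀ γ, rescaledCost μ ν ε (v ε) ≤ rescaledCost μ ν ε γ := by
    intro ε hε γ
    refine le_of_forall_lt fun c hc => ?_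
    obtain ⟨r, hr1, hr2⟩ := EReal.lt_iff_exists_real_btwn.1 hc
    -- Every real threshold r of the rescaled functional is the image of the threshold (r + L)ε + W
    -- of the penalized one.
    have hr : ((r + L ε) * ε + W - W) / ε - L ε = r := by field_simp; ring
    refine hr1.trans ?_
    rw [← hr, coe_lt_rescaledCost_iff hε] at hr2 ⊢
    rw [hv ε hε] at hr2
    exact hr2.trans_le (hj ε hε γ)
  have hval : ∀ ε, 0 < ε → rescaledCost μ ν ε (v ε) = (((j ε - W) / ε - L ε : ℝ) : EReal) := by
    intro ε hε
    refine le_antisymm ?_ ?_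
    · refine le_of_not_gt fun h => ?_
      rw [coe_lt_rescaledCost_iff hε, hv ε hε] at h
      exact lt_irrefl _ h
    · rw [← EReal.ge_of_forall_gt_iff_ge]
      intro r hr
      have hr' : ((r + L ε) * ε + W - W) / ε - L ε = r := by field_simp; ring
      refine le_of_lt ?_
      rw [← hr', coe_lt_rescaledCost_iff hε, hv ε hε, EReal.coe_lt_coe_iff]
      rw [EReal.coe_lt_coe_iff, lt_sub_iff_add_lt, lt_div_iff₀ hε] at hr
      linarith
  obtain ⟨γ, hγ, hlim⟩ := exists_isLeast_and_tendsto_of_gamma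
    (fun γ u l' hl' hu c hc => hR.eventually_lt_rescaledCost hfr hlog hl' hu hc)
    (hR.exists_recoverySequence hfr hlog)
    (v := v) (by filter_upwards [self_mem_nhdsWithin] with ε hε using hmin ε hε)
  have htop : limitCost μ ν γ ≠ ⊤ := by
    obtain ⟨γ', h⟩ := hfin
    exact ((hγ γ').trans_lt h).ne
  obtain ⟨m, hm⟩ : ∃ m : ℝ, limitCost μ ν γ = (m : EReal) :=
    ⟨_, (EReal.coe_toReal htop (limitCost_ne_bot γ)).symm⟩
  refine ⟨j, m, fun ε hε => ⟨⟨v ε, hv ε hε⟩, ?_⟩, ⟨⟨γ, hm⟩, ?_⟩, ?_⟩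
  · rintro _ ⟨γ', rfl⟩
    exact hj ε hε γ'
  · rintro _ ⟨γ', rfl⟩
    exact hm ▸ hγ γ'
  · have h1 : Tendsto (fun ε => (j ε - W) / ε - L ε) (𝓝[>] 0) (𝓝 m) := by
      rw [← EReal.tendsto_coe, ← hm]
      refine hlim.congr' ?_
      filter_upwards [self_mem_nhdsWithin] with ε hε using hval ε hε
    rw [Asymptotics.isLittleO_iff_tendsto' (by
      filter_upwards [self_mem_nhdsWithin] with ε (hε : 0 < ε) h using absurd h hε.ne')]
    have h2 := h1.sub_const m
    rw [sub_self] at h2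
    refine h2.congr' ?_
    filter_upwards [self_mem_nhdsWithin] with ε (hε : 0 < ε)
    simp only [hL]
    field_simp
    ring

end Penalized
end

/-! ### Assembly of the theorem -/

noncomputable section

theorem ac_of_relEnt_lt_top {X : Type*} [MeasurableSpace X] {γ ρ : Measure X}
    (h : relEnt γ ρ < ⊤) : γ ≪ ρ := by
  by_contra hn
  rw [relEnt, if_neg hn] at h
  exact lt_irrefl _ h

theorem exists_support_subset_Icc {μ ν : Measure ℝ} (hμ : Bornology.IsBounded μ.support)
    (hν : Bornology.IsBounded ν.support) :
    ∃ R : ℝ, 0 < R ∧ μ.support ⊆ Icc (-R) R ∧ ν.support ⊆ Icc (-R) R := by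
  obtain ⟨R, hR0, hR⟩ := (hμ.union hν).subset_closedBall_lt 0 0
  rw [Real.closedBall_eq_Icc, zero_sub, zero_add, union_subset_iff] at hR
  exact ⟨R, hR0, hR⟩

end

theorem theorem4p1 (μ ν : Measure ℝ) [IsProbabilityMeasure μ] [IsProbabilityMeasure ν]
    (hμ_supp : Bornology.IsBounded μ.support) (hν_supp : Bornology.IsBounded ν.support)
    (hμ_ent : relEnt μ volume < ⊤) (hν_ent : relEnt ν volume < ⊤)
    {ι : Type*} (a b : ι → ℝ)
    (hab : IsDisjointIntervalUnion (interior (coincidenceSet μ ν ∩ μ.support)) a b) :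
    -- both measures are absolutely continuous
    μ ≪ volume ∧ ν ≪ volume ∧
    -- first sufficient condition for the logarithmic integrability condition
    ((∃ C : ℝ, ∀ᵐ x ∂(volume.restrict (coincidenceSet μ ν)),
          μ.rnDeriv volume x ≤ ENNReal.ofReal C) →
        Summable (fun i => |a i - b i| * |Real.log (|a i - b i|)|) →
        LogDistSummable μ a b) ∧
    -- second sufficient condition for the logarithmic integrability condition
    ((∃ δ : ℝ, 0 < δ ∧ Summable (fun i => |a i - b i| ^ (1 - δ))) →
        LogDistSummable μ a b) ∧
    -- main result
    (volume (frontier (coincidenceSet μ ν ∩ μ.support)) = 0 →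
      LogDistSummable μ a b →
      (∃ γ ∈ optimalPlans μ ν,
        relEnt ((γ : Measure (ℝ × ℝ)).restrict
          ((coincidenceSet μ ν)ᶜ ×ˢ (coincidenceSet μ ν)ᶜ)) (μ.prod ν) < ⊤) →
      -- the constant in the limit functional is a genuine integral
      IntegrableOn (fun x => Real.log (μ.rnDeriv volume x).toReal) (coincidenceSet μ ν) μ ∧
      GammaTendsto (rescaledCost μ ν) (𝓝[>] 0) (limitCost μ ν) ∧
      -- both minima exist and are finite, and the asymptotic expansion holds
      ∃ (j : ℝ → ℝ) (m : ℝ),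
        (∀ ε : ℝ, 0 < ε → IsLeast (Set.range (penalizedCost μ ν ε)) ((j ε : ℝ) : EReal)) ∧
        IsLeast (Set.range (limitCost μ ν)) ((m : ℝ) : EReal) ∧
        (fun ε : ℝ => j ε -
            (wassersteinOne μ ν + ε * |Real.log (2 * ε)| * μ.real (coincidenceSet μ ν) + ε * m))
          =o[𝓝[>] 0] fun ε : ℝ => ε) := by
  have hμ := ac_of_relEnt_lt_top hμ_ent
  have hν := ac_of_relEnt_lt_top hν_ent
  obtain ⟨R, hR0, hμR, hνR⟩ := exists_support_subset_Icc hμ_supp hν_supp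
  have hR : BoundedMarginals μ ν R := ⟨hR0, hμ, hν,
    measure_mono_null (compl_subset_compl.2 hμR) Measure.measure_compl_support,
    measure_mono_null (compl_subset_compl.2 hνR) Measure.measure_compl_support⟩
  -- Bounded support makes the negative part of the entropy relative to Lebesgue measure finite, so
  -- finite entropy gives integrability on the whole line.
  have hlog : Integrable (fun x => Real.log (lebDensity μ x)) μ :=
    (ac_and_integrable_of_relEnt_lt_top measurableSet_Icc hR.left
      (isCompact_Icc.measure_lt_top) hμ_ent).2
  have hU : volume (interior (coincidenceSet μ ν ∩ μ.support)) < ⊤ :=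
    (measure_mono ((interior_subset.trans inter_subset_right).trans hμR)).trans_lt
      isCompact_Icc.measure_lt_top
  refine ⟨hμ, hν, fun ⟨C, hC⟩ hs => ?_, fun ⟨δ, hδ, hs⟩ => ?_, fun hfr _ ⟨γ, hγ, hent⟩ => ?_⟩
  · exact hab.logDistSummable_of_bounded hU hμ (interior_subset.trans inter_subset_left) hC hs
  · exact hab.logDistSummable_of_rpow hU hμ hlog hδ hs
  refine ⟨hlog.integrableOn, gammaTendsto_of_eventually
    (fun γ u hu c hc => hR.eventually_lt_rescaledCost hfr hlog le_rfl hu hc)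
    (hR.exists_recoverySequence hfr hlog), hR.exists_expansion hfr hlog ⟨⟨γ, hγ.1⟩, ?_⟩⟩
  rw [limitCost, if_pos hγ]
  refine lt_top_iff_ne_top.2 fun h => ?_
  rw [sub_eq_add_neg, ← EReal.coe_neg] at h
  exact (EReal.add_lt_top hent.ne (EReal.coe_ne_top _)).ne h
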